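/- For an elliptic curve $E/\mathbb{Q}$ and $d \in \mathbb{Q}^\times$ let $E^d/\mathbb{Q}$ denote the quadratic twist of $E$ by $d$; the twist is called nontrivial if $d$ is not a square in $\mathbb{Q}$. We say that $E$ has CM if its ring of geometric endomorphisms $\operatorname{End}_{\overline{\mathbb{Q}}}(E)$ is strictly larger than $\mathbb{Z}$, and that $E$ has CM by a ring $\mathcal{O}$ if $\operatorname{End}_{\overline{\mathbb{Q}}}(E) \cong \mathcal{O}$. Let $E/\mathbb{Q}$ be an elliptic curve. There exists an isogeny defined over $\mathbb{Q}$ from $E$ to a nontrivial quadratic twist $E^d$ of $E$ if and only if $E$ has CM. More precisely, if $E$ has CM by an imaginary quadratic order $\mathcal{O}$ of discriminant $-D$, then there is an isogeny $E \to E^{-D}$ of degree $D$ defined over $\mathbb{Q}$. Moreover, if $4$ divides $D$, then there is also an isogeny $E \to E^{-D}$ of degree $D/4$ defined over $\mathbb{Q}$. -/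

import Mathlib

open scoped Polynomial.Bivariate

noncomputable section

namespace WeierstrassCurve

/-- The quadratic twist `E^d` of a Weierstrass curve `E` over `ℚ`: if
`y² = x³ + (b₂/4) x² + (b₄/2) x + b₆/4` is obtained from `E` by completing the square, then `E^d` is
`d y² = x³ + (b₂/4) x² + (b₄/2) x + b₆/4`, rescaled to the Weierstrass equation
`y² = x³ + d (b₂/4) x² + d² (b₄/2) x + d³ (b₆/4)`. -/
def quadraticTwist (E : WeierstrassCurve ℚ) (d : ℚ) : WeierstrassCurve ℚ where
  a₁ := 0
  a₂ := d * (E.b₂ / 4)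
  a₃ := 0
  a₄ := d ^ 2 * (E.b₄ / 2)
  a₆ := d ^ 3 * (E.b₆ / 4)

/-- The discriminant of the quadratic twist by `d`. -/
lemma quadraticTwist_Δ (E : WeierstrassCurve ℚ) (d : ℚ) :
    (E.quadraticTwist d).Δ = d ^ 6 * E.Δ := by
  simp only [quadraticTwist, Δ, b₂, b₄, b₆, b₈]
  ring

/-- The quadratic twist of an elliptic curve by `d ≠ 0` is an elliptic curve. -/
lemma quadraticTwist_isElliptic (E : WeierstrassCurve ℚ) [hE : E.IsElliptic] {d : ℚ} (hd : d ≠ 0) :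
    (E.quadraticTwist d).IsElliptic := by
  constructor
  rw [quadraticTwist_Δ]
  exact ((isUnit_iff_ne_zero.mpr hd).pow 6).mul hE.isUnit

section Isogeny

variable {K : Type*} [Field K] (k L : Type*) [Field k] [Field L]
  [Algebra K k] [Algebra K L] [Algebra k L]

/-- The rational function `f ∈ k(W)` is regular at the affine point `(x, y)` (with coordinates in an
extension `L` of `k`) and takes the value `v` there: `f` is a quotient `a / b` of polynomials in the
coordinates with `b(x, y) ≠ 0` and `a(x, y) / b(x, y) = v`. -/
def HasValueAt (W : WeierstrassCurve K) (f : (W⁄k).toAffine.FunctionField) (x y v : L) : Prop :=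
  ∃ a b : k[X][Y],
    Polynomial.aevalAeval x y b ≠ 0 ∧
    f * algebraMap _ (W⁄k).toAffine.FunctionField (Affine.CoordinateRing.mk (W⁄k).toAffine b) =
      algebraMap _ (W⁄k).toAffine.FunctionField (Affine.CoordinateRing.mk (W⁄k).toAffine a) ∧
    Polynomial.aevalAeval x y a = v * Polynomial.aevalAeval x y b

/-- An isogeny `W → W'` defined over the field `k`, where `L` is an algebraically closed
extension of `k`: a nonzero homomorphism `W(L) → W'(L)` that is a morphism of curves over `k`, that
is, composition with it maps the field `k(W')` of rational functions on `W'` into the field `k(W)`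
of rational functions on `W`. The map `f ↦ f ∘ φ` on rational functions is `pullback`. -/
structure Isogeny [IsScalarTower K k L] [DecidableEq L] (W W' : WeierstrassCurve K) where
  /-- The homomorphism on geometric points. -/
  toHom : (W⁄L).toAffine.Point →+ (W'⁄L).toAffine.Point
  /-- The homomorphism of function fields `f ↦ f ∘ φ`. -/
  pullback : (W'⁄k).toAffine.FunctionField →ₐ[k] (W⁄k).toAffine.FunctionField
  toHom_ne_zero : toHom ≠ 0
  pullback_hasValueAt : ∀ (x y x' y' : L) (h : (W⁄L).toAffine.Nonsingular x y)
    (h' : (W'⁄L).toAffine.Nonsingular x' y'),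
    toHom (.some x y h) = .some x' y' h' →
    ∀ (f : (W'⁄k).toAffine.FunctionField) (v : L),
      HasValueAt k L W' f x' y' v → HasValueAt k L W (pullback f) x y v

variable {k L}

/-- The degree `[k(W) : φ^* k(W')]` of an isogeny. -/
def Isogeny.degree [IsScalarTower K k L] [DecidableEq L] {W W' : WeierstrassCurve K}
    (φ : Isogeny k L W W') : ℕ :=
  Module.finrank φ.pullback.fieldRange (W⁄k).toAffine.FunctionField

end Isogeny

section ComplexMultiplication

variable [DecidableEq (AlgebraicClosure ℚ)]

/-- The underlying set of the geometric endomorphism ring of `E`, inside the ring of all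
endomorphisms of the abelian group of geometric points (addition is pointwise and multiplication is
composition): the zero map and the isogenies `E → E` defined over the algebraic closure of `ℚ`. -/
def geometricEnd (E : WeierstrassCurve ℚ) :
    Set (AddMonoid.End (E⁄(AlgebraicClosure ℚ)).toAffine.Point) :=
  {f | f = 0 ∨ ∃ φ : Isogeny (AlgebraicClosure ℚ) (AlgebraicClosure ℚ) E E, φ.toHom = f}

/-- `E` has complex multiplication: it has a geometric endomorphism that is not multiplication by
an integer. -/
def HasCM (E : WeierstrassCurve ℚ) : Prop :=
  ∃ f ∈ E.geometricEnd, ∀ m : ℤ, ∃ P, f P ≠ m • P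

/-- `E` has complex multiplication by the ring `O`: the geometric endomorphism ring of `E` is
isomorphic to `O`. -/
def HasCMBy (E : WeierstrassCurve ℚ) (O : Type*) [Ring O] : Prop :=
  ∃ ι : O →+* AddMonoid.End (E⁄(AlgebraicClosure ℚ)).toAffine.Point,
    Function.Injective ι ∧ Set.range ι = E.geometricEnd

end ComplexMultiplication

end WeierstrassCurve

/-- `F` is an imaginary quadratic field and the subring `O` is an order in `F` of
discriminant `Δ`. (Two elements of `F` that are linearly independent over `ℤ` span `F` over `ℚ`, so
that a subring that is free of rank two over `ℤ` is an order.) -/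
structure IsImaginaryQuadraticOrder (F : Type*) [Field F] [NumberField F] (O : Subalgebra ℤ F)
    (Δ : ℤ) : Prop where
  finrank_eq_two : Module.finrank ℚ F = 2
  isTotallyComplex : NumberField.IsTotallyComplex F
  exists_basis_discr_eq : ∃ b : Module.Basis (Fin 2) ℤ O, Algebra.discr ℤ b = Δ

end

section

open Polynomial Filter

set_option linter.unusedSectionVars false

noncomputable section

namespace WeierstrassCurve

/-! ### Points in the coordinates `(x, η)` and the group law -/

section Points

variable {F : Type*} [Field F] [CharZero F]

/-! Write a Weierstrass curve as `η² = cubic(x)`. A nonzero homomorphism of curves is odd, so it has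
the form `(x, η) ↦ (r(x), η s(x))` with rational functions `r`, `s` (`Isogeny.exists_rep`).
Conversely such a pair defines an isogeny over any field containing its coefficients
(`Rep.exists_isogeny`), of degree equal to the degree of `r` as a self-map of the projective line.
Two invariants of such a homomorphism carry the argument.

The first is the degree. It is multiplicative, and it satisfies the parallelogram law
(`IsRegularHom.homDeg_parallelogram`), so it is a positive definite integral quadratic form on the
endomorphism ring. Hence every endomorphism `a` satisfies `a² - t a + deg a = 0` for an integer `t`.
If `a` is not an integer, then `g = 2a - t` satisfies `g² = -M` with `M > 0`, and `deg g = M`.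

The second is the constant `c` in `r' = c s`, the factor by which the invariant differential `dx/η`
is multiplied under pullback. It is additive and multiplicative, and in characteristic zero it
determines the homomorphism (`HasTangent.ext`). If `g² = -M` then `c² = -M`, so a Galois conjugate
of `g` has constant `±c` and equals `±g`. Hence `r` is Galois invariant and descends to `ℚ(x)`,
while `s = r'/c`. Scaling by `u = e c` with `e` rational maps `E` to its twist by `u² = -e² M`, and
after composition with it both coordinate functions are rational. This gives an isogeny over `ℚ` of
degree `M` to the twist (`exists_isogeny_quadraticTwist`).

Conversely, an isogeny over `ℚ` to `E^d` has a rational constant `q`. Followed by the geometric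
isomorphism `E^d → E` it becomes an endomorphism with constant `q √d`, which is not an integer when
`d` is not a square.

For an order of discriminant `-D`, the ring itself contains a square root `δ` of `-D`, and `δ/2` as
well when `4 ∣ D` (`exists_sq_eq_discr`). The elements `δ` and `δ/2` produce the isogenies of
degrees `D` and `D/4`. -/

/-- The monic cubic `x³ + (b₂/4) x² + (b₄/2) x + b₆/4` whose roots are the `x`-coordinates of the
points of order two. -/
def cubic (W : WeierstrassCurve F) : F[X] :=
  X ^ 3 + C (W.b₂ / 4) * X ^ 2 + C (W.b₄ / 2) * X + C (W.b₆ / 4)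

lemma aeval_cubic (W : WeierstrassCurve F) {A : Type*} [CommRing A] [Algebra F A] (x : A) :
    aeval x W.cubic = x ^ 3 + algebraMap F A (W.b₂ / 4) * x ^ 2 + algebraMap F A (W.b₄ / 2) * x +
      algebraMap F A (W.b₆ / 4) := by
  simp only [cubic, map_add, map_mul, map_pow, aeval_X, aeval_C]

lemma eval_cubic (W : WeierstrassCurve F) (x : F) :
    W.cubic.eval x = x ^ 3 + W.b₂ / 4 * x ^ 2 + W.b₄ / 2 * x + W.b₆ / 4 := by
  simp [cubic]

lemma cubic_monic (W : WeierstrassCurve F) : W.cubic.Monic := by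
  unfold cubic; monicity!

/-- `P` is the affine point with coordinates `(x, y)`, where `η = y + (a₁ x + a₃) / 2`. -/
def IsPt {W : WeierstrassCurve F} (P : W.toAffine.Point) (x η : F) : Prop :=
  ∃ h : W.toAffine.Nonsingular x (η - (W.a₁ * x + W.a₃) / 2), P = .some _ _ h

variable {W : WeierstrassCurve F}

lemma isPt_some {x y : F} (h : W.toAffine.Nonsingular x y) :
    IsPt (.some x y h) x (y + (W.a₁ * x + W.a₃) / 2) := by
  refine ⟨by simpa using h, ?_⟩
  simp

lemma exists_isPt {P : W.toAffine.Point} (hP : P ≠ 0) : ∃ x η, IsPt P x η := by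
  rcases P with _ | ⟨x, y, h⟩
  · exact absurd rfl hP
  · exact ⟨_, _, isPt_some h⟩

namespace IsPt

variable {P Q : W.toAffine.Point} {x η x' η' : F}

lemma ne_zero (h : IsPt P x η) : P ≠ 0 := by
  obtain ⟨h, rfl⟩ := h
  exact Affine.Point.some_ne_zero h

lemma unique (h : IsPt P x η) (h' : IsPt P x' η') : x = x' ∧ η = η' := by
  obtain ⟨h, rfl⟩ := h
  obtain ⟨h', e⟩ := h'
  simp only [Affine.Point.some.injEq] at e
  obtain ⟨rfl, e⟩ := e
  exact ⟨rfl, by simpa using e⟩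

lemma ext (h : IsPt P x η) (h' : IsPt Q x η) : P = Q := by
  obtain ⟨h, rfl⟩ := h
  obtain ⟨h', rfl⟩ := h'
  rfl

lemma eq (h : IsPt P x η) : η ^ 2 = W.cubic.eval x := by
  obtain ⟨h, rfl⟩ := h
  have := (W.toAffine.equation_iff _ _).mp h.1
  rw [eval_cubic, b₂, b₄, b₆]
  linear_combination this

lemma neg [DecidableEq F] (h : IsPt P x η) : IsPt (-P) x (-η) := by
  obtain ⟨h, rfl⟩ := h
  rw [Affine.Point.neg_some]
  have e : W.toAffine.negY x (η - (W.a₁ * x + W.a₃) / 2) = -η - (W.a₁ * x + W.a₃) / 2 := by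
    simp only [Affine.negY, toAffine]; ring
  refine ⟨e ▸ (Affine.nonsingular_neg ..).mpr h, ?_⟩
  rw [Affine.Point.some.injEq]
  exact ⟨rfl, e⟩

lemma of_eq [W.IsElliptic] (h : η ^ 2 = W.cubic.eval x) : ∃ P : W.toAffine.Point, IsPt P x η := by
  have : W.toAffine.Equation x (η - (W.a₁ * x + W.a₃) / 2) := by
    rw [Affine.equation_iff]
    rw [eval_cubic, b₂, b₄, b₆] at h
    linear_combination h
  exact ⟨_, Affine.equation_iff_nonsingular.mp this, rfl⟩

lemma eq_or_eq_neg [DecidableEq F] (h : IsPt P x η) (h' : IsPt Q x η') : P = Q ∨ P = -Q := by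
  have : η ^ 2 = η' ^ 2 := by rw [h.eq, h'.eq]
  rcases sq_eq_sq_iff_eq_or_eq_neg.mp this with rfl | rfl
  · exact .inl (h.ext h')
  · exact .inr (h.ext h'.neg)

lemma add [DecidableEq F] (h : IsPt P x η) (h' : IsPt Q x' η') (hx : x ≠ x') :
    IsPt (P + Q) (((η - η') / (x - x')) ^ 2 - W.b₂ / 4 - x - x')
      (-((η - η') / (x - x') * (((η - η') / (x - x')) ^ 2 - W.b₂ / 4 - x - x' - x) + η)) := by
  obtain ⟨h, rfl⟩ := h
  obtain ⟨h', rfl⟩ := h'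
  rw [Affine.Point.add_some (by simp [hx])]
  have hs : W.toAffine.slope x x' (η - (W.a₁ * x + W.a₃) / 2) (η' - (W.a₁ * x' + W.a₃) / 2) =
      (η - η') / (x - x') - W.a₁ / 2 := by
    rw [Affine.slope_of_X_ne hx]
    field_simp [sub_ne_zero.mpr hx]
    ring
  generalize (η - η') / (x - x') = l at hs
  convert isPt_some _ using 1
  · rw [hs, Affine.addX, b₂]; ring
  · rw [hs, Affine.addY, Affine.negY, Affine.negAddY, Affine.addX, b₂]; ring
  · infer_instance

lemma double [DecidableEq F] (h : IsPt P x η) (hη : η ≠ 0) :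
    IsPt (P + P) ((W.cubic.derivative.eval x / (2 * η)) ^ 2 - W.b₂ / 4 - x - x)
      (-(W.cubic.derivative.eval x / (2 * η) *
        ((W.cubic.derivative.eval x / (2 * η)) ^ 2 - W.b₂ / 4 - x - x - x) + η)) := by
  obtain ⟨h, rfl⟩ := h
  have hy : η - (W.a₁ * x + W.a₃) / 2 ≠ W.toAffine.negY x (η - (W.a₁ * x + W.a₃) / 2) := by
    rw [Affine.negY, ← sub_ne_zero]
    convert mul_ne_zero (two_ne_zero' F) hη using 1
    ring
  rw [Affine.Point.add_some (by simpa using hy)]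
  have hs : W.toAffine.slope x x (η - (W.a₁ * x + W.a₃) / 2) (η - (W.a₁ * x + W.a₃) / 2) =
      W.cubic.derivative.eval x / (2 * η) - W.a₁ / 2 := by
    rw [Affine.slope_of_Y_ne rfl hy]
    have : η - (W.a₁ * x + W.a₃) / 2 - W.toAffine.negY x (η - (W.a₁ * x + W.a₃) / 2) = 2 * η := by
      rw [Affine.negY]; ring
    rw [this]
    simp only [cubic, derivative_add, derivative_X_pow, derivative_mul, derivative_C, derivative_X,
      eval_add, eval_mul, eval_C, eval_X, eval_pow, b₂, b₄, eval_zero, eval_one]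
    field_simp
    push_cast
    ring
  generalize W.cubic.derivative.eval x / (2 * η) = l at hs
  convert isPt_some _ using 1
  · rw [hs, Affine.addX, b₂]; ring
  · rw [hs, Affine.addY, Affine.negY, Affine.negAddY, Affine.addX, b₂]; ring
  · infer_instance

end IsPt

/-- A common root `x` would make `(x, 0)` a singular point of the curve. -/
lemma cubic_isCoprime_derivative [IsAlgClosed F] [W.IsElliptic] :
    IsCoprime W.cubic W.cubic.derivative := by
  rw [isCoprime_iff_aeval_ne_zero_of_isAlgClosed F F]
  intro x
  by_contra! h
  simp only [coe_aeval_eq_eval] at h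
  obtain ⟨P, hP, -⟩ := IsPt.of_eq (W := W) (x := x) (η := 0) (by simp [h.1])
  have h2 := h.2
  simp only [cubic, derivative_add, derivative_X_pow, derivative_mul, derivative_C, derivative_X,
    eval_add, eval_mul, eval_C, eval_X, eval_pow, b₂, b₄, eval_zero, eval_one] at h2
  rw [Affine.nonsingular_iff] at hP
  simp only [toAffine] at hP
  rcases hP.2 with h3 | h3
  · apply h3
    push_cast at h2
    linear_combination -h2
  · apply h3
    ring

/-- All but finitely many points have an `x`-coordinate outside a given finite set. -/
lemma eventually_isPt {p : F → Prop} (hp : ∀ᶠ x in cofinite, p x) :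
    ∀ᶠ P : W.toAffine.Point in cofinite, ∀ x η, IsPt P x η → p x := by
  classical
  rw [eventually_cofinite] at hp ⊢
  have hfin : ∀ x : F, {P : W.toAffine.Point | ∃ η, IsPt P x η}.Finite := by
    intro x
    by_cases h : ∃ P : W.toAffine.Point, ∃ η, IsPt P x η
    · obtain ⟨P, η, hP⟩ := h
      apply Set.Finite.subset (Set.toFinite {P, -P})
      rintro Q ⟨η', hQ⟩
      exact hQ.eq_or_eq_neg hP
    · convert Set.finite_empty
      ext P
      simpa using fun η hη => h ⟨P, η, hη⟩
  refine (hp.biUnion fun x _ => hfin x).subset fun P hP => ?_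
  simp only [Set.mem_ofPred_eq, not_forall] at hP
  obtain ⟨x, η, hP, hx⟩ := hP
  exact Set.mem_biUnion hx ⟨η, hP⟩

lemma IsPt.eventually_ne_zero : ∀ᶠ P : W.toAffine.Point in cofinite, P ≠ 0 := by
  simp [eventually_cofinite]

section Infinite

variable [IsAlgClosed F] [W.IsElliptic]

lemma exists_isPt_of_x (x : F) : ∃ (P : W.toAffine.Point) (η : F), IsPt P x η := by
  obtain ⟨η, h⟩ := IsAlgClosed.exists_pow_nat_eq (W.cubic.eval x) two_pos
  obtain ⟨P, hP⟩ := IsPt.of_eq h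
  exact ⟨P, η, hP⟩

instance : Infinite W.toAffine.Point := by
  choose P η h using exists_isPt_of_x (W := W)
  refine Infinite.of_injective P fun x y e => ?_
  have := h x
  rw [e] at this
  exact (this.unique (h y)).1

/-- A property of `x`-coordinates that holds for all but finitely many points holds for all but
finitely many values of `x`. -/
lemma eventually_of_isPt {p : F → Prop}
    (h : ∀ᶠ P : W.toAffine.Point in cofinite, ∀ x η, IsPt P x η → p x) :
    ∀ᶠ x in cofinite, p x := by
  choose P η hP using exists_isPt_of_x (W := W)
  have hinj : Function.Injective P := fun x y e => by
    have := hP x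
    rw [e] at this
    exact (this.unique (hP y)).1
  filter_upwards [hinj.tendsto_cofinite.eventually h] with x hx
  exact hx _ _ (hP x)

end Infinite

end Points
end WeierstrassCurve

/-! ### Rational functions: values at points -/

namespace RatFunc

section Eval

variable {L : Type*} [Field L]

/-- The value of a rational function at a point. -/
abbrev ev (x : L) (r : RatFunc L) : L := r.eval (RingHom.id L) x

/-- The rational function `r` has no pole at `x`. -/
def RegAt (x : L) (r : RatFunc L) : Prop := r.denom.eval x ≠ 0

lemma ev_def (x : L) (r : RatFunc L) : ev x r = r.num.eval x / r.denom.eval x := rfl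

lemma eventually_eval_ne_zero {p : L[X]} (hp : p ≠ 0) : ∀ᶠ x in cofinite, p.eval x ≠ 0 := by
  rw [eventually_cofinite]
  simpa using (p.rootSet_finite L).subset fun x hx => by
    simpa [mem_rootSet, hp] using hx

lemma eventually_regAt (r : RatFunc L) : ∀ᶠ x in cofinite, RegAt x r :=
  eventually_eval_ne_zero r.denom_ne_zero

lemma algebraMap_ne_zero_of_eval {x : L} {q : L[X]} (hq : q.eval x ≠ 0) :
    algebraMap L[X] (RatFunc L) q ≠ 0 :=
  algebraMap_ne_zero fun h => hq (by simp [h])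

lemma regAt_div {x : L} {p q : L[X]} (hq : q.eval x ≠ 0) :
    RegAt x (algebraMap L[X] (RatFunc L) p / algebraMap L[X] (RatFunc L) q) ∧
      ev x (algebraMap L[X] (RatFunc L) p / algebraMap L[X] (RatFunc L) q) =
        p.eval x / q.eval x := by
  set r := algebraMap L[X] (RatFunc L) p / algebraMap L[X] (RatFunc L) q
  have hq0 : q ≠ 0 := fun h => hq (by simp [h])
  have h1 : r.num * q = p * r.denom := (num_mul_eq_mul_denom_iff hq0).mpr rfl
  have h2 : RegAt x r := fun h => hq <|
    eval_eq_zero_of_dvd_of_eval_eq_zero (denom_div_dvd p q) h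
  refine ⟨h2, ?_⟩
  rw [ev_def, div_eq_div_iff h2 hq]
  simpa using congr(Polynomial.eval x $h1)

lemma exists_div (r : RatFunc L) {x : L} (hr : RegAt x r) : ∃ p q : L[X], q.eval x ≠ 0 ∧
    r = algebraMap L[X] (RatFunc L) p / algebraMap L[X] (RatFunc L) q :=
  ⟨r.num, r.denom, hr, r.num_div_denom.symm⟩

namespace RegAt

variable {x : L} {r s : RatFunc L}

lemma add (hr : RegAt x r) (hs : RegAt x s) :
    RegAt x (r + s) ∧ ev x (r + s) = ev x r + ev x s := by
  obtain ⟨p, q, hq, rfl⟩ := exists_div r hr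
  obtain ⟨p', q', hq', rfl⟩ := exists_div s hs
  rw [div_add_div _ _ (algebraMap_ne_zero_of_eval hq) (algebraMap_ne_zero_of_eval hq'),
    ← map_mul, ← map_mul, ← map_mul, ← map_add]
  have := regAt_div (x := x) (p := p * q' + q * p') (q := q * q') (by simp [hq, hq'])
  refine ⟨this.1, ?_⟩
  rw [this.2, (regAt_div hq).2, (regAt_div hq').2, div_add_div _ _ hq hq']
  simp

lemma mul (hr : RegAt x r) (hs : RegAt x s) :
    RegAt x (r * s) ∧ ev x (r * s) = ev x r * ev x s := by
  obtain ⟨p, q, hq, rfl⟩ := exists_div r hr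
  obtain ⟨p', q', hq', rfl⟩ := exists_div s hs
  rw [div_mul_div_comm, ← map_mul, ← map_mul]
  have := regAt_div (x := x) (p := p * p') (q := q * q') (by simp [hq, hq'])
  refine ⟨this.1, ?_⟩
  rw [this.2, (regAt_div hq).2, (regAt_div hq').2, div_mul_div_comm]
  simp

lemma div (hr : RegAt x r) (hs : RegAt x s) (h : ev x s ≠ 0) :
    RegAt x (r / s) ∧ ev x (r / s) = ev x r / ev x s := by
  obtain ⟨p, q, hq, rfl⟩ := exists_div r hr
  obtain ⟨p', q', hq', rfl⟩ := exists_div s hs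
  rw [(regAt_div hq').2] at h
  have hp' : p'.eval x ≠ 0 := fun h' => h (by simp [h'])
  rw [div_div_div_eq, ← map_mul, ← map_mul]
  have := regAt_div (x := x) (p := p * q') (q := q * p') (by simp [hq, hp'])
  refine ⟨this.1, ?_⟩
  rw [this.2, (regAt_div hq).2, (regAt_div hq').2, div_div_div_eq]
  simp

end RegAt

lemma regAt_C (x c : L) : RegAt x (C c) := by simp [RegAt]

lemma ev_C (x c : L) : ev x (C c) = c := by simp

lemma regAt_X (x : L) : RegAt x X := by simp [RegAt]

lemma regAt_algebraMap (x : L) (p : L[X]) : RegAt x (algebraMap L[X] (RatFunc L) p) := by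
  simp [RegAt]

lemma ev_algebraMap (x : L) (p : L[X]) : ev x (algebraMap L[X] (RatFunc L) p) = p.eval x := by
  simp

namespace RegAt

variable {x : L} {r s : RatFunc L}

lemma neg (hr : RegAt x r) : RegAt x (-r) ∧ ev x (-r) = - ev x r := by
  have := (regAt_C x (-1)).mul hr
  rwa [ev_C, map_neg, map_one, neg_one_mul, neg_one_mul] at this

lemma sub (hr : RegAt x r) (hs : RegAt x s) :
    RegAt x (r - s) ∧ ev x (r - s) = ev x r - ev x s := by
  rw [sub_eq_add_neg, sub_eq_add_neg, ← hs.neg.2]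
  exact hr.add hs.neg.1

lemma pow (hr : RegAt x r) (n : ℕ) : RegAt x (r ^ n) ∧ ev x (r ^ n) = ev x r ^ n := by
  induction n with
  | zero => simpa using regAt_C x 1
  | succ n ih =>
    rw [pow_succ, pow_succ, ← ih.2]
    exact ih.1.mul hr

lemma aeval (hr : RegAt x r) (p : L[X]) :
    RegAt x (p.aeval r) ∧ ev x (p.aeval r) = p.eval (ev x r) := by
  induction p using Polynomial.induction_on with
  | C a => simpa using regAt_C x a
  | add p q hp hq =>
    rw [map_add, Polynomial.eval_add, ← hp.2, ← hq.2]
    exact hp.1.add hq.1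
  | monomial n a h =>
    have h1 := hr.pow (n + 1)
    have := (regAt_C x a).mul h1.1
    rw [h1.2, ev_C] at this
    simpa [algebraMap_eq_C] using this

end RegAt

/-- The cross-multiplied difference of two distinct fractions is a nonzero polynomial with finitely
many roots. This converts statements about almost all points into identities of rational functions.
-/
lemma eq_of_frequently_ev_eq {r s : RatFunc L} (h : ∃ᶠ x in cofinite, ev x r = ev x s) :
    r = s := by
  by_contra hne
  have h1 : r.num * s.denom - s.num * r.denom ≠ 0 := by
    rw [sub_ne_zero]
    intro e
    apply hne
    rw [← r.num_div_denom, ← s.num_div_denom, div_eq_div_iff (algebraMap_ne_zero r.denom_ne_zero)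
      (algebraMap_ne_zero s.denom_ne_zero), ← map_mul, ← map_mul, e]
  apply h
  filter_upwards [eventually_eval_ne_zero h1, eventually_regAt r, eventually_regAt s]
    with x hx hr hs e
  rw [ev_def, ev_def, div_eq_div_iff hr hs] at e
  simp [e] at hx

lemma eventually_ev_ne_zero {r : RatFunc L} (hr : r ≠ 0) : ∀ᶠ x in cofinite, ev x r ≠ 0 := by
  by_contra h
  rw [not_eventually] at h
  exact hr (eq_of_frequently_ev_eq (h.mono fun x hx => by simpa using hx))

lemma eventually_ev_ne {r s : RatFunc L} (hrs : r ≠ s) :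
    ∀ᶠ x in cofinite, ev x r ≠ ev x s := by
  by_contra h
  rw [not_eventually] at h
  exact hrs (eq_of_frequently_ev_eq (h.mono fun x hx => by simpa using hx))

/-- A nonconstant function has finite fibres, so a condition excluding finitely many values of `r`
excludes only finitely many `x`. -/
lemma tendsto_ev {r : RatFunc L} (hr : ¬∃ c, r = C c) :
    Tendsto (fun x => ev x r) cofinite cofinite := by
  refine Tendsto.cofinite_of_finite_preimage_singleton fun c => ?_
  have := eventually_ev_ne (r := r) (s := C c) fun h => hr ⟨c, h⟩
  rw [eventually_cofinite] at this
  refine this.subset fun x hx => ?_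
  simpa using hx

end Eval

/-! ### Composition of rational functions -/

section Composition

variable {L : Type*} [Field L]

/-- Composition `r ↦ r ∘ g` with a nonconstant rational function `g`. -/
def compHom (g : RatFunc L) (hg : ¬∃ c, g = C c) : RatFunc L →ₐ[L] RatFunc L :=
  liftAlgHom (aeval g) fun p hp => by
    have := transcendental_iff_injective.mp (g.transcendental_of_ne_C hg)
    simpa [map_eq_zero_iff _ this] using hp

variable {g : RatFunc L} (hg : ¬∃ c, g = C c)

lemma compHom_algebraMap (p : L[X]) : compHom g hg (algebraMap _ _ p) = aeval g p := by
  rw [compHom, ← div_one (algebraMap L[X] (RatFunc L) p), ← map_one (algebraMap L[X] (RatFunc L)),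
    liftAlgHom_apply_div]
  simp

lemma compHom_X : compHom g hg X = g := by
  rw [← algebraMap_X, compHom_algebraMap, aeval_X]

lemma compHom_apply (r : RatFunc L) :
    compHom g hg r = aeval g r.num / aeval g r.denom := by
  rw [← compHom_algebraMap hg, ← compHom_algebraMap hg, ← map_div₀, num_div_denom]

lemma regAt_compHom {x : L} {r : RatFunc L} (h : RegAt x g) (h' : RegAt (ev x g) r) :
    RegAt x (compHom g hg r) ∧ ev x (compHom g hg r) = ev (ev x g) r := by
  rw [compHom_apply, ev_def _ r, ← (h.aeval r.num).2, ← (h.aeval r.denom).2]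
  exact (h.aeval r.num).1.div (h.aeval r.denom).1 (by rw [(h.aeval r.denom).2]; exact h')

end Composition

/-! ### The height, that is, the degree as a self-map of the projective line -/

section Height

variable {L : Type*} [Field L]

/-- The degree of a rational function as a map `ℙ¹ → ℙ¹`. -/
def height (r : RatFunc L) : ℕ := max r.num.natDegree r.denom.natDegree

lemma height_eq_finrank (r : RatFunc L) :
    r.height = Module.finrank (IntermediateField.adjoin L {r}) (RatFunc L) :=
  r.finrank_eq_max_natDegree.symm

lemma height_eq_zero {r : RatFunc L} : r.height = 0 ↔ ∃ c, r = C c := by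
  rw [height, Nat.max_eq_zero_iff, eq_C_iff]

lemma adjoin_eq_fieldRange {g : RatFunc L} (hg : ¬∃ c, g = C c) :
    IntermediateField.adjoin L {g} = (compHom g hg).fieldRange := by
  rw [AlgHom.fieldRange_eq_map, ← RatFunc.adjoin_X, IntermediateField.adjoin_map,
    Set.image_singleton, compHom_X]

/-- This is the tower law for `L(r ∘ g) ⊆ L(g) ⊆ L(X)`: composition with `g` carries the extension
`L(r) ⊆ L(X)` to `L(r ∘ g) ⊆ L(g)`. -/
lemma height_compHom {g : RatFunc L} (hg : ¬∃ c, g = C c) (r : RatFunc L) :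
    (compHom g hg r).height = r.height * g.height := by
  have h1 : IntermediateField.adjoin L {compHom g hg r} =
      (IntermediateField.adjoin L {r}).map (compHom g hg) := by
    rw [IntermediateField.adjoin_map, Set.image_singleton]
  have h2 := (adjoin_eq_fieldRange hg).trans (compHom g hg).fieldRange_eq_map
  have hle : IntermediateField.adjoin L {compHom g hg r} ≤ IntermediateField.adjoin L {g} := by
    rw [h1, h2]
    exact IntermediateField.map_mono _ le_top
  rw [height_eq_finrank, height_eq_finrank g, ← IntermediateField.relfinrank_mul_finrank_top hle,
    h1, h2, IntermediateField.relfinrank_map_map, IntermediateField.relfinrank_top_right,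
    height_eq_finrank r]

lemma height_div {p q : L[X]} (h : IsCoprime p q) (hq : q ≠ 0) :
    (algebraMap L[X] (RatFunc L) p / algebraMap L[X] (RatFunc L) q).height =
      max p.natDegree q.natDegree := by
  set r := algebraMap L[X] (RatFunc L) p / algebraMap L[X] (RatFunc L) q
  have h1 : r.num * q = p * r.denom := (num_mul_eq_mul_denom_iff hq).mpr rfl
  have h2 : Associated r.num p := associated_of_dvd_dvd
    ((r.isCoprime_num_denom).dvd_of_dvd_mul_right ⟨q, h1.symm⟩)
    (h.dvd_of_dvd_mul_right ⟨r.denom, h1⟩)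
  have h3 : Associated r.denom q := associated_of_dvd_dvd (denom_div_dvd p q)
    (h.symm.dvd_of_dvd_mul_left ⟨r.num, by rw [← h1, mul_comm]⟩)
  rw [height, natDegree_eq_of_degree_eq (degree_eq_degree_of_associated h2),
    natDegree_eq_of_degree_eq (degree_eq_degree_of_associated h3)]

lemma height_C_mul {c : L} (hc : c ≠ 0) (r : RatFunc L) : (C c * r).height = r.height := by
  have : C c * r = algebraMap L[X] (RatFunc L) (Polynomial.C c * r.num) /
      algebraMap L[X] (RatFunc L) r.denom := by
    rw [map_mul, mul_div_assoc, num_div_denom, algebraMap_C]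
  have hu : IsUnit (Polynomial.C c) := Polynomial.isUnit_C.mpr hc.isUnit
  rw [this, height_div _ r.denom_ne_zero, natDegree_C_mul hc, height]
  exact (isCoprime_mul_unit_left_left hu _ _).mpr r.isCoprime_num_denom

end Height

/-! ### Extension of scalars -/

section Map

variable {k L : Type*} [Field k] [Field L] [Algebra k L]

variable (k L) in
/-- Extension of scalars for rational functions. -/
def extend : RatFunc k →+* RatFunc L :=
  mapRingHom (Polynomial.mapRingHom (algebraMap k L)) fun p hp => by
    simpa using hp

lemma extend_algebraMap (p : k[X]) : extend k L (algebraMap _ _ p) =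
    algebraMap _ _ (p.map (algebraMap k L)) := by
  rw [extend, ← div_one (algebraMap k[X] (RatFunc k) p), ← map_one (algebraMap k[X] (RatFunc k)),
    coe_mapRingHom_eq_coe_map, map_apply_div]
  simp

lemma extend_C (c : k) : extend k L (C c) = C (algebraMap k L c) := by
  rw [← algebraMap_C, extend_algebraMap, Polynomial.map_C, algebraMap_C]

lemma extend_X : extend k L X = X := by
  rw [← algebraMap_X, extend_algebraMap, Polynomial.map_X, algebraMap_X]

lemma extend_eq_div (r : RatFunc k) : extend k L r =
    algebraMap _ _ (r.num.map (algebraMap k L)) /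
      algebraMap _ _ (r.denom.map (algebraMap k L)) := by
  rw [← extend_algebraMap, ← extend_algebraMap, ← map_div₀, num_div_denom]

/-- A Bézout relation between numerator and denominator survives extension of scalars, so the
reduced form stays reduced. -/
lemma height_extend (r : RatFunc k) : (extend k L r).height = r.height := by
  rw [extend_eq_div, height_div (p := r.num.map (algebraMap k L))
    (q := r.denom.map (algebraMap k L))
    (r.isCoprime_num_denom.map (Polynomial.mapRingHom (algebraMap k L)))
    (by simpa using r.denom_ne_zero), natDegree_map, natDegree_map, height]

end Map

/-! ### The derivative of a rational function -/

section Derivative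

variable {L : Type*} [Field L]

open TrivSqZeroExt in
/-- `r ↦ r + r' ε`. -/
def toDual : RatFunc L →ₐ[L] TrivSqZeroExt (RatFunc L) (RatFunc L) :=
  IsLocalization.liftAlgHom (M := nonZeroDivisors L[X]) (f := aeval (inl X + inr 1))
    fun p => by
      -- A nonzero polynomial `p` goes to `p(X + ε)`, which is a unit because its `ε`-free part is
      -- `p` itself.
      have h : (fstHom L (RatFunc L) (RatFunc L)).comp (aeval (inl X + inr 1)) =
          aeval (X : RatFunc L) := by ext; simp
      have h2 : fst (aeval (inl X + inr 1 : TrivSqZeroExt (RatFunc L) (RatFunc L)) p.1) =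
          aeval (X : RatFunc L) p.1 := congr($h p.1)
      rw [isUnit_iff_isUnit_fst]
      change IsUnit (fst (aeval _ p.1))
      rw [h2, aeval_X_left_eq_algebraMap]
      exact (algebraMap_ne_zero (nonZeroDivisors.ne_zero p.2)).isUnit

open TrivSqZeroExt in
lemma toDual_algebraMap (p : L[X]) :
    toDual (algebraMap L[X] (RatFunc L) p) = aeval (inl X + inr 1) p := by
  rw [toDual, IsLocalization.liftAlgHom_apply, IsLocalization.lift_eq]
  rfl

open TrivSqZeroExt in
lemma fst_toDual (r : RatFunc L) : fst (toDual r) = r := by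
  have : (fstHom L (RatFunc L) (RatFunc L)).comp toDual = AlgHom.id L _ := by
    apply IsLocalization.algHom_ext (nonZeroDivisors L[X])
    ext
    change fst (toDual (algebraMap L[X] _ Polynomial.X)) = algebraMap L[X] _ Polynomial.X
    rw [toDual_algebraMap]
    simp
  exact congr($this r)

/-- The derivation `d/dx` of the field of rational functions. -/
def deriv : Derivation L (RatFunc L) (RatFunc L) :=
  Derivation.mk' ((TrivSqZeroExt.sndHom (RatFunc L) (RatFunc L)).restrictScalars L ∘ₗ
      toDual.toLinearMap) fun r s => by
    simp [fst_toDual, mul_comm]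

lemma deriv_X : deriv (X : RatFunc L) = 1 := by
  change TrivSqZeroExt.snd (toDual X) = 1
  rw [← algebraMap_X, toDual_algebraMap]
  simp

lemma deriv_aeval (r : RatFunc L) (p : L[X]) :
    deriv (p.aeval r) = p.derivative.aeval r * deriv r := by
  rw [Derivation.map_aeval, smul_eq_mul]

lemma deriv_algebraMap (p : L[X]) :
    deriv (algebraMap L[X] (RatFunc L) p) = algebraMap L[X] (RatFunc L) p.derivative := by
  rw [← aeval_X_left_eq_algebraMap, deriv_aeval, deriv_X, mul_one, aeval_X_left_eq_algebraMap]

lemma deriv_C (c : L) : deriv (C c) = 0 := deriv.map_algebraMap c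

lemma deriv_C_mul (c : L) (r : RatFunc L) : deriv (C c * r) = C c * deriv r := by
  rw [Derivation.leibniz, deriv_C, smul_zero, add_zero, smul_eq_mul]

/-- From `num' * denom = num * denom'` and coprimality, the denominator divides its own derivative.
By degree it is then constant, and in characteristic zero so is the numerator. -/
lemma deriv_eq_zero [CharZero L] {r : RatFunc L} (h : deriv r = 0) : ∃ c, r = C c := by
  have h0 := algebraMap_ne_zero r.denom_ne_zero
  have h1 : r.num.derivative * r.denom = r.num * r.denom.derivative := by
    apply algebraMap_injective L
    have h2 : r * algebraMap L[X] (RatFunc L) r.denom = algebraMap L[X] (RatFunc L) r.num :=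
      (div_eq_iff h0).mp r.num_div_denom |>.symm
    have h3 := congr(deriv $h2)
    rw [Derivation.leibniz, h, deriv_algebraMap, deriv_algebraMap, smul_zero, add_zero,
      smul_eq_mul] at h3
    rw [map_mul, map_mul, ← h2, ← h3]
    ring
  have h4 : r.denom ∣ r.denom.derivative :=
    r.isCoprime_num_denom.symm.dvd_of_dvd_mul_left ⟨_, by rw [← h1, mul_comm]⟩
  have h5 : r.denom.natDegree = 0 := by
    by_contra hne
    have := natDegree_le_of_dvd h4 fun e => hne (derivative_eq_zero.mp e)
    have := natDegree_derivative_lt hne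
    omega
  have h6 : r.denom = 1 := r.monic_denom.natDegree_eq_zero.mp h5
  rw [h6, derivative_one, mul_one, mul_zero] at h1
  exact (eq_C_iff r).mpr ⟨derivative_eq_zero.mp h1, h5⟩

lemma deriv_compHom {g : RatFunc L} (hg : ¬∃ c, g = C c) (r : RatFunc L) :
    deriv (compHom g hg r) = compHom g hg (deriv r) * deriv g := by
  conv_lhs => rw [← r.num_div_denom]
  conv_rhs => rw [← r.num_div_denom]
  have h0 := (map_ne_zero (compHom g hg)).mpr (algebraMap_ne_zero r.denom_ne_zero)
  rw [map_div₀, Derivation.leibniz_div, Derivation.leibniz_div, compHom_algebraMap,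
    compHom_algebraMap, deriv_aeval, deriv_aeval, deriv_algebraMap, deriv_algebraMap]
  rw [compHom_algebraMap] at h0
  simp only [smul_eq_mul, map_mul, map_sub, map_inv₀, map_pow, compHom_algebraMap]
  field_simp

end Derivative

section MapDerivative

variable {k L : Type*} [Field k] [Field L] [Algebra k L]

lemma deriv_extend (r : RatFunc k) : deriv (extend k L r) = extend k L (deriv r) := by
  conv_lhs => rw [← r.num_div_denom]
  conv_rhs => rw [← r.num_div_denom]
  rw [map_div₀, Derivation.leibniz_div, Derivation.leibniz_div]
  simp only [smul_eq_mul, map_mul, map_sub, map_inv₀, map_pow, deriv_algebraMap, extend_algebraMap,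
    derivative_map]

end MapDerivative

end RatFunc

/-! ### Homomorphisms given by rational functions -/

namespace WeierstrassCurve

open RatFunc (ev RegAt)

variable {L : Type*} [Field L] [CharZero L] [IsAlgClosed L] [DecidableEq L]
variable {W W' W'' : WeierstrassCurve L} [W.IsElliptic] [W'.IsElliptic] [W''.IsElliptic]

/-- The homomorphism `f` is given by `(x, η) ↦ (r(x), η s(x))` at all but finitely many points. -/
def Rep (f : W.toAffine.Point →+ W'.toAffine.Point) (r s : RatFunc L) : Prop :=
  ∀ᶠ P in cofinite, ∀ x η, IsPt P x η → IsPt (f P) (ev x r) (η * ev x s)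

/-- The kernel is finite and every nonempty fibre is a coset of it. -/
lemma tendsto_of_eventually_ne_zero {f : W.toAffine.Point →+ W'.toAffine.Point}
    (h : ∀ᶠ P in cofinite, f P ≠ 0) : Tendsto f cofinite cofinite := by
  refine Tendsto.cofinite_of_finite_preimage_singleton fun Q => ?_
  by_cases hQ : ∃ P, f P = Q
  · obtain ⟨P, rfl⟩ := hQ
    rw [eventually_cofinite] at h
    have h2 : {R | f R = 0}.Finite := by simpa using h
    refine (h2.image (P + ·)).subset fun R hR => ⟨R - P, ?_, by simp⟩
    have : f R = f P := hR
    simp [this]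
  · have : f ⁻¹' {Q} = ∅ := by
      ext P
      simpa using fun h => hQ ⟨P, h⟩
    rw [this]
    exact Set.finite_empty

/-- For any `Q` some `P` has both `P` and `Q + P` outside the finite exceptional set, and `Q` is
their difference. -/
lemma hom_ext_of_eventually {f g : W.toAffine.Point →+ W'.toAffine.Point}
    (h : ∀ᶠ P in cofinite, f P = g P) : f = g := by
  ext1 Q
  have h2 := (add_right_injective Q).tendsto_cofinite.eventually h
  obtain ⟨P, hP, hP'⟩ := (h.and h2).exists
  rw [map_add, map_add, hP] at hP'
  exact add_right_cancel hP'

/-- The cubic as a rational function. -/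
abbrev cubicFun (W : WeierstrassCurve L) : RatFunc L := algebraMap L[X] (RatFunc L) W.cubic

lemma cubicFun_ne_zero : W.cubicFun ≠ 0 :=
  RatFunc.algebraMap_ne_zero W.cubic_monic.ne_zero

lemma eventually_eta_ne_zero :
    ∀ᶠ P : W.toAffine.Point in cofinite, ∀ x η, IsPt P x η → η ≠ 0 := by
  filter_upwards [eventually_isPt (RatFunc.eventually_eval_ne_zero W.cubic_monic.ne_zero)]
    with P hP x η h h0
  apply hP x η h
  rw [← h.eq, h0]
  ring

namespace Rep

variable {f g : W.toAffine.Point →+ W'.toAffine.Point} {r s r' s' : RatFunc L}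

lemma eventually_ne_zero (h : Rep f r s) : ∀ᶠ P in cofinite, f P ≠ 0 := by
  filter_upwards [h, IsPt.eventually_ne_zero] with P hP h0
  obtain ⟨x, η, hx⟩ := exists_isPt h0
  exact (hP x η hx).ne_zero

lemma ne_zero (h : Rep f r s) : f ≠ 0 := by
  rintro rfl
  obtain ⟨P, hP⟩ := h.eventually_ne_zero.exists
  exact hP rfl

lemma tendsto (h : Rep f r s) : Tendsto f cofinite cofinite :=
  tendsto_of_eventually_ne_zero h.eventually_ne_zero

lemma unique (h : Rep f r s) (h' : Rep f r' s') : r = r' ∧ s = s' := by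
  constructor
  · apply RatFunc.eq_of_frequently_ev_eq
    refine (eventually_of_isPt (W := W) ?_).frequently
    filter_upwards [h, h'] with P hP hP' x η hx
    exact ((hP x η hx).unique (hP' x η hx)).1
  · apply RatFunc.eq_of_frequently_ev_eq
    refine (eventually_of_isPt (W := W) ?_).frequently
    filter_upwards [h, h', eventually_eta_ne_zero] with P hP hP' h0 x η hx
    exact mul_left_cancel₀ (h0 x η hx) ((hP x η hx).unique (hP' x η hx)).2

lemma hom_ext (h : Rep f r s) (h' : Rep g r s) : f = g := by
  apply hom_ext_of_eventually
  filter_upwards [h, h', IsPt.eventually_ne_zero] with P hP hP' h0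
  obtain ⟨x, η, hx⟩ := exists_isPt h0
  exact (hP x η hx).ext (hP' x η hx)

/-- The image point satisfies the equation of `W'`; substitute `η² = cubic(x)` on `W` and compare at
almost all `x`. -/
lemma cubic_eq (h : Rep f r s) : W.cubicFun * s ^ 2 = aeval r W'.cubic := by
  apply RatFunc.eq_of_frequently_ev_eq
  have h1 : ∀ᶠ x in cofinite, W.cubic.eval x * ev x s ^ 2 = W'.cubic.eval (ev x r) := by
    apply eventually_of_isPt (W := W)
    filter_upwards [h] with P hP x η hx
    rw [← (hP x η hx).eq, ← hx.eq, mul_pow]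
  refine Eventually.frequently ?_
  filter_upwards [h1, RatFunc.eventually_regAt s, RatFunc.eventually_regAt r] with x hx hs hr
  rw [(hr.aeval _).2, ((RatFunc.regAt_algebraMap _ _).mul (hs.pow 2).1).2, (hs.pow 2).2,
    RatFunc.ev_algebraMap, hx]

/-- Homomorphisms of this kind are finite-to-one, while a constant `r` would send almost all points
to the at most two points over one `x`-coordinate. -/
lemma nonconst (h : Rep f r s) : ¬∃ c, r = RatFunc.C c := by
  rintro ⟨c, rfl⟩
  have h1 : ∀ᶠ Q : W'.toAffine.Point in cofinite, ∀ x η, IsPt Q x η → x ≠ c :=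
    eventually_isPt (by simp [eventually_cofinite])
  have h2 := h.tendsto.eventually h1
  obtain ⟨P, hP, hP', h0⟩ := (h.and (h2.and IsPt.eventually_ne_zero)).exists
  obtain ⟨x, η, hx⟩ := exists_isPt h0
  exact hP' _ _ (hP x η hx) (by simp)

lemma s_ne_zero (h : Rep f r s) : s ≠ 0 := by
  rintro rfl
  have h1 := h.cubic_eq
  have h2 := transcendental_iff_injective.mp (r.transcendental_of_ne_C h.nonconst)
  rw [zero_pow two_ne_zero, mul_zero, eq_comm, map_eq_zero_iff _ h2] at h1
  exact W'.cubic_monic.ne_zero h1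

lemma neg (h : Rep f r s) : Rep (-f) r (-s) := by
  filter_upwards [h, eventually_isPt (RatFunc.eventually_regAt s)] with P hP hs x η hx
  rw [(hs x η hx).neg.2, mul_neg]
  exact (hP x η hx).neg

lemma id : Rep (AddMonoidHom.id W.toAffine.Point) RatFunc.X 1 :=
  .of_forall fun P x η hx => by simpa using hx

lemma comp {g : W'.toAffine.Point →+ W''.toAffine.Point} (hg : Rep g r' s') (hf : Rep f r s) :
    Rep (g.comp f) (RatFunc.compHom r hf.nonconst r')
      (RatFunc.compHom r hf.nonconst s' * s) := by
  filter_upwards [hf, hf.tendsto.eventually hg,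
    eventually_isPt (RatFunc.eventually_regAt s),
    eventually_isPt (RatFunc.eventually_regAt r),
    eventually_isPt ((RatFunc.tendsto_ev hf.nonconst).eventually (RatFunc.eventually_regAt r')),
    eventually_isPt ((RatFunc.tendsto_ev hf.nonconst).eventually (RatFunc.eventually_regAt s'))]
    with P hP hP' hs hr h1 h2 x η hx
  have e1 := RatFunc.regAt_compHom hf.nonconst (hr x η hx) (h1 x η hx)
  have e2 := RatFunc.regAt_compHom hf.nonconst (hr x η hx) (h2 x η hx)
  have := hP' _ _ (hP x η hx)
  rw [e1.2, (e2.1.mul (hs x η hx)).2, e2.2, mul_comm (ev _ s'), ← mul_assoc]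
  exact this

end Rep

/-- The `x`-coordinate function of the sum of two homomorphisms. -/
def sumX (W W' : WeierstrassCurve L) (r s r' s' : RatFunc L) : RatFunc L :=
  W.cubicFun * ((s - s') / (r - r')) ^ 2 - RatFunc.C (W'.b₂ / 4) - r - r'

/-- The `η`-coordinate function, divided by `η`, of the sum of two homomorphisms. -/
def sumY (W W' : WeierstrassCurve L) (r s r' s' : RatFunc L) : RatFunc L :=
  -((s - s') / (r - r') * (sumX W W' r s r' s' - r) + s)

variable {f g : W.toAffine.Point →+ W'.toAffine.Point} {r s r' s' : RatFunc L}

/-- The chord through the two image points has slope `η (s - s') / (r - r')`. Its square is `cubic ·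
((s - s') / (r - r'))²`, a function of `x` alone. Since `r ≠ r'`, the chord formula fails for only
finitely many points. -/
lemma Rep.add (hf : Rep f r s) (hg : Rep g r' s') (hr : r ≠ r') :
    Rep (f + g) (sumX W W' r s r' s') (sumY W W' r s r' s') := by
  filter_upwards [hf, hg,
    eventually_isPt (RatFunc.eventually_regAt s), eventually_isPt (RatFunc.eventually_regAt r),
    eventually_isPt (RatFunc.eventually_regAt s'), eventually_isPt (RatFunc.eventually_regAt r'),
    eventually_isPt (RatFunc.eventually_ev_ne_zero (sub_ne_zero.mpr hr))]
    with P hP hP' hs hr hs' hr' hd x η hx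
  have hs := hs x η hx
  have hr := hr x η hx
  have hs' := hs' x η hx
  have hr' := hr' x η hx
  have hd := hd x η hx
  have h1 := (hs.sub hs').1.div (hr.sub hr').1 hd
  rw [(hs.sub hs').2, (hr.sub hr').2] at h1
  rw [(hr.sub hr').2] at hd
  have h2 := h1.1.pow 2
  have h3 := (RatFunc.regAt_algebraMap x W.cubic).mul h2.1
  have h4 := h3.1.sub (RatFunc.regAt_C x (W'.b₂ / 4))
  have h5 := h4.1.sub hr
  have h6 := h5.1.sub hr'
  have e1 : ev x (sumX W W' r s r' s') = ((η * ev x s - η * ev x s') / (ev x r - ev x r')) ^ 2 -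
      W'.b₂ / 4 - ev x r - ev x r' := by
    rw [sumX, h6.2, h5.2, h4.2, h3.2, h2.2, h1.2, RatFunc.ev_algebraMap, RatFunc.ev_C, ← hx.eq]
    ring
  have h7 : RegAt x (sumX W W' r s r' s') := h6.1
  have h8 := h1.1.mul (h7.sub hr).1
  have h9 := h8.1.add hs
  have h10 := h9.1.neg
  have := (hP x η hx).add (hP' x η hx) (sub_ne_zero.mp hd)
  rw [AddMonoidHom.add_apply]
  convert this using 1
  rw [← e1, sumY, h10.2, h9.2, h8.2, h1.2, (h7.sub hr).2]
  ring

/-- The `x`-coordinate function of multiplication by two. -/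
def doubleX (W : WeierstrassCurve L) : RatFunc L :=
  algebraMap L[X] (RatFunc L)
      (W.cubic.derivative ^ 2 - C 4 * W.cubic * (C (W.b₂ / 4) + C 2 * X)) /
    algebraMap L[X] (RatFunc L) (C 4 * W.cubic)

/-- The `η`-coordinate function, divided by `η`, of multiplication by two. -/
def doubleY (W : WeierstrassCurve L) : RatFunc L :=
  -(algebraMap L[X] (RatFunc L) W.cubic.derivative /
    algebraMap L[X] (RatFunc L) (C 2 * W.cubic) * (doubleX W - RatFunc.X) + 1)

lemma rep_double : Rep (AddMonoidHom.id W.toAffine.Point + AddMonoidHom.id W.toAffine.Point)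
    (doubleX W) (doubleY W) := by
  filter_upwards [eventually_eta_ne_zero] with P hη x η hx
  have hη := hη x η hx
  have hc : W.cubic.eval x ≠ 0 := by rw [← hx.eq]; exact pow_ne_zero 2 hη
  have h1 := RatFunc.regAt_div (x := x)
    (p := W.cubic.derivative ^ 2 - C 4 * W.cubic * (C (W.b₂ / 4) + C 2 * X))
    (q := C 4 * W.cubic) (by simpa using hc)
  have h2 := RatFunc.regAt_div (x := x) (p := W.cubic.derivative)
    (q := C 2 * W.cubic) (by simpa using hc)
  have e1 : ev x (doubleX W) = (W.cubic.derivative.eval x / (2 * η)) ^ 2 - W.b₂ / 4 - x - x := by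
    rw [doubleX, h1.2]
    simp only [eval_sub, eval_mul, eval_add, eval_C, eval_X, eval_pow, ← hx.eq]
    field_simp
    ring
  have h3 : RegAt x (doubleX W) := h1.1
  have h4 := h3.sub (RatFunc.regAt_X x)
  have h5 := h2.1.mul h4.1
  have h6 := h5.1.add (s := 1) (by simpa using RatFunc.regAt_C x 1)
  have h7 := h6.1.neg
  have := hx.double hη
  simp only [AddMonoidHom.add_apply, AddMonoidHom.id_apply]
  convert this using 1
  · rw [← e1, doubleY, h7.2, h6.2, h5.2, h4.2, h2.2]
    simp only [eval_mul, eval_C, ← hx.eq, RatFunc.eval_one, RatFunc.eval_X]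
    field_simp

/-- By `Rep.cubic_eq`, `r` determines `s²`, hence `s` up to sign. -/
lemma Rep.eq_or_eq_neg (hf : Rep f r s) (hg : Rep g r s') : f = g ∨ f = -g := by
  have : s ^ 2 = s' ^ 2 := mul_left_cancel₀ (cubicFun_ne_zero (W := W)) <| by
    rw [hf.cubic_eq, hg.cubic_eq]
  rcases sq_eq_sq_iff_eq_or_eq_neg.mp this with rfl | rfl
  · exact .inl (hf.hom_ext hg)
  · exact .inr (hf.hom_ext hg.neg)

lemma Rep.add_self (hf : Rep f r s) : ∃ r₂ s₂, Rep (f + f) r₂ s₂ := by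
  have : f + f = (AddMonoidHom.id W'.toAffine.Point + AddMonoidHom.id W'.toAffine.Point).comp f :=
      by
    ext; simp
  rw [this]
  exact ⟨_, _, rep_double.comp hf⟩

/-- The homomorphisms given by rational functions. -/
def IsRegularHom (f : W.toAffine.Point →+ W'.toAffine.Point) : Prop :=
  f = 0 ∨ ∃ r s, Rep f r s

namespace IsRegularHom

lemma zero : IsRegularHom (0 : W.toAffine.Point →+ W'.toAffine.Point) := .inl rfl

lemma neg (hf : IsRegularHom f) : IsRegularHom (-f) := by
  rcases hf with rfl | ⟨r, s, h⟩
  · simpa using zero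
  · exact .inr ⟨_, _, h.neg⟩

/-- If the `x`-coordinate functions differ, the chord formula applies. If they agree, then `f = ±g`,
and the sum is a duplication or zero. -/
lemma add (hf : IsRegularHom f) (hg : IsRegularHom g) : IsRegularHom (f + g) := by
  rcases hf with rfl | ⟨r, s, hf⟩
  · rwa [zero_add]
  rcases hg with rfl | ⟨r', s', hg⟩
  · rw [add_zero]
    exact .inr ⟨_, _, hf⟩
  by_cases h : r = r'
  · subst h
    rcases hf.eq_or_eq_neg hg with rfl | rfl
    · exact .inr hf.add_self
    · rw [neg_add_cancel]
      exact zero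
  · exact .inr ⟨_, _, hf.add hg h⟩

lemma comp {g : W'.toAffine.Point →+ W''.toAffine.Point} (hg : IsRegularHom g)
    (hf : IsRegularHom f) : IsRegularHom (g.comp f) := by
  rcases hf with rfl | ⟨r, s, hf⟩
  · rw [AddMonoidHom.comp_zero]; exact zero
  rcases hg with rfl | ⟨r', s', hg⟩
  · rw [AddMonoidHom.zero_comp]; exact zero
  exact .inr ⟨_, _, hg.comp hf⟩

end IsRegularHom

end WeierstrassCurve

/-! ### The parallelogram law for the degree -/

namespace RatFunc

variable {L : Type*} [Field L]

lemma isPrimitive_linear {p q : L[X]} (h : IsCoprime p q) :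
    (Polynomial.C q * Polynomial.X + Polynomial.C p).IsPrimitive := by
  intro d hd
  rw [C_dvd_iff_dvd_coeff] at hd
  exact h.isUnit_of_dvd' (by simpa using hd 0) (by simpa using hd 1)

/-- This is Gauss's lemma: the content of `u G` is associated to `u` when `G` is primitive. -/
lemma dvd_of_C_dvd_C_mul {R : Type*} [CommRing R] [IsDomain R] [NormalizedGCDMonoid R] {d u : R}
    {G : Polynomial R} (hG : G.IsPrimitive) (h : Polynomial.C d ∣ Polynomial.C u * G) : d ∣ u := by
  rw [← dvd_content_iff_C_dvd] at h
  have := h.trans (associated_content_C_mul u G).dvd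
  rwa [hG.content_eq_one, mul_one] at this

/-- If the elementary symmetric functions of two rational functions are the ratios `A / U` and
`B / U` of polynomials of degree at most `n`, then the sum of their heights is at most `n`. -/
lemma height_add_height_le {r s : RatFunc L} {A B U : L[X]} {n : ℕ} (hU : U ≠ 0)
    (hA' : A.natDegree ≤ n) (hB' : B.natDegree ≤ n) (hU' : U.natDegree ≤ n)
    (hA : (r + s) * algebraMap L[X] (RatFunc L) U = algebraMap L[X] (RatFunc L) A)
    (hB : r * s * algebraMap L[X] (RatFunc L) U = algebraMap L[X] (RatFunc L) B) :
    r.height + s.height ≤ n := by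
  set p := r.num
  set q := r.denom
  set p' := s.num
  set q' := s.denom
  have hq : q ≠ 0 := r.denom_ne_zero
  have hq' : q' ≠ 0 := s.denom_ne_zero
  have hr : r * algebraMap L[X] (RatFunc L) q = algebraMap L[X] (RatFunc L) p :=
    ((div_eq_iff (algebraMap_ne_zero hq)).mp r.num_div_denom).symm
  have hs : s * algebraMap L[X] (RatFunc L) q' = algebraMap L[X] (RatFunc L) p' :=
    ((div_eq_iff (algebraMap_ne_zero hq')).mp s.num_div_denom).symm
  have hA1 : (p * q' + p' * q) * U = A * (q * q') := by
    apply algebraMap_injective L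
    simp only [map_mul, map_add, ← hr, ← hs, ← hA]
    ring
  have hB1 : p * p' * U = B * (q * q') := by
    apply algebraMap_injective L
    simp only [map_mul, ← hr, ← hs, ← hB]
    ring
  -- With a second variable `T`, the product `G = (q T + p)(q' T + p')` is primitive, and `U G = q
  -- q' (U T² + A T + B)`. Gauss's lemma then gives `q q' ∣ U`.
  have hdvd : q * q' ∣ U := by
    classical
    have h1 : ((Polynomial.C q * Polynomial.X + Polynomial.C p) *
        (Polynomial.C q' * Polynomial.X + Polynomial.C p')).IsPrimitive :=
      (isPrimitive_linear r.isCoprime_num_denom).mul (isPrimitive_linear s.isCoprime_num_denom)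
    set G := (Polynomial.C q * Polynomial.X + Polynomial.C p) *
        (Polynomial.C q' * Polynomial.X + Polynomial.C p') with hG
    have h2 : Polynomial.C (q * q') ∣ Polynomial.C U * G := by
      refine ⟨Polynomial.C U * Polynomial.X ^ 2 + Polynomial.C A * Polynomial.X +
        Polynomial.C B, ?_⟩
      have e1 := congr(Polynomial.C $hA1)
      have e2 := congr(Polynomial.C $hB1)
      simp only [hG, map_mul, map_add] at e1 e2 ⊢
      linear_combination Polynomial.X * e1 + e2
    exact @dvd_of_C_dvd_C_mul L[X] _ _ (Classical.choice inferInstance) _ _ _ h1 h2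
  obtain ⟨w, hw⟩ := hdvd
  have hqq : q * q' ≠ 0 := mul_ne_zero hq hq'
  have hw0 : w ≠ 0 := by rintro rfl; exact hU (by simpa using hw)
  have hA2 : A = w * (p * q' + p' * q) := mul_right_cancel₀ hqq <| by
    rw [← hA1, hw]; ring
  have hB2 : B = w * (p * p') := mul_right_cancel₀ hqq <| by
    rw [← hB1, hw]; ring
  have key : ∀ t m, t ≠ 0 → t.natDegree = m → (w * t).natDegree ≤ n → m ≤ n := by
    intro t m ht hm h
    rw [natDegree_mul hw0 ht] at h
    omega
  have h1 : r.height = max p.natDegree q.natDegree := rfl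
  have h2 : s.height = max p'.natDegree q'.natDegree := rfl
  -- The coefficients `q q'`, `p q' + p' q`, `p p'` of `G`, times one common cofactor `w`, are `U`,
  -- `A`, `B`. In each case the sum of the heights is the degree of one of these coefficients.
  rcases le_or_gt p.natDegree q.natDegree with hpq | hpq <;>
    rcases le_or_gt p'.natDegree q'.natDegree with hpq' | hpq'
  · rw [h1, h2, max_eq_right hpq, max_eq_right hpq', ← natDegree_mul hq hq']
    exact key _ _ hqq rfl (by rwa [mul_comm, ← hw])
  · have hp' : p' ≠ 0 := by rintro h; simp [h] at hpq'
    rw [h1, h2, max_eq_right hpq, max_eq_left hpq'.le, add_comm, ← natDegree_mul hp' hq]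
    rcases eq_or_ne p 0 with h0 | h0
    · exact key _ _ (mul_ne_zero hp' hq) rfl (by simpa [hA2, h0] using hA')
    · have hlt : (p * q').natDegree < (p' * q).natDegree := by
        rw [natDegree_mul h0 hq', natDegree_mul hp' hq]; omega
      have e := natDegree_add_eq_right_of_natDegree_lt hlt
      exact key _ _ (fun h => by rw [h, natDegree_zero] at e; omega) e (hA2 ▸ hA')
  · have hp : p ≠ 0 := by rintro h; simp [h] at hpq
    rw [h1, h2, max_eq_left hpq.le, max_eq_right hpq', ← natDegree_mul hp hq']
    rcases eq_or_ne p' 0 with h0 | h0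
    · exact key _ _ (mul_ne_zero hp hq') rfl (by simpa [hA2, h0] using hA')
    · have hlt : (p' * q).natDegree < (p * q').natDegree := by
        rw [natDegree_mul h0 hq, natDegree_mul hp hq']; omega
      have e := natDegree_add_eq_left_of_natDegree_lt hlt
      exact key _ _ (fun h => by rw [h, natDegree_zero] at e; omega) e (hA2 ▸ hA')
  · have hp : p ≠ 0 := by rintro h; simp [h] at hpq
    have hp' : p' ≠ 0 := by rintro h; simp [h] at hpq'
    rw [h1, h2, max_eq_left hpq.le, max_eq_left hpq'.le, ← natDegree_mul hp hp']
    exact key _ _ (mul_ne_zero hp hp') rfl (hB2 ▸ hB')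

end RatFunc

namespace WeierstrassCurve

open RatFunc (ev RegAt)

variable {L : Type*} [Field L] [CharZero L] [IsAlgClosed L] [DecidableEq L]
variable {W W' W'' : WeierstrassCurve L} [W.IsElliptic] [W'.IsElliptic] [W''.IsElliptic]
variable {f g : W.toAffine.Point →+ W'.toAffine.Point} {r s r' s' : RatFunc L}

/-- The expression is the general quadratic form in `p p'`, `p q' + p' q`, `q q'`. With suitable
coefficients it yields each of the three polynomials needed in `Rep.height_sum_le`. -/
lemma natDegree_le_of_quadratic {p q p' q' : L[X]} {m n : ℕ} (hp : p.natDegree ≤ m)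
    (hq : q.natDegree ≤ m) (hp' : p'.natDegree ≤ n) (hq' : q'.natDegree ≤ n) (a b c d e i : L) :
    (C a * ((p * p') * (p * p')) + C b * ((p * p') * (p * q' + p' * q)) +
      C c * ((p * p') * (q * q')) + C d * ((q * q') * (p * q' + p' * q)) +
      C e * ((q * q') * (q * q')) + C i * ((p * q' + p' * q) * (p * q' + p' * q))).natDegree ≤ 2 * m
          + 2 * n := by
  have h1 : (p * p').natDegree ≤ m + n := natDegree_mul_le_of_le hp hp'
  have h2 : (q * q').natDegree ≤ m + n := natDegree_mul_le_of_le hq hq'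
  have h3 : (p * q' + p' * q).natDegree ≤ m + n := natDegree_add_le_of_degree_le
    (natDegree_mul_le_of_le hp hq')
    ((natDegree_mul_le_of_le hp' hq).trans (by omega))
  generalize p * p' = u at *
  generalize q * q' = v at *
  generalize p * q' + p' * q = w at *
  have key : ∀ (y : L) (t t' : L[X]), t.natDegree ≤ m + n → t'.natDegree ≤ m + n →
      (C y * (t * t')).natDegree ≤ 2 * m + 2 * n := fun y t t' ht ht' =>
    (natDegree_C_mul_le _ _).trans ((natDegree_mul_le_of_le ht ht').trans (by omega))
  refine natDegree_add_le_of_degree_le (natDegree_add_le_of_degree_le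
    (natDegree_add_le_of_degree_le (natDegree_add_le_of_degree_le (natDegree_add_le_of_degree_le ?_
        ?_) ?_) ?_) ?_) ?_ <;> apply key <;> assumption

lemma sumX_neg_eq : sumX W W' r s r' (-s') =
    W.cubicFun * ((s + s') / (r - r')) ^ 2 - RatFunc.C (W'.b₂ / 4) - r - r' := by
  rw [sumX, sub_neg_eq_add]

lemma aeval_cubic_ratFunc (r : RatFunc L) : aeval r W.cubic = r ^ 3 +
    RatFunc.C (W.b₂ / 4) * r ^ 2 + RatFunc.C (W.b₄ / 2) * r + RatFunc.C (W.b₆ / 4) := by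
  rw [aeval_cubic]; rfl

/-- The sum and the product of `x(P + Q)` and `x(P - Q)` are symmetric in `x(P)` and `x(Q)`, with
common denominator `(x(P) - x(Q))²`. Clearing the denominators of `r` and `r'` leaves polynomials of
degree at most `2 (height r + height r')`, to which `RatFunc.height_add_height_le` applies. -/
lemma Rep.height_sum_le (hf : Rep f r s) (hg : Rep g r' s') (hr : r ≠ r') :
    (sumX W W' r s r' s').height + (sumX W W' r s r' (-s')).height ≤
      2 * r.height + 2 * r'.height := by
  have hd := sub_ne_zero.mpr hr
  have e1 := hf.cubic_eq
  have e2 := hg.cubic_eq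
  rw [aeval_cubic_ratFunc] at e1 e2
  have hA : (sumX W W' r s r' s' + sumX W W' r s r' (-s')) * (r - r') ^ 2 =
      RatFunc.C 2 * (r * r' * (r + r')) + RatFunc.C W'.b₂ * (r * r') +
        RatFunc.C W'.b₄ * (r + r') + RatFunc.C W'.b₆ := by
    rw [sumX_neg_eq, sumX]
    simp only [map_div₀, map_ofNat] at e1 e2 ⊢
    field_simp
    linear_combination 8 * e1 + 8 * e2
  have hB : (sumX W W' r s r' s' * sumX W W' r s r' (-s')) * (r - r') ^ 2 =
      (r * r') ^ 2 - RatFunc.C W'.b₄ * (r * r') - RatFunc.C W'.b₆ * (r + r') +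
        RatFunc.C (W'.b₄ ^ 2 / 4 - W'.b₂ * W'.b₆ / 4) := by
    rw [sumX_neg_eq, sumX]
    simp only [map_sub, map_mul, map_pow, map_div₀, map_ofNat] at e1 e2 ⊢
    set F := W.cubicFun
    have h3 : F * s ^ 2 - F * s' ^ 2 = F * s ^ 2 - F * s' ^ 2 := rfl
    apply mul_right_cancel₀ (pow_ne_zero 2 hd)
    have e3 : (F * ((s - s') / (r - r')) ^ 2 - RatFunc.C W'.b₂ / 4 - r - r') *
        (F * ((s + s') / (r - r')) ^ 2 - RatFunc.C W'.b₂ / 4 - r - r') * (r - r') ^ 2 *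
        (r - r') ^ 2 =
        (F * s ^ 2 + F * s' ^ 2 - (RatFunc.C W'.b₂ / 4 + r + r') * (r - r') ^ 2) ^ 2 -
          4 * (F * s ^ 2) * (F * s' ^ 2) := by
      field_simp
      ring
    rw [e3, e1, e2]
    field_simp
    ring
  have hq := RatFunc.algebraMap_ne_zero r.denom_ne_zero
  have hq' := RatFunc.algebraMap_ne_zero r'.denom_ne_zero
  have hr1 : r * algebraMap L[X] (RatFunc L) r.denom = algebraMap L[X] (RatFunc L) r.num :=
    ((div_eq_iff hq).mp r.num_div_denom).symm
  have hr2 : r' * algebraMap L[X] (RatFunc L) r'.denom = algebraMap L[X] (RatFunc L) r'.num :=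
    ((div_eq_iff hq').mp r'.num_div_denom).symm
  have hdeg := natDegree_le_of_quadratic (le_max_left r.num.natDegree r.denom.natDegree)
    (le_max_right r.num.natDegree r.denom.natDegree)
    (le_max_left r'.num.natDegree r'.denom.natDegree)
    (le_max_right r'.num.natDegree r'.denom.natDegree)
  -- The three coefficient lists give the numerators of `hA` and `hB` and the common denominator `(p
  -- q' + p' q)² - 4 p p' q q' = (p q' - p' q)²`.
  refine RatFunc.height_add_height_le ?_ (hdeg 0 2 W'.b₂ W'.b₄ W'.b₆ 0)
    (hdeg 1 0 (-W'.b₄) (-W'.b₆) (W'.b₄ ^ 2 / 4 - W'.b₂ * W'.b₆ / 4) 0)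
    (hdeg 0 0 (-4) 0 0 1) ?_ ?_
  · intro h
    have h2 := congr(algebraMap L[X] (RatFunc L) $h)
    have h3 := mul_ne_zero (pow_ne_zero 2 hd) (pow_ne_zero 2 (mul_ne_zero hq hq'))
    apply h3
    simp only [map_add, map_mul, map_neg, map_ofNat, ← hr1, ← hr2, map_zero, map_one] at h2
    linear_combination h2
  · simp only [map_add, map_mul, map_neg, map_ofNat, ← hr1, ← hr2, map_zero, map_one,
      RatFunc.algebraMap_C] at hA ⊢
    linear_combination (algebraMap L[X] (RatFunc L) r.denom *
      algebraMap L[X] (RatFunc L) r'.denom) ^ 2 * hA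
  · simp only [map_add, map_mul, map_neg, map_ofNat, ← hr1, ← hr2, map_zero, map_one,
      RatFunc.algebraMap_C] at hB ⊢
    linear_combination (algebraMap L[X] (RatFunc L) r.denom *
      algebraMap L[X] (RatFunc L) r'.denom) ^ 2 * hB

/-- Modulo the cubic the numerator is the square of its derivative, so the fraction is reduced;
numerator and denominator have degrees 4 and 3. -/
lemma height_doubleX : (doubleX W).height = 4 := by
  have h4 : (4 : L) ≠ 0 := by norm_num
  have h1 : IsCoprime (W.cubic.derivative ^ 2 - C 4 * W.cubic * (C (W.b₂ / 4) + C 2 * X))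
      (C 4 * W.cubic) := by
    have hu : IsUnit (C (4 : L)) := isUnit_C.mpr (isUnit_iff_ne_zero.mpr h4)
    rw [isCoprime_mul_unit_left_right hu]
    have h2 : IsCoprime (W.cubic.derivative ^ 2) W.cubic :=
      cubic_isCoprime_derivative.symm.pow_left
    have := h2.add_mul_left_left (-(C 4 * (C (W.b₂ / 4) + C 2 * X)))
    have e : W.cubic.derivative ^ 2 + W.cubic * -(C 4 * (C (W.b₂ / 4) + C 2 * X)) =
        W.cubic.derivative ^ 2 - C 4 * W.cubic * (C (W.b₂ / 4) + C 2 * X) := by ring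
    rwa [e] at this
  have hne : C 4 * W.cubic ≠ 0 :=
    mul_ne_zero (C_ne_zero.mpr h4) W.cubic_monic.ne_zero
  rw [doubleX, RatFunc.height_div h1 hne, natDegree_C_mul h4]
  have e1 : W.cubic.natDegree = 3 := by unfold cubic; compute_degree!
  have e2 : (W.cubic.derivative ^ 2 - C 4 * W.cubic * (C (W.b₂ / 4) + C 2 * X)).natDegree = 4 := by
    simp only [cubic, derivative_add, derivative_X_pow, derivative_mul, derivative_C, derivative_X]
    compute_degree!
  rw [e1, e2]
  rfl

open Classical in
/-- The degree of a homomorphism given by rational functions. -/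
def homDeg (f : W.toAffine.Point →+ W'.toAffine.Point) : ℕ :=
  if h : ∃ r s, Rep f r s then h.choose.height else 0

lemma Rep.homDeg_eq (h : Rep f r s) : homDeg f = r.height := by
  have h' : ∃ r s, Rep f r s := ⟨r, s, h⟩
  rw [homDeg, dif_pos h', (h'.choose_spec.choose_spec.unique h).1]

lemma homDeg_zero : homDeg (0 : W.toAffine.Point →+ W'.toAffine.Point) = 0 := by
  rw [homDeg, dif_neg]
  rintro ⟨r, s, h⟩
  exact h.ne_zero rfl

lemma homDeg_id : homDeg (AddMonoidHom.id W.toAffine.Point) = 1 := by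
  rw [Rep.id.homDeg_eq, RatFunc.height]
  simp

lemma IsRegularHom.homDeg_eq_zero (h : IsRegularHom f) : homDeg f = 0 ↔ f = 0 := by
  refine ⟨fun h0 => ?_, ?_⟩
  · rcases h with h | ⟨r, s, h⟩
    · exact h
    · rw [h.homDeg_eq, RatFunc.height_eq_zero] at h0
      exact absurd h0 h.nonconst
  · rintro rfl
    exact homDeg_zero

lemma IsRegularHom.homDeg_neg (h : IsRegularHom f) : homDeg (-f) = homDeg f := by
  rcases h with rfl | ⟨r, s, h⟩
  · simp
  · rw [h.homDeg_eq, h.neg.homDeg_eq]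

lemma IsRegularHom.homDeg_comp {g : W'.toAffine.Point →+ W''.toAffine.Point}
    (hg : IsRegularHom g) (hf : IsRegularHom f) :
    homDeg (g.comp f) = homDeg g * homDeg f := by
  rcases hf with rfl | ⟨r, s, hf⟩
  · simp [homDeg_zero]
  rcases hg with rfl | ⟨r', s', hg⟩
  · simp [homDeg_zero]
  rw [hf.homDeg_eq, hg.homDeg_eq, (hg.comp hf).homDeg_eq, RatFunc.height_compHom]

lemma IsRegularHom.homDeg_add_self (hf : IsRegularHom f) : homDeg (f + f) = 4 * homDeg f := by
  have : f + f = (AddMonoidHom.id W'.toAffine.Point + AddMonoidHom.id W'.toAffine.Point).comp f :=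
      by
    ext; simp
  rw [this, homDeg_comp (.inr ⟨_, _, rep_double⟩) hf, rep_double.homDeg_eq, height_doubleX]

lemma IsRegularHom.homDeg_add_le (hf : IsRegularHom f) (hg : IsRegularHom g) :
    homDeg (f + g) + homDeg (f - g) ≤ 2 * homDeg f + 2 * homDeg g := by
  rcases hf with rfl | ⟨r, s, h⟩
  · rw [zero_add, zero_sub, hg.homDeg_neg, homDeg_zero]
    omega
  rcases hg with rfl | ⟨r', s', h'⟩
  · rw [add_zero, sub_zero, homDeg_zero]
    omega
  by_cases hr : r = r'
  · subst hr
    have hf : IsRegularHom f := .inr ⟨_, _, h⟩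
    rcases h.eq_or_eq_neg h' with rfl | rfl
    · rw [hf.homDeg_add_self, sub_self, homDeg_zero]
      omega
    · have hg : IsRegularHom g := .inr ⟨_, _, h'⟩
      rw [neg_add_cancel, homDeg_zero, sub_eq_add_neg, hf.homDeg_add_self, hg.homDeg_neg]
      omega
  · rw [sub_eq_add_neg, (h.add h' hr).homDeg_eq, (h.add h'.neg hr).homDeg_eq, h.homDeg_eq,
      h'.homDeg_eq]
    exact h.height_sum_le h' hr

/-- The parallelogram law for the degree. -/
theorem IsRegularHom.homDeg_parallelogram (hf : IsRegularHom f) (hg : IsRegularHom g) :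
    homDeg (f + g) + homDeg (f - g) = 2 * homDeg f + 2 * homDeg g := by
  refine le_antisymm (hf.homDeg_add_le hg) ?_
  have hg' := hg.neg
  -- The inequality for the pair `f + g`, `f - g` bounds `deg (2f) + deg (2g) = 4 deg f + 4 deg g`
  -- from above, which is the reverse inequality.
  have h1 := (hf.add hg).homDeg_add_le (hf.add hg')
  have e1 : f + g + (f + -g) = f + f := by abel
  have e2 : f + g - (f + -g) = g + g := by abel
  rw [e1, e2, hf.homDeg_add_self, hg.homDeg_add_self, ← sub_eq_add_neg] at h1
  omega

end WeierstrassCurve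

/-! ### Integral quadratic forms on groups and rings -/

section QuadraticForm

/-- The polar form of a function satisfying the parallelogram law. -/
def parallelogramPolar {A : Type*} [AddCommGroup A] (Q : A → ℤ)
    (hQ : ∀ x y, Q (x + y) + Q (x - y) = 2 * Q x + 2 * Q y) : A →+ A →+ ℤ :=
  -- The third difference of `Q` vanishes; this is what makes the polar form biadditive.
  have hadd : ∀ x y z, Q (x + y + z) =
      Q (x + y) + Q (y + z) + Q (x + z) - Q x - Q y - Q z := fun x y z => by
    have h1 := hQ (x + z) y
    have h2 := hQ x (y - z)
    have h3 := hQ (x + y) z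
    have h4 := hQ y z
    rw [show x + z + y = x + y + z by abel, show x + z - y = x - (y - z) by abel] at h1
    rw [show x + (y - z) = x + y - z by abel] at h2
    linarith
  AddMonoidHom.mk' (fun x => AddMonoidHom.mk' (fun y => Q (x + y) - Q x - Q y) fun y z => by
      rw [← add_assoc, hadd]; ring) fun x y => by
    ext z
    simp only [AddMonoidHom.mk'_apply, AddMonoidHom.add_apply]
    rw [hadd]; ring

variable {A : Type*} [AddCommGroup A] {Q : A → ℤ}
  (hQ : ∀ x y, Q (x + y) + Q (x - y) = 2 * Q x + 2 * Q y)

lemma parallelogramPolar_apply (x y : A) :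
    parallelogramPolar Q hQ x y = Q (x + y) - Q x - Q y := rfl

lemma parallelogramPolar_self (x : A) : parallelogramPolar Q hQ x x = 2 * Q x := by
  have h0 := hQ 0 0
  have h1 := hQ x x
  rw [parallelogramPolar_apply]
  simp only [add_zero, sub_self] at h0 h1
  linarith

lemma parallelogramPolar_comm (x y : A) :
    parallelogramPolar Q hQ x y = parallelogramPolar Q hQ y x := by
  rw [parallelogramPolar_apply, parallelogramPolar_apply, add_comm]; ring

/-- A multiplicative integral quadratic form on a ring gives rise to quadratic equations. -/
lemma exists_trace_of_multiplicative_parallelogram {R : Type*} [Ring R] {Q : R → ℤ}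
    (hQ : ∀ x y, Q (x + y) + Q (x - y) = 2 * Q x + 2 * Q y) (hmul : ∀ x y, Q (x * y) = Q x * Q y)
    (hone : Q 1 = 1) (a : R) :
    ∃ t : ℤ, Q (a * a - t • a + Q a • 1) = 0 ∧ Q (2 • a - t • 1) = 4 * Q a - t ^ 2 := by
  set B := parallelogramPolar Q hQ with hB
  have hself : ∀ x, B x x = 2 * Q x := parallelogramPolar_self hQ
  have hcomm : ∀ x y, B x y = B y x := parallelogramPolar_comm hQ
  -- The polar form against `1` plays the role of the trace, as `Q` plays that of the norm.
  refine ⟨B a 1, ?_, ?_⟩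
  · set t := B a 1
    have haa : B (a * a) a = Q a * t := by
      simp only [t, hB, parallelogramPolar_apply]
      rw [show a * a + a = a * (a + 1) by noncomm_ring, hmul, hmul, hone]
      ring
    -- Multiplicativity at `(a + 1)(a - 1) = a² - 1` yields `B(a², 1) = t² - 2 Q(a)`. Together with
    -- `haa` this gives every polar value in the expansion of `Q(a² - t a + Q(a))`.
    have h1 := hself ((a + 1) * (a - 1))
    have h2 := hself (a + 1)
    have h3 := hself (a - 1)
    rw [hmul] at h1
    rw [show (a + 1) * (a - 1) = a * a - 1 by noncomm_ring] at h1
    simp only [map_add, map_sub, AddMonoidHom.add_apply, AddMonoidHom.sub_apply, hself, hone,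
      hcomm 1, hmul] at h1 h2 h3
    have h4 := hself (a * a - t • a + Q a • 1)
    simp only [map_add, map_sub, AddMonoidHom.add_apply, AddMonoidHom.sub_apply, hself, hone,
      hcomm 1, hmul, map_zsmul, AddMonoidHom.smul_apply, hcomm a (a * a), haa, smul_eq_mul] at h4
    change _ + _ + (t + _) = _ at h2
    change _ - _ - (t - _) = _ at h3
    have h5 : Q (a + 1) = Q a + t + 1 := by linarith
    have h6 : Q (a - 1) = Q a - t + 1 := by linarith
    rw [h5, h6] at h1
    change _ - t * (_ - t * _ + Q a * t) + Q a * (_ - t * t + _) = _ at h4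
    have h7 : B (a * a) 1 = t ^ 2 - 2 * Q a := by linarith
    rw [h7] at h4
    linarith
  · have h := hself (2 • a - B a 1 • 1)
    rw [two_nsmul] at h ⊢
    simp only [map_sub, map_add, AddMonoidHom.sub_apply, AddMonoidHom.add_apply, hself, hone,
      hcomm 1, map_zsmul, AddMonoidHom.smul_apply, smul_eq_mul] at h
    linarith

end QuadraticForm

/-! ### The action on the invariant differential -/

section Addition

/-- The invariant differential of a cubic curve is additive. -/
lemma derivation_sum_eq {K : Type*} [Field K] {F dF r s dr ds r' s' dr' ds' a b c u v l dl : K}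
    (hs : s ≠ 0) (hs' : s' ≠ 0) (hr : r ≠ r')
    (e : F * s ^ 2 = r ^ 3 + a * r ^ 2 + b * r + c)
    (e' : F * s' ^ 2 = r' ^ 3 + a * r' ^ 2 + b * r' + c)
    (d : dF * s ^ 2 + F * (2 * s * ds) = (3 * r ^ 2 + 2 * a * r + b) * dr)
    (d' : dF * s' ^ 2 + F * (2 * s' * ds') = (3 * r' ^ 2 + 2 * a * r' + b) * dr')
    (hu : dr = u * s) (hv : dr' = v * s') (hl : l * (r - r') = s - s')
    (hdl : dl * (r - r') + l * (dr - dr') = ds - ds') :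
    dF * l ^ 2 + F * (2 * l * dl) - dr - dr' =
      (u + v) * -(l * (F * l ^ 2 - a - r - r' - r) + s) := by
  have hd := sub_ne_zero.mpr hr
  subst hu hv
  have d1 : dF * s + F * (2 * ds) = (3 * r ^ 2 + 2 * a * r + b) * u := by
    apply mul_right_cancel₀ hs
    linear_combination d
  have d2 : dF * s' + F * (2 * ds') = (3 * r' ^ 2 + 2 * a * r' + b) * v := by
    apply mul_right_cancel₀ hs'
    linear_combination d'
  obtain rfl : s = s' + l * (r - r') := by linear_combination -hl
  -- The cubic minus `F` times the squared chord has roots `r`, `r'` and `x₃ = F l² - a - r - r'`.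
  -- The relations `k1` and `k2` compute its derivative at `r` and, up to sign, at `r'` as products
  -- of differences of roots.
  have k1 : 3 * r ^ 2 + 2 * a * r + b - 2 * F * l * (s' + l * (r - r')) =
      -(r - r') * (F * l ^ 2 - a - 2 * r - r') := by
    apply mul_right_cancel₀ hd
    linear_combination e' - e
  have k2 : -(3 * r' ^ 2 + 2 * a * r' + b) + 2 * F * l * s' =
      -(r - r') * (F * l ^ 2 - a - 2 * r - r') - (r - r') ^ 2 := by
    apply mul_right_cancel₀ hd
    linear_combination e - e'
  apply mul_right_cancel₀ hd
  linear_combination 2 * F * l * hdl + l * d1 - l * d2 + l * u * k1 + l * v * k2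

end Addition
namespace WeierstrassCurve

open RatFunc (ev RegAt)

variable {L : Type*} [Field L] [CharZero L] [IsAlgClosed L] [DecidableEq L]
variable {W W' W'' : WeierstrassCurve L} [W.IsElliptic] [W'.IsElliptic] [W''.IsElliptic]
variable {f g : W.toAffine.Point →+ W'.toAffine.Point} {r s r' s' : RatFunc L}

/-- Duplication multiplies the invariant differential `dx/η` by 2. Here this is an explicit
computation with the tangent formula. -/
lemma deriv_doubleX : RatFunc.deriv (doubleX W) = 2 * doubleY W := by
  have h0 : W.cubicFun ≠ 0 := cubicFun_ne_zero
  have e1 : doubleX W = algebraMap L[X] (RatFunc L) W.cubic.derivative ^ 2 / (4 * W.cubicFun) -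
      RatFunc.C (W.b₂ / 4) - 2 * RatFunc.X := by
    rw [doubleX]
    simp only [map_sub, map_mul, map_add, map_pow, RatFunc.algebraMap_C, RatFunc.algebraMap_X,
      map_ofNat]
    field_simp
    ring
  have e2 : algebraMap L[X] (RatFunc L) W.cubic.derivative.derivative =
      2 * RatFunc.C (W.b₂ / 4) + 6 * RatFunc.X := by
    have : W.cubic.derivative.derivative = 2 * C (W.b₂ / 4) + 6 * X := by
      simp only [cubic, derivative_add, derivative_X_pow, derivative_mul, derivative_C,
        derivative_X, derivative_zero, derivative_one, map_natCast, derivative_natCast]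
      norm_num
      ring
    rw [this]
    simp only [map_mul, map_add, RatFunc.algebraMap_C, RatFunc.algebraMap_X, map_ofNat]
  have e3 : RatFunc.deriv (4 * W.cubicFun) = 4 * algebraMap L[X] (RatFunc L) W.cubic.derivative :=
      by
    rw [← map_ofNat (RatFunc.C (K := L)) 4, RatFunc.deriv_C_mul, RatFunc.deriv_algebraMap]
  have e4 : RatFunc.deriv (2 * RatFunc.X) = (2 : RatFunc L) := by
    rw [← map_ofNat (RatFunc.C (K := L)) 2, RatFunc.deriv_C_mul, RatFunc.deriv_X, mul_one]
  rw [doubleY, e1, map_sub, map_sub, Derivation.leibniz_div, RatFunc.deriv_C, e3, e4,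
    Derivation.leibniz_pow, RatFunc.deriv_algebraMap, e2]
  simp only [map_mul, map_ofNat, nsmul_eq_mul, smul_eq_mul]
  push_cast
  field_simp
  ring

/-- The pullback of the invariant differential is a constant multiple of the invariant
differential. -/
lemma Rep.exists_tangent (h : Rep f r s) : ∃ c, c ≠ 0 ∧ RatFunc.deriv r = RatFunc.C c * s := by
  have hs := h.s_ne_zero
  -- A homomorphism commutes with duplication, so the two composites have the same coordinate
  -- functions; the first ones are now differentiated.
  have h1 := h.comp (rep_double (W := W))
  have h2 := (rep_double (W := W')).comp h
  have h3 : f.comp (AddMonoidHom.id _ + AddMonoidHom.id _) =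
      (AddMonoidHom.id W'.toAffine.Point + AddMonoidHom.id W'.toAffine.Point).comp f := by ext; simp
  rw [h3] at h1
  obtain ⟨e1, e2⟩ := h1.unique h2
  have hne := h2.s_ne_zero
  set d := doubleX W
  have hd := (rep_double (W := W)).nonconst
  have e3 := congr(RatFunc.deriv $e1)
  have e4 : RatFunc.deriv r = RatFunc.deriv r / s * s := (div_mul_cancel₀ _ hs).symm
  rw [RatFunc.deriv_compHom, RatFunc.deriv_compHom, deriv_doubleX, deriv_doubleX, e4, map_mul,
    map_mul, map_ofNat] at e3
  -- The ratio `r'/s` is invariant under composition with the duplication function. Its height is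
  -- thus equal to four times itself, hence zero, and the ratio is constant.
  have e5 : RatFunc.compHom _ hd (RatFunc.deriv r / s) = RatFunc.deriv r / s := by
    apply mul_right_cancel₀ (mul_ne_zero (two_ne_zero' (RatFunc L)) hne)
    linear_combination e3 - 2 * RatFunc.compHom _ hd (RatFunc.deriv r / s) * e2
  have e6 := congr(RatFunc.height $e5)
  rw [RatFunc.height_compHom, height_doubleX] at e6
  obtain ⟨c, hc⟩ := RatFunc.height_eq_zero.mp (show (RatFunc.deriv r / s).height = 0 by omega)
  refine ⟨c, ?_, by rw [← hc, ← e4]⟩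
  rintro rfl
  rw [map_zero, div_eq_zero_iff, or_iff_left hs] at hc
  exact h.nonconst (RatFunc.deriv_eq_zero hc)

/-- The homomorphism `f` acts on invariant differentials as multiplication by `c`. -/
def HasTangent (f : W.toAffine.Point →+ W'.toAffine.Point) (c : L) : Prop :=
  f = 0 ∧ c = 0 ∨ ∃ r s, Rep f r s ∧ RatFunc.deriv r = RatFunc.C c * s

namespace HasTangent

variable {c c' : L}

lemma isRegularHom (h : HasTangent f c) : IsRegularHom f := by
  rcases h with h | ⟨r, s, h, -⟩
  · exact .inl h.1
  · exact .inr ⟨r, s, h⟩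

lemma unique (h : HasTangent f c) (h' : HasTangent f c') : c = c' := by
  rcases h with ⟨rfl, rfl⟩ | ⟨r, s, h, hc⟩
  · rcases h' with ⟨-, rfl⟩ | ⟨r, s, h, -⟩
    · rfl
    · exact absurd rfl h.ne_zero
  · rcases h' with ⟨rfl, -⟩ | ⟨r, s, h', hc'⟩
    · exact absurd rfl h.ne_zero
    · obtain ⟨rfl, rfl⟩ := h.unique h'
      rw [hc] at hc'
      exact RatFunc.C_injective (mul_right_cancel₀ h.s_ne_zero hc')

/-- In characteristic zero `r' = 0` makes `r` constant, which a nonzero homomorphism excludes. -/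
lemma eq_zero (h : HasTangent f 0) : f = 0 := by
  rcases h with h | ⟨r, s, h, hc⟩
  · exact h.1
  · rw [map_zero, zero_mul] at hc
    exact absurd (RatFunc.deriv_eq_zero hc) h.nonconst

lemma zero : HasTangent (0 : W.toAffine.Point →+ W'.toAffine.Point) 0 := .inl ⟨rfl, rfl⟩

lemma id : HasTangent (AddMonoidHom.id W.toAffine.Point) 1 :=
  .inr ⟨_, _, Rep.id, by rw [RatFunc.deriv_X, map_one, one_mul]⟩

lemma double : HasTangent (AddMonoidHom.id W.toAffine.Point + AddMonoidHom.id _) 2 :=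
  .inr ⟨_, _, rep_double, by rw [deriv_doubleX, map_ofNat]⟩

lemma neg (h : HasTangent f c) : HasTangent (-f) (-c) := by
  rcases h with ⟨rfl, rfl⟩ | ⟨r, s, h, hc⟩
  · simpa using zero
  · exact .inr ⟨_, _, h.neg, by rw [hc, map_neg, neg_mul_neg]⟩

lemma comp {g : W'.toAffine.Point →+ W''.toAffine.Point} (hg : HasTangent g c')
    (hf : HasTangent f c) : HasTangent (g.comp f) (c' * c) := by
  rcases hf with ⟨rfl, rfl⟩ | ⟨r, s, hf, hc⟩
  · rw [AddMonoidHom.comp_zero, mul_zero]; exact zero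
  rcases hg with ⟨rfl, rfl⟩ | ⟨r', s', hg, hc'⟩
  · rw [AddMonoidHom.zero_comp, zero_mul]; exact zero
  refine .inr ⟨_, _, hg.comp hf, ?_⟩
  rw [RatFunc.deriv_compHom, hc, hc', map_mul, map_mul, ← RatFunc.algebraMap_eq_C,
    AlgHom.commutes]
  ring

/-- For distinct `x`-coordinate functions this is `derivation_sum_eq` applied to the chord.
Otherwise the homomorphisms agree up to sign, and duplication has constant 2. -/
lemma add (hf : HasTangent f c) (hg : HasTangent g c') : HasTangent (f + g) (c + c') := by
  rcases hf with ⟨rfl, rfl⟩ | ⟨r, s, hf, hc⟩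
  · rwa [zero_add, zero_add]
  rcases hg with ⟨rfl, rfl⟩ | ⟨r', s', hg, hc'⟩
  · rw [add_zero, add_zero]
    exact .inr ⟨_, _, hf, hc⟩
  by_cases hr : r = r'
  · subst hr
    have hf' : HasTangent f c := .inr ⟨_, _, hf, hc⟩
    have hg' : HasTangent g c' := .inr ⟨_, _, hg, hc'⟩
    rcases hf.eq_or_eq_neg hg with rfl | rfl
    · have e : f + f = (AddMonoidHom.id W'.toAffine.Point + AddMonoidHom.id W'.toAffine.Point).comp
        f := by ext; simp
      rw [hf'.unique hg', e, ← two_mul]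
      exact double.comp hg'
    · rw [hf'.unique hg'.neg, neg_add_cancel, neg_add_cancel]
      exact zero
  · refine .inr ⟨_, _, hf.add hg hr, ?_⟩
    have e1 := hf.cubic_eq
    have e2 := hg.cubic_eq
    have d1 := congr(RatFunc.deriv $e1)
    have d2 := congr(RatFunc.deriv $e2)
    rw [aeval_cubic_ratFunc] at e1 e2 d1 d2
    simp only [map_add, Derivation.leibniz, Derivation.leibniz_pow, RatFunc.deriv_C,
      smul_eq_mul, nsmul_eq_mul, mul_zero] at d1 d2
    push_cast at d1 d2
    set l := (s - s') / (r - r') with hl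
    have hd := sub_ne_zero.mpr hr
    have hl' : l * (r - r') = s - s' := div_mul_cancel₀ _ hd
    have hdl := congr(RatFunc.deriv $hl')
    rw [Derivation.leibniz, map_sub, map_sub, smul_eq_mul, smul_eq_mul] at hdl
    have := derivation_sum_eq hf.s_ne_zero hg.s_ne_zero hr e1 e2
      (dF := RatFunc.deriv W.cubicFun) (ds := RatFunc.deriv s) (ds' := RatFunc.deriv s') (dr :=
          RatFunc.deriv r) (dr' := RatFunc.deriv r')
      (by linear_combination d1) (by linear_combination d2) hc hc' hl'
      (dl := RatFunc.deriv l) (by linear_combination hdl)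
    rw [sumY, sumX, ← hl]
    simp only [map_sub, Derivation.leibniz, Derivation.leibniz_pow, RatFunc.deriv_C, map_add,
      smul_eq_mul, nsmul_eq_mul]
    push_cast
    linear_combination this

lemma sub (hf : HasTangent f c) (hg : HasTangent g c') : HasTangent (f - g) (c - c') := by
  rw [sub_eq_add_neg, sub_eq_add_neg]
  exact hf.add hg.neg

/-- By additivity and `HasTangent.eq_zero`, the action on differentials is faithful. This allows
endomorphisms to be identified by comparing numbers. -/
lemma ext (hf : HasTangent f c) (hg : HasTangent g c) : f = g := by
  have := hf.sub hg
  rw [sub_self] at this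
  exact sub_eq_zero.mp this.eq_zero

lemma zsmul (hf : HasTangent f c) (n : ℤ) : HasTangent (n • f) (n * c) := by
  induction n with
  | zero => simpa using zero
  | succ n ih =>
    rw [add_zsmul, one_zsmul]
    push_cast at ih ⊢
    rw [add_mul, one_mul]
    exact ih.add hf
  | pred n ih =>
    rw [sub_zsmul, one_zsmul]
    push_cast at ih ⊢
    rw [sub_mul, one_mul]
    exact ih.sub hf

end HasTangent

/-! ### The endomorphism ring with the degree form -/

variable (W) in
/-- The ring of endomorphisms given by rational functions. -/
def regularEnd : Subring (AddMonoid.End W.toAffine.Point) where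
  carrier := {f | IsRegularHom (W := W) (W' := W) f}
  mul_mem' hf hg := IsRegularHom.comp hf hg
  one_mem' := .inr ⟨_, _, Rep.id⟩
  add_mem' hf hg := IsRegularHom.add hf hg
  zero_mem' := .zero
  neg_mem' hf := IsRegularHom.neg hf

/-- The degree of an endomorphism, as an integer. -/
def endDeg (f : regularEnd W) : ℤ := (homDeg (W := W) (W' := W) f.1 : ℕ)

lemma endDeg_parallelogram (x y : regularEnd W) :
    endDeg (x + y) + endDeg (x - y) = 2 * endDeg x + 2 * endDeg y :=
  congr((($(IsRegularHom.homDeg_parallelogram x.2 y.2) : ℕ) : ℤ))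

lemma endDeg_mul (x y : regularEnd W) : endDeg (x * y) = endDeg x * endDeg y :=
  congr((($(IsRegularHom.homDeg_comp x.2 y.2) : ℕ) : ℤ)).trans (Nat.cast_mul _ _)

lemma endDeg_one : endDeg (1 : regularEnd W) = 1 :=
  congr((($(homDeg_id (W := W)) : ℕ) : ℤ))

lemma endDeg_zero : endDeg (0 : regularEnd W) = 0 :=
  congr((($(homDeg_zero (W := W) (W' := W)) : ℕ) : ℤ))

lemma endDeg_nonneg (x : regularEnd W) : 0 ≤ endDeg x := Int.natCast_nonneg _

lemma eq_zero_of_endDeg_eq_zero {x : regularEnd W} (hx : endDeg x = 0) : x = 0 :=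
  Subtype.ext ((IsRegularHom.homDeg_eq_zero x.2).mp (Int.natCast_eq_zero.mp hx))

/-- An endomorphism that is not an integer gives rise to an endomorphism whose square is a
negative integer. -/
theorem exists_sq_eq_neg {f : AddMonoid.End W.toAffine.Point} (hf : f ∈ regularEnd W)
    (hne : ∀ m : ℤ, f ≠ m) :
    ∃ g ∈ regularEnd W, ∃ M : ℕ, 0 < M ∧ g * g = -(M : AddMonoid.End W.toAffine.Point) := by
  obtain ⟨t, h1, h2⟩ :=
    exists_trace_of_multiplicative_parallelogram endDeg_parallelogram endDeg_mul endDeg_one ⟨f, hf⟩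
  set a : regularEnd W := ⟨f, hf⟩
  have h3 := eq_zero_of_endDeg_eq_zero h1
  -- Completing the square in `a² - t a + deg a = 0` gives `g² = t² - 4 deg a`, and `h2` says that
  -- this is `-deg g`.
  set g : regularEnd W := 2 • a - t • 1 with hg
  have h4 : g * g = -((endDeg g : ℤ) : regularEnd W) := by
    rw [h2, hg]
    simp only [zsmul_eq_mul, mul_one, nsmul_eq_mul] at h3 ⊢
    have ht : (t : regularEnd W) * a = a * t := (Int.cast_commute t a).eq
    push_cast
    have : a * a = t * a - endDeg a := by
      rw [← sub_eq_zero, ← h3]; abel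
    have e : ((2 : regularEnd W) * a - t) * (2 * a - t) =
        4 * (a * a) - 2 * (t * a) - 2 * (a * t) + t ^ 2 := by
      noncomm_ring
    rw [e, ← ht, this]
    noncomm_ring
  -- Degree zero means `t² = 4 deg a`, so `t = 2m`, and `2 (a - m) = g = 0`. Then `4 deg (a - m) =
  -- 0`, and `a` would be the integer `m`.
  have h5 : endDeg g ≠ 0 := by
    intro h
    have hg0 := eq_zero_of_endDeg_eq_zero h
    rw [h] at h2
    have hev : Even t := by
      have : Even (t ^ 2) := ⟨2 * endDeg a, by linarith⟩
      exact (Int.even_pow.mp this).1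
    obtain ⟨m, rfl⟩ := hev
    apply hne m
    have h6 : a - m • 1 = 0 := by
      apply eq_zero_of_endDeg_eq_zero
      have h7 := endDeg_parallelogram (a - m • 1) (a - m • 1)
      rw [sub_self, show a - m • (1 : regularEnd W) + (a - m • 1) = g by
        rw [hg, add_smul, two_smul]; abel, hg0] at h7
      rw [endDeg_zero] at h7
      linarith
    have h9 := congr(Subtype.val $(sub_eq_zero.mp h6))
    simpa using h9
  refine ⟨g.1, g.2, homDeg (W := W) (W' := W) g.1, ?_, ?_⟩
  · have := endDeg_nonneg g
    have h6 : 0 < endDeg g := lt_of_le_of_ne this h5.symm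
    exact Int.natCast_pos.mp h6
  · have := congr(Subtype.val $h4)
    simpa [endDeg] using this

/-- The degree of an endomorphism with square `-M`. -/
lemma homDeg_of_sq_eq_neg {f : AddMonoid.End W.toAffine.Point} (hf : f ∈ regularEnd W) {M : ℕ}
    (hM : f * f = -(M : AddMonoid.End W.toAffine.Point)) :
    homDeg (W := W) (W' := W) f = M := by
  -- The polar form evaluates the degree of multiplication by `-M` as `M²`. By multiplicativity this
  -- is `(deg f)²`.
  have h1 := parallelogramPolar_self (endDeg_parallelogram (W := W)) (-(M • 1))
  simp only [map_neg, map_nsmul, AddMonoidHom.neg_apply, AddMonoidHom.smul_apply,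
    parallelogramPolar_self, endDeg_one] at h1
  have h2 : endDeg (W := W) (-(M • 1)) = endDeg ⟨f, hf⟩ * endDeg ⟨f, hf⟩ := by
    have e : (-(M • 1) : regularEnd W) = ⟨f, hf⟩ * ⟨f, hf⟩ := by
      apply Subtype.ext
      simp [hM]
    rw [e]
    exact endDeg_mul _ _
  rw [h2] at h1
  simp only [nsmul_eq_mul] at h1
  have h3 : (endDeg ⟨f, hf⟩) ^ 2 = (M : ℤ) ^ 2 := by
    push_cast at h1
    linarith
  have h4 := (sq_eq_sq₀ (endDeg_nonneg _) (Int.natCast_nonneg _)).mp h3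
  exact Int.ofNat_inj.mp h4

end WeierstrassCurve

/-! ### Values of fractions at a point of the underlying ring -/

section HasVal

variable {R M L : Type*} [CommRing R] [IsDomain R] [Field M] [Algebra R M] [IsFractionRing R M]
  [Field L]

/-- The fraction `f` is defined at the `L`-valued point `θ` of `R` and takes the value `v`. -/
def HasVal (θ : R →+* L) (f : M) (v : L) : Prop :=
  ∃ a b : R, θ b ≠ 0 ∧ f * algebraMap R M b = algebraMap R M a ∧ θ a = v * θ b

namespace HasVal

variable {θ : R →+* L} {f g : M} {u v : L}

lemma of_algebraMap (a : R) : HasVal θ (algebraMap R M a) (θ a) :=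
  ⟨a, 1, by simp, by simp, by simp⟩

lemma unique (hf : HasVal θ f u) (hg : HasVal θ f v) : u = v := by
  obtain ⟨a, b, hb, h, e⟩ := hf
  obtain ⟨a', b', hb', h', e'⟩ := hg
  have h1 : a * b' = a' * b := by
    apply IsFractionRing.injective R M
    rw [map_mul, map_mul, ← h, ← h']
    ring
  have h2 := congr(θ $h1)
  rw [map_mul, map_mul, e, e'] at h2
  apply mul_right_cancel₀ (mul_ne_zero hb hb')
  linear_combination h2

lemma add (hf : HasVal θ f u) (hg : HasVal θ g v) : HasVal θ (f + g) (u + v) := by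
  obtain ⟨a, b, hb, h, e⟩ := hf
  obtain ⟨a', b', hb', h', e'⟩ := hg
  refine ⟨a * b' + a' * b, b * b', by rw [map_mul]; exact mul_ne_zero hb hb', ?_, ?_⟩
  · rw [map_mul, map_add, map_mul, map_mul, ← h, ← h']
    ring
  · rw [map_add, map_mul, map_mul, map_mul, e, e']
    ring

lemma mul (hf : HasVal θ f u) (hg : HasVal θ g v) : HasVal θ (f * g) (u * v) := by
  obtain ⟨a, b, hb, h, e⟩ := hf
  obtain ⟨a', b', hb', h', e'⟩ := hg
  refine ⟨a * a', b * b', by rw [map_mul]; exact mul_ne_zero hb hb', ?_, ?_⟩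
  · rw [map_mul, map_mul, ← h, ← h']
    ring
  · rw [map_mul, map_mul, e, e']
    ring

lemma neg (hf : HasVal θ f u) : HasVal θ (-f) (-u) := by
  obtain ⟨a, b, hb, h, e⟩ := hf
  exact ⟨-a, b, hb, by rw [map_neg, ← h]; ring, by rw [map_neg, e]; ring⟩

lemma sub (hf : HasVal θ f u) (hg : HasVal θ g v) : HasVal θ (f - g) (u - v) := by
  rw [sub_eq_add_neg, sub_eq_add_neg]
  exact hf.add hg.neg

lemma inv (hf : HasVal θ f u) (hu : u ≠ 0) : HasVal θ f⁻¹ u⁻¹ := by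
  obtain ⟨a, b, hb, h, e⟩ := hf
  have ha : θ a ≠ 0 := by rw [e]; exact mul_ne_zero hu hb
  have ha' : algebraMap R M a ≠ 0 := fun h0 => ha <| by
    rw [(map_eq_zero_iff _ (IsFractionRing.injective R M)).mp h0, map_zero]
  have hf : f ≠ 0 := by
    rintro rfl
    rw [zero_mul] at h
    exact ha' h.symm
  refine ⟨b, a, ha, ?_, ?_⟩
  · rw [← h, inv_mul_cancel_left₀ hf]
  · rw [e, inv_mul_cancel_left₀ hu]

lemma div (hf : HasVal θ f u) (hg : HasVal θ g v) (hv : v ≠ 0) : HasVal θ (f / g) (u / v) := by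
  rw [div_eq_mul_inv, div_eq_mul_inv]
  exact hf.mul (hg.inv hv)

lemma pow (hf : HasVal θ f u) (n : ℕ) : HasVal θ (f ^ n) (u ^ n) := by
  induction n with
  | zero => simpa using of_algebraMap (M := M) (θ := θ) 1
  | succ n ih =>
    rw [pow_succ, pow_succ]
    exact ih.mul hf

/-- A map of fraction fields is compatible with values as soon as it is so on the ring `R`. -/
lemma map {R' M' : Type*} [CommRing R'] [IsDomain R'] [Field M'] [Algebra R' M']
    [IsFractionRing R' M'] {θ' : R' →+* L} {φ : M →+* M'}
    (h : ∀ c, HasVal θ' (φ (algebraMap R M c)) (θ c)) (hf : HasVal θ f u) :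
    HasVal θ' (φ f) u := by
  obtain ⟨a, b, hb, h1, e⟩ := hf
  have h2 := (h a).div (h b) hb
  have h0 : algebraMap R M b ≠ 0 := fun h0 => hb <| by
    rw [(map_eq_zero_iff _ (IsFractionRing.injective R M)).mp h0, map_zero]
  rwa [← h1, map_mul, mul_div_cancel_right₀ _ ((map_ne_zero φ).mpr h0), e,
    mul_div_cancel_right₀ _ hb] at h2

end HasVal

end HasVal

/-! ### The function field as the quadratic extension `k(x)(η)` -/

namespace RatFunc

variable {k L : Type*} [Field k] [Field L] [Algebra k L]

/-- The numerator and denominator over `k` have no common zero even in `L`, so no pole can cancel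
after extension of scalars. -/
lemma regAt_extend {x : L} {r : RatFunc k} :
    RegAt x (extend k L r) ↔ aeval x r.denom ≠ 0 := by
  have h0 : r.denom.map (algebraMap k L) ≠ 0 := by simpa using r.denom_ne_zero
  constructor
  · intro h h1
    obtain ⟨p, q, hq, e⟩ := exists_div _ h
    rw [extend_eq_div, div_eq_div_iff (algebraMap_ne_zero h0) (algebraMap_ne_zero_of_eval hq),
      ← map_mul, ← map_mul] at e
    have e := congr(Polynomial.eval x $(algebraMap_injective L e))
    rw [Polynomial.eval_mul, Polynomial.eval_mul, eval_map_algebraMap, eval_map_algebraMap, h1,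
        mul_zero,
      mul_eq_zero, or_iff_left hq] at e
    obtain ⟨u, v, huv⟩ := r.isCoprime_num_denom
    have := congr(aeval x $huv)
    simp [e, h1] at this
  · intro h
    rw [extend_eq_div]
    exact (regAt_div (by rwa [eval_map_algebraMap])).1

lemma ev_extend {x : L} {r : RatFunc k} (h : RegAt x (extend k L r)) :
    ev x (extend k L r) = aeval x r.num / aeval x r.denom := by
  rw [regAt_extend] at h
  rw [extend_eq_div, (regAt_div (by rwa [eval_map_algebraMap])).2, eval_map_algebraMap,
    eval_map_algebraMap]

end RatFunc

namespace WeierstrassCurve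

open RatFunc (ev RegAt extend)

variable {k : Type*} [Field k] [CharZero k] (V : WeierstrassCurve k)

/-- The field of rational functions in `x`, as a subfield of the function field. -/
def ofX : RatFunc k →ₐ[k] V.toAffine.FunctionField :=
  RatFunc.liftAlgHom (IsScalarTower.toAlgHom k k[X] V.toAffine.FunctionField) <|
    nonZeroDivisors_le_comap_nonZeroDivisors_of_injective _
      (FaithfulSMul.algebraMap_injective k[X] V.toAffine.FunctionField)

lemma ofX_algebraMap (p : k[X]) : V.ofX (algebraMap k[X] (RatFunc k) p) =
    algebraMap V.toAffine.CoordinateRing V.toAffine.FunctionField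
      (Affine.CoordinateRing.mk V.toAffine (C p)) := by
  rw [ofX, ← div_one (algebraMap k[X] (RatFunc k) p), ← map_one (algebraMap k[X] (RatFunc k)),
    RatFunc.liftAlgHom_apply_div, map_one, div_one]
  rfl

/-- The function `η = y + (a₁ x + a₃) / 2`. -/
def etaFun : V.toAffine.FunctionField :=
  algebraMap V.toAffine.CoordinateRing V.toAffine.FunctionField
    (Affine.CoordinateRing.mk V.toAffine Y) +
  V.ofX (algebraMap k[X] (RatFunc k) (C (V.a₁ / 2) * X + C (V.a₃ / 2)))

lemma etaFun_sq : V.etaFun ^ 2 = V.ofX (algebraMap k[X] (RatFunc k) V.cubic) := by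
  rw [etaFun, ofX_algebraMap, ofX_algebraMap, ← map_add, ← map_pow, ← map_add, ← map_pow]
  congr 1
  -- After completing the square, `η² - cubic` is exactly the Weierstrass polynomial, so the
  -- cofactor is 1.
  refine AdjoinRoot.mk_eq_mk.mpr ⟨1, ?_⟩
  have h2 : (C (V.a₁ / 2) : k[X]) * 2 = C V.a₁ := by
    rw [← map_ofNat C, ← C_mul, div_mul_cancel₀ _ two_ne_zero]
  have h3 : (C (V.a₃ / 2) : k[X]) * 2 = C V.a₃ := by
    rw [← map_ofNat C, ← C_mul, div_mul_cancel₀ _ two_ne_zero]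
  have h4 : (C (V.b₂ / 4) : k[X]) = C (V.a₁ / 2) ^ 2 + C V.a₂ := by
    rw [← C_pow, ← C_add, b₂]; congr 1; ring
  have h5 : (C (V.b₄ / 2) : k[X]) = 2 * C (V.a₁ / 2) * C (V.a₃ / 2) + C V.a₄ := by
    rw [← map_ofNat C, ← C_mul, ← C_mul, ← C_add, b₄]; congr 1; ring
  have h6 : (C (V.b₆ / 4) : k[X]) = C (V.a₃ / 2) ^ 2 + C V.a₆ := by
    rw [← C_pow, ← C_add, b₆]; congr 1; ring
  rw [Affine.polynomial, cubic, h4, h5, h6]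
  simp only [toAffine, ← h2, ← h3, map_add, map_mul, map_pow, map_ofNat]
  ring

variable {V}

/-- Otherwise `A² = B² · cubic` with `B ≠ 0`, which is impossible because the cubic has odd degree.
-/
lemma ofX_add_ofX_mul_etaFun_eq_zero {A B : RatFunc k} (h : V.ofX A + V.ofX B * V.etaFun = 0) :
    A = 0 ∧ B = 0 := by
  have hB : B = 0 := by
    by_contra hB
    have h1 : V.ofX (A ^ 2) = V.ofX (B ^ 2 * algebraMap k[X] (RatFunc k) V.cubic) := by
      rw [map_mul, ← etaFun_sq, map_pow, map_pow]
      linear_combination (V.ofX A - V.ofX B * V.etaFun) * h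
    have h2 := V.ofX.injective h1
    have h0 : algebraMap k[X] (RatFunc k) V.cubic ≠ 0 :=
      RatFunc.algebraMap_ne_zero V.cubic_monic.ne_zero
    have hA : A ≠ 0 := by
      rintro rfl
      exact mul_ne_zero (pow_ne_zero 2 hB) h0 (by rw [← h2]; ring)
    have h3 := congr(RatFunc.intDegree $h2)
    rw [sq, sq, RatFunc.intDegree_mul (mul_ne_zero hB hB) h0, RatFunc.intDegree_mul hA hA,
      RatFunc.intDegree_mul hB hB, RatFunc.intDegree_polynomial] at h3
    have e1 : V.cubic.natDegree = 3 := by unfold cubic; compute_degree!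
    omega
  subst hB
  rw [map_zero, zero_mul, add_zero, map_eq_zero] at h
  exact ⟨h, rfl⟩

variable (V) in
lemma exists_ofX_add_ofX_mul_etaFun (z : V.toAffine.FunctionField) :
    ∃ A B, z = V.ofX A + V.ofX B * V.etaFun := by
  obtain ⟨a, b, hb, rfl⟩ := IsFractionRing.div_surjective (A := V.toAffine.CoordinateRing) z
  have hb0 := nonZeroDivisors.ne_zero hb
  have : Algebra.IsIntegral k[X] V.toAffine.CoordinateRing :=
    have := Module.Finite.of_basis (Affine.CoordinateRing.basis V.toAffine)
    inferInstance
  -- The coordinate ring is integral over `k[x]`, so the fraction can be rewritten with a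
  -- denominator in `k[x]`.
  obtain ⟨c, d, hd, e⟩ := Algebra.IsAlgebraic.exists_smul_eq_mul k[X] a hb0
  obtain ⟨p, q, rfl⟩ := Affine.CoordinateRing.exists_smul_basis_eq c
  have hd' := RatFunc.algebraMap_ne_zero hd
  refine ⟨algebraMap k[X] (RatFunc k) (p - q * (C (V.a₁ / 2) * X + C (V.a₃ / 2))) /
    algebraMap k[X] (RatFunc k) d, algebraMap k[X] (RatFunc k) q / algebraMap k[X] (RatFunc k) d,
        ?_⟩
  have h1 := (map_ne_zero V.ofX).mpr hd'
  have h2 : algebraMap V.toAffine.CoordinateRing V.toAffine.FunctionField b ≠ 0 := by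
    simpa using hb0
  have e' := congr(algebraMap V.toAffine.CoordinateRing V.toAffine.FunctionField $e)
  simp only [Affine.CoordinateRing.smul, map_mul, map_add, ← ofX_algebraMap, mul_one] at e'
  rw [etaFun]
  generalize C (V.a₁ / 2) * X + C (V.a₃ / 2) = g
  rw [map_div₀ V.ofX, map_div₀ V.ofX, map_sub, map_sub, map_mul, map_mul]
  field_simp
  linear_combination e'

variable {L : Type*} [Field L] [Algebra k L] {x η : L}

variable (V) in
/-- The evaluation of polynomials in the coordinates at the point `(x, η)`. -/
def pointEval (h : η ^ 2 = aeval x V.cubic) : V.toAffine.CoordinateRing →+* L :=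
  AdjoinRoot.lift (aeval x).toRingHom
    (η - (algebraMap k L V.a₁ * x + algebraMap k L V.a₃) / 2) <| by
  have := charZero_of_injective_algebraMap (algebraMap k L).injective
  rw [aeval_cubic, b₂, b₄, b₆] at h
  simp only [map_div₀, map_add, map_mul, map_pow, map_ofNat] at h
  rw [Affine.polynomial]
  simp only [eval₂_sub, eval₂_add, eval₂_mul, eval₂_pow, eval₂_X, eval₂_C, toAffine,
    AlgHom.toRingHom_eq_coe, RingHom.coe_coe, map_add, map_mul, aeval_X, aeval_C, map_pow]
  linear_combination h

lemma pointEval_mk (h : η ^ 2 = aeval x V.cubic) (p : k[X][Y]) :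
    V.pointEval h (Affine.CoordinateRing.mk V.toAffine p) =
      aevalAeval x (η - (algebraMap k L V.a₁ * x + algebraMap k L V.a₃) / 2) p := by
  rw [pointEval, AdjoinRoot.lift_mk]
  generalize η - (algebraMap k L V.a₁ * x + algebraMap k L V.a₃) / 2 = y
  have : eval₂RingHom (aeval x).toRingHom y = (aevalAeval (R := k) x y).toRingHom := by
    ext <;> simp
  exact congr($this p)

variable {h : η ^ 2 = aeval x V.cubic}

lemma hasVal_ofX {r : RatFunc k} (hr : RegAt x (extend k L r)) :
    HasVal (V.pointEval h) (V.ofX r) (ev x (extend k L r)) := by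
  have h0 := RatFunc.regAt_extend.mp hr
  have key : ∀ p : k[X], HasVal (V.pointEval h) (V.ofX (algebraMap k[X] (RatFunc k) p))
      (aeval x p) := fun p => by
    have := HasVal.of_algebraMap (θ := V.pointEval h) (M := V.toAffine.FunctionField)
      (Affine.CoordinateRing.mk V.toAffine (C p))
    rwa [← ofX_algebraMap, pointEval_mk, aevalAeval_C] at this
  have := (key r.num).div (key r.denom) h0
  rwa [← map_div₀, r.num_div_denom, ← RatFunc.ev_extend hr] at this

lemma hasVal_algebraMap (c : k) : HasVal (V.pointEval h) (algebraMap k V.toAffine.FunctionField c)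
    (algebraMap k L c) := by
  have := hasVal_ofX (h := h) (r := RatFunc.C c)
    (by rw [RatFunc.extend_C]; exact RatFunc.regAt_C _ _)
  rwa [RatFunc.extend_C, RatFunc.ev_C, ← RatFunc.algebraMap_eq_C, AlgHom.commutes] at this

/-- If the denominator vanished at `x`, having a value would force the numerator to vanish too,
contradicting coprimality. Writing the function with denominators that involve `y` does not remove a
pole in `x`. -/
lemma regAt_of_hasVal {r : RatFunc k} {v : L} (hr : HasVal (V.pointEval h) (V.ofX r) v) :
    RegAt x (extend k L r) ∧ v = ev x (extend k L r) := by
  have : RegAt x (extend k L r) := by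
    rw [RatFunc.regAt_extend]
    intro h0
    have h1 := hr.mul (HasVal.of_algebraMap (θ := V.pointEval h)
      (Affine.CoordinateRing.mk V.toAffine (C r.denom)))
    rw [← ofX_algebraMap, ← map_mul, pointEval_mk, aevalAeval_C, h0, mul_zero] at h1
    have h2 := HasVal.of_algebraMap (θ := V.pointEval h) (M := V.toAffine.FunctionField)
      (Affine.CoordinateRing.mk V.toAffine (C r.num))
    rw [← ofX_algebraMap, pointEval_mk, aevalAeval_C] at h2
    have h3 : r * algebraMap k[X] (RatFunc k) r.denom = algebraMap k[X] (RatFunc k) r.num :=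
      ((div_eq_iff (RatFunc.algebraMap_ne_zero r.denom_ne_zero)).mp r.num_div_denom).symm
    rw [h3] at h1
    have h4 := h2.unique h1
    obtain ⟨u, v, huv⟩ := r.isCoprime_num_denom
    have := congr(aeval x $huv)
    simp [h4, h0] at this
  exact ⟨this, hr.unique (hasVal_ofX this)⟩

lemma hasVal_etaFun : HasVal (V.pointEval h) V.etaFun η := by
  have := charZero_of_injective_algebraMap (algebraMap k L).injective
  have := (HasVal.of_algebraMap (θ := V.pointEval h) (M := V.toAffine.FunctionField)
      (Affine.CoordinateRing.mk V.toAffine Y)).add (HasVal.of_algebraMap (θ := V.pointEval h)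
      (Affine.CoordinateRing.mk V.toAffine (C (C (V.a₁ / 2) * X + C (V.a₃ / 2)))))
  rw [← ofX_algebraMap, pointEval_mk, pointEval_mk, aevalAeval_C, aevalAeval_Y] at this
  change HasVal _ V.etaFun _ at this
  convert this using 1
  simp only [map_add, map_mul, aeval_C, aeval_X, map_div₀, map_ofNat]
  ring

end WeierstrassCurve

/-! ### Every isogeny is given by rational functions -/

namespace WeierstrassCurve

open RatFunc (ev RegAt extend)

section BaseChange

variable {K : Type*} [Field K] (k L : Type*) [Field k] [CharZero k] [Field L] [CharZero L]
  [Algebra K k] [Algebra K L] [Algebra k L] [IsScalarTower K k L]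
variable (W : WeierstrassCurve K)

instance isElliptic_baseChange [W.IsElliptic] : (W⁄L).IsElliptic :=
  inferInstanceAs (W.map (algebraMap K L)).IsElliptic

lemma baseChange_eq_map : W⁄L = (W⁄k).map (algebraMap k L) := by
  rw [baseChange, baseChange, map_map, ← IsScalarTower.algebraMap_eq]

lemma cubic_baseChange : (W⁄L).cubic = (W⁄k).cubic.map (algebraMap k L) := by
  rw [baseChange_eq_map k]
  simp only [cubic, map_b₂, map_b₄, map_b₆, Polynomial.map_add, Polynomial.map_mul,
    Polynomial.map_pow, Polynomial.map_C, Polynomial.map_X, map_div₀, map_ofNat]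

variable {W L}

lemma IsPt.eq_aeval {P : (W⁄L).toAffine.Point} {x η : L} (h : IsPt P x η) :
    η ^ 2 = aeval x (W⁄k).cubic := by
  rw [h.eq, cubic_baseChange k, eval_map_algebraMap]

variable {k}

/-- Translates the notion of value used for isogenies into evaluation of fractions of the coordinate
ring, with the shift from `y` to `η`. -/
lemma hasValueAt_iff {x y v : L} (hP : (W⁄L).toAffine.Nonsingular x y)
    (f : (W⁄k).toAffine.FunctionField) :
    HasValueAt k L W f x y v ↔ HasVal ((W⁄k).pointEval ((isPt_some hP).eq_aeval k)) f v := by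
  have e : y + ((W⁄L).a₁ * x + (W⁄L).a₃) / 2 -
      (algebraMap k L (W⁄k).a₁ * x + algebraMap k L (W⁄k).a₃) / 2 = y := by
    rw [baseChange_eq_map k, map_a₁, map_a₃]
    ring
  constructor
  · rintro ⟨a, b, hb, h, ha⟩
    refine ⟨_, _, ?_, h, ?_⟩
    · rwa [pointEval_mk, e]
    · rwa [pointEval_mk, pointEval_mk, e]
  · rintro ⟨a, b, hb, h, ha⟩
    obtain ⟨a, rfl⟩ := AdjoinRoot.mk_surjective a
    obtain ⟨b, rfl⟩ := AdjoinRoot.mk_surjective b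
    rw [pointEval_mk, e] at hb
    rw [pointEval_mk, pointEval_mk, e] at ha
    exact ⟨a, b, hb, h, ha⟩

end BaseChange

namespace Isogeny

variable {K : Type*} [Field K] {k L : Type*} [Field k] [CharZero k] [Field L] [CharZero L]
  [IsAlgClosed L] [DecidableEq L]
  [Algebra K k] [Algebra K L] [Algebra k L] [IsScalarTower K k L]
variable {W W' : WeierstrassCurve K} [W.IsElliptic] [W'.IsElliptic]

lemma hasVal_pullback (φ : Isogeny k L W W') {P : (W⁄L).toAffine.Point} {x η x' η' v : L}
    (hP : IsPt P x η) (hP' : IsPt (φ.toHom P) x' η') {f : (W'⁄k).toAffine.FunctionField}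
    (hf : HasVal ((W'⁄k).pointEval (hP'.eq_aeval k)) f v) :
    HasVal ((W⁄k).pointEval (hP.eq_aeval k)) (φ.pullback f) v := by
  obtain ⟨h, rfl⟩ := id hP
  obtain ⟨h', e⟩ := id hP'
  have := (hasValueAt_iff h (φ.pullback f) (v := v)).mp
    (φ.pullback_hasValueAt _ _ _ _ h h' e f v ((hasValueAt_iff h' f).mpr (by simpa using hf)))
  simpa using this

/-- An isogeny is given by rational functions `r`, `s` with coefficients in `k`. -/
theorem exists_rep (φ : Isogeny k L W W') : ∃ r s : RatFunc k,
    Rep (W := W⁄L) (W' := W'⁄L) φ.toHom (extend k L r) (extend k L s) := by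
  -- The pulled-back coordinates are a priori `A + B η` and `C + D η`; the aim is `B = 0` and `C =
  -- 0`.
  obtain ⟨A, B, hAB⟩ := (W⁄k).exists_ofX_add_ofX_mul_etaFun (φ.pullback ((W'⁄k).ofX RatFunc.X))
  obtain ⟨C, D, hCD⟩ := (W⁄k).exists_ofX_add_ofX_mul_etaFun (φ.pullback (W'⁄k).etaFun)
  have hval : ∀ᶠ P in cofinite, ∀ x η, IsPt P x η → ∀ x' η', IsPt (φ.toHom P) x' η' →
      x' = ev x (extend k L A) + ev x (extend k L B) * η ∧
        η' = ev x (extend k L C) + ev x (extend k L D) * η := by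
    filter_upwards [eventually_isPt (RatFunc.eventually_regAt (extend k L A)),
      eventually_isPt (RatFunc.eventually_regAt (extend k L B)),
      eventually_isPt (RatFunc.eventually_regAt (extend k L C)),
      eventually_isPt (RatFunc.eventually_regAt (extend k L D))]
      with P hA hB hC hD x η hP x' η' hP'
    have hX : HasVal ((W'⁄k).pointEval (hP'.eq_aeval k)) ((W'⁄k).ofX RatFunc.X) x' := by
      have := hasVal_ofX (h := hP'.eq_aeval k) (r := RatFunc.X)
        (by rw [RatFunc.extend_X]; exact RatFunc.regAt_X _)
      rwa [RatFunc.extend_X, show ev x' RatFunc.X = x' by simp] at this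
    have h1 := φ.hasVal_pullback hP hP' hX
    have h2 := φ.hasVal_pullback hP hP' hasVal_etaFun
    rw [hAB] at h1
    rw [hCD] at h2
    exact ⟨h1.unique ((hasVal_ofX (hA x η hP)).add ((hasVal_ofX (hB x η hP)).mul hasVal_etaFun)),
      h2.unique ((hasVal_ofX (hC x η hP)).add ((hasVal_ofX (hD x η hP)).mul hasVal_etaFun))⟩
  have hne : ∃ᶠ P in cofinite, φ.toHom P ≠ 0 := fun h =>
    φ.toHom_ne_zero (hom_ext_of_eventually (h.mono fun P hP => by simpa using hP))
  have hneg := (neg_injective.tendsto_cofinite).eventually hval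
  -- Since `φ(-P) = -φ(P)`, changing the sign of `η` must preserve the first coordinate and negate
  -- the second.
  have hBC : extend k L B = 0 ∧ extend k L C = 0 := by
    constructor
    · by_contra h0
      obtain ⟨P, hP0, hP, hP', hP1, hη, h1⟩ := (hne.and_eventually (hval.and (hneg.and
        (IsPt.eventually_ne_zero.and (eventually_eta_ne_zero.and
          (eventually_isPt (RatFunc.eventually_ev_ne_zero h0))))))).exists
      obtain ⟨x, η, hx⟩ := exists_isPt hP1
      obtain ⟨x', η', hx'⟩ := exists_isPt hP0
      have h2 := (hP x η hx x' η' hx').1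
      have h3 := (hP' x (-η) hx.neg x' (-η') (by rw [map_neg]; exact hx'.neg)).1
      have h4 : 2 * η * ev x (extend k L B) = 0 := by linear_combination h3 - h2
      simp [hη x η hx, h1 x η hx] at h4
    · by_contra h0
      obtain ⟨P, hP0, hP, hP', hP1, h1⟩ := (hne.and_eventually (hval.and (hneg.and
        (IsPt.eventually_ne_zero.and
          (eventually_isPt (RatFunc.eventually_ev_ne_zero h0)))))).exists
      obtain ⟨x, η, hx⟩ := exists_isPt hP1
      obtain ⟨x', η', hx'⟩ := exists_isPt hP0
      have h2 := (hP x η hx x' η' hx').2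
      have h3 := (hP' x (-η) hx.neg x' (-η') (by rw [map_neg]; exact hx'.neg)).2
      have h4 : 2 * ev x (extend k L C) = 0 := by linear_combination - h3 - h2
      simp [h1 x η hx] at h4
  rw [hBC.1, hBC.2] at hval
  -- The pullback is injective and fixes constants, so a constant image would make `x` constant on
  -- `W'`.
  have hA : ¬∃ c, extend k L A = RatFunc.C c := fun h => by
    rw [← RatFunc.height_eq_zero, RatFunc.height_extend, RatFunc.height_eq_zero] at h
    obtain ⟨c, rfl⟩ := h
    have hB : B = 0 := by simpa using hBC.1
    rw [hB, map_zero, zero_mul, add_zero, ← RatFunc.algebraMap_eq_C, AlgHom.commutes,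
      ← φ.pullback.commutes, ← (W'⁄k).ofX.commutes] at hAB
    have h1 := (W'⁄k).ofX.injective (φ.pullback.injective hAB)
    have h2 := congr(RatFunc.height $h1)
    rw [RatFunc.algebraMap_eq_C, RatFunc.height_eq_zero.mpr ⟨c, rfl⟩, RatFunc.height] at h2
    simp at h2
  -- An infinite kernel has infinite cosets, and on one of them the nonconstant function `A` would
  -- take a single value infinitely often.
  have hker : ∀ᶠ P in cofinite, φ.toHom P ≠ 0 := by
    by_contra h
    rw [not_eventually] at h
    obtain ⟨P₀, hP₀⟩ := hne.exists
    obtain ⟨x', η', hx'⟩ := exists_isPt hP₀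
    have h1 : ∃ᶠ P in cofinite, φ.toHom P = φ.toHom P₀ := by
      refine (add_right_injective P₀).tendsto_cofinite.frequently (h.mono fun P hP => ?_)
      rw [map_add, not_not.mp hP, add_zero]
    obtain ⟨P, hP, hP1, hP2, hP3⟩ := (h1.and_eventually (hval.and
      (IsPt.eventually_ne_zero.and (eventually_isPt (RatFunc.eventually_ev_ne
        (s := RatFunc.C x') fun h => hA ⟨_, h⟩))))).exists
    obtain ⟨x, η, hx⟩ := exists_isPt hP2
    have h2 := (hP1 x η hx x' η' (by rwa [hP])).1
    apply hP3 x η hx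
    rw [RatFunc.ev_C, h2]
    simp
  refine ⟨A, D, ?_⟩
  filter_upwards [hval, hker] with P hP hP0 x η hx
  obtain ⟨x', η', hx'⟩ := exists_isPt hP0
  obtain ⟨rfl, rfl⟩ := hP x η hx x' η' hx'
  simpa [mul_comm] using hx'

end Isogeny

end WeierstrassCurve

/-! ### Regularity at every point outside the kernel -/

section AddFormula

/-- The `x`-coordinate of the sum of two points in terms of `(x, η)`-coordinates. -/
def chordX {M : Type*} [Field M] (b x e x' e' : M) : M :=
  ((e - e') / (x - x')) ^ 2 - b - x - x'

/-- The `η`-coordinate of the sum of two points in terms of `(x, η)`-coordinates. -/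
def chordY {M : Type*} [Field M] (b x e x' e' : M) : M :=
  -((e - e') / (x - x') * (chordX b x e x' e' - x) + e)

variable {R M L : Type*} [CommRing R] [IsDomain R] [Field M] [Algebra R M] [IsFractionRing R M]
  [Field L] {θ : R →+* L} {b x e x' e' : M} {b₀ x₀ e₀ x₀' e₀' : L}

lemma HasVal.chord (hb : HasVal θ b b₀) (hx : HasVal θ x x₀) (he : HasVal θ e e₀)
    (hx' : HasVal θ x' x₀') (he' : HasVal θ e' e₀') (hne : x₀ ≠ x₀') :
    HasVal θ (chordX b x e x' e') (chordX b₀ x₀ e₀ x₀' e₀') ∧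
      HasVal θ (chordY b x e x' e') (chordY b₀ x₀ e₀ x₀' e₀') := by
  have h1 := (he.sub he').div (hx.sub hx') (sub_ne_zero.mpr hne)
  have h2 := (((h1.pow 2).sub hb).sub hx).sub hx'
  exact ⟨h2, ((h1.mul (h2.sub hx)).add he).neg⟩

end AddFormula

namespace RatFunc

variable {L : Type*} [Field L]

lemma extend_self (r : RatFunc L) : extend L L r = r := by
  rw [extend_eq_div, Algebra.algebraMap_self, Polynomial.map_id, Polynomial.map_id, num_div_denom]

end RatFunc

namespace WeierstrassCurve

open RatFunc (ev RegAt extend)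

section Values

variable {k L : Type*} [Field k] [CharZero k] [Field L] [Algebra k L] {V : WeierstrassCurve k}
  {x η u : L} {h : η ^ 2 = aeval x V.cubic} {z : V.toAffine.FunctionField}

lemma hasVal_aeval (hz : HasVal (V.pointEval h) z u) (p : k[X]) :
    HasVal (V.pointEval h) (aeval z p) (aeval u p) := by
  induction p using Polynomial.induction_on' with
  | add p q hp hq => rw [map_add, map_add]; exact hp.add hq
  | monomial n a =>
    rw [aeval_monomial, aeval_monomial]
    exact (hasVal_algebraMap a).mul (hz.pow n)

lemma hasVal_aeval_div {r : RatFunc k} (hz : HasVal (V.pointEval h) z u)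
    (hr : RegAt u (extend k L r)) :
    HasVal (V.pointEval h) (aeval z r.num / aeval z r.denom) (ev u (extend k L r)) := by
  rw [RatFunc.ev_extend hr]
  exact (hasVal_aeval hz _).div (hasVal_aeval hz _) (RatFunc.regAt_extend.mp hr)

lemma hasVal_ofX_X : HasVal (V.pointEval h) (V.ofX RatFunc.X) x := by
  have := hasVal_ofX (h := h) (r := RatFunc.X)
    (by rw [RatFunc.extend_X]; exact RatFunc.regAt_X _)
  rwa [RatFunc.extend_X, show ev x RatFunc.X = x by simp] at this

end Values

variable {L : Type*} [Field L] [CharZero L] [IsAlgClosed L] [DecidableEq L]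
variable {W W' : WeierstrassCurve L} [W.IsElliptic] [W'.IsElliptic]

lemma IsPt.chord {P Q : W.toAffine.Point} {x η x' η' : L} (h : IsPt P x η) (h' : IsPt Q x' η')
    (hx : x ≠ x') :
    IsPt (P + Q) (chordX (W.b₂ / 4) x η x' η') (chordY (W.b₂ / 4) x η x' η') :=
  h.add h' hx

lemma IsPt.eq_aeval' {P : W.toAffine.Point} {x η : L} (h : IsPt P x η) :
    η ^ 2 = aeval x W.cubic := by
  rw [h.eq, coe_aeval_eq_eval]

/-- A nonzero function has only finitely many zeros. -/
lemma eventually_not_hasVal_zero {z : W.toAffine.FunctionField} (hz : z ≠ 0) :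
    ∀ᶠ P in cofinite, ∀ x η, ∀ h : IsPt (W := W) P x η,
      ¬HasVal (W.pointEval h.eq_aeval') z 0 := by
  obtain ⟨A, B, rfl⟩ := W.exists_ofX_add_ofX_mul_etaFun z
  -- This is the norm of `A + B η` to `k(x)`, here with `k = L`; it is nonzero and vanishes at any
  -- zero of the function where `A` and `B` are regular.
  have hN : A ^ 2 - B ^ 2 * W.cubicFun ≠ 0 := by
    intro hN
    have h1 : (W.ofX A + W.ofX B * W.etaFun) * (W.ofX A + W.ofX (-B) * W.etaFun) = 0 := by
      have := congr(W.ofX $hN)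
      rw [map_sub, map_mul, map_pow, map_pow, ← etaFun_sq, map_zero] at this
      rw [map_neg, ← this]
      ring
    obtain ⟨rfl, h2⟩ := ofX_add_ofX_mul_etaFun_eq_zero ((mul_eq_zero.mp h1).resolve_left hz)
    rw [neg_eq_zero] at h2
    subst h2
    simp at hz
  filter_upwards [eventually_isPt (RatFunc.eventually_regAt A),
    eventually_isPt (RatFunc.eventually_regAt B),
    eventually_isPt (RatFunc.eventually_ev_ne_zero hN)] with P hA hB hN x η h hv
  have hA := hA x η h
  have hB := hB x η h
  have e1 := ((hasVal_ofX (h := h.eq_aeval') (by rwa [RatFunc.extend_self])).add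
    ((hasVal_ofX (by rwa [RatFunc.extend_self])).mul hasVal_etaFun)).unique hv
  rw [RatFunc.extend_self, RatFunc.extend_self] at e1
  have h2 := (hB.pow 2).1.mul (RatFunc.regAt_algebraMap x W.cubic)
  apply hN x η h
  rw [((hA.pow 2).1.sub h2.1).2, h2.2, (hA.pow 2).2, (hB.pow 2).2, RatFunc.ev_algebraMap, ← h.eq]
  linear_combination (ev x A - ev x B * η) * e1

lemma eq_of_eventually_hasVal {z w : W.toAffine.FunctionField}
    (h : ∀ᶠ P in cofinite, ∀ x η, ∀ h : IsPt (W := W) P x η,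
      ∃ v, HasVal (W.pointEval h.eq_aeval') z v ∧ HasVal (W.pointEval h.eq_aeval') w v) :
    z = w := by
  by_contra hne
  obtain ⟨P, hP, h0, h1⟩ := (h.and (IsPt.eventually_ne_zero.and
    (eventually_not_hasVal_zero (sub_ne_zero.mpr hne)))).exists
  obtain ⟨x, η, hx⟩ := exists_isPt h0
  obtain ⟨v, hz, hw⟩ := hP x η hx
  exact h1 x η hx (by simpa using hz.sub hw)

section Translation

variable (r s : RatFunc L) (xT ηT x₁ η₁ : L)

/-- The pair of functions `(x, η) ∘ (P ↦ f (P + T) - f T)`, where `f` is given by `r` and `s`. -/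
def translated (W W' : WeierstrassCurve L) :
    W.toAffine.FunctionField × W.toAffine.FunctionField :=
  let c := algebraMap L W.toAffine.FunctionField
  let X := chordX (c (W.b₂ / 4)) (W.ofX RatFunc.X) W.etaFun (c xT) (c ηT)
  let H := chordY (c (W.b₂ / 4)) (W.ofX RatFunc.X) W.etaFun (c xT) (c ηT)
  let R := aeval X r.num / aeval X r.denom
  let S := H * (aeval X s.num / aeval X s.denom)
  (chordX (c (W'.b₂ / 4)) R S (c x₁) (c (-η₁)), chordY (c (W'.b₂ / 4)) R S (c x₁) (c (-η₁)))

variable {r s xT ηT x₁ η₁} {f : W.toAffine.Point →+ W'.toAffine.Point}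

/-- Since `f(P) = f(P + T) - f(T)`, the value at `P` can be computed through the translate `P + T`,
where the formulas for `f` hold. The other hypotheses keep both chord constructions nondegenerate.
-/
lemma hasVal_translated {P T : W.toAffine.Point} (hT : IsPt T xT ηT) (hT' : IsPt (f T) x₁ η₁)
    (hPT : P ≠ T) (hPT' : P ≠ -T)
    (h : ∀ x η, IsPt (P + T) x η → RegAt x r ∧ RegAt x s ∧ IsPt (f (P + T)) (ev x r) (η * ev x s))
    (h0 : f P ≠ 0) (h2 : f P + (f T + f T) ≠ 0) {x η x' η' : L} (hP : IsPt P x η)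
    (hP' : IsPt (f P) x' η') :
    HasVal (W.pointEval hP.eq_aeval') (translated r s xT ηT x₁ η₁ W W').1 x' ∧
      HasVal (W.pointEval hP.eq_aeval') (translated r s xT ηT x₁ η₁ W W').2 η' := by
  have hx : x ≠ xT := by
    rintro rfl
    rcases hP.eq_or_eq_neg hT with rfl | rfl
    · exact hPT rfl
    · exact hPT' rfl
  have hsum := hP.chord hT hx
  obtain ⟨hr, hs, hfs⟩ := h _ _ hsum
  have hx' : ev (chordX (W.b₂ / 4) x η xT ηT) r ≠ x₁ := by
    intro e
    rw [e] at hfs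
    rcases hfs.eq_or_eq_neg hT' with h | h
    · rw [map_add, add_eq_right] at h
      exact h0 h
    · apply h2
      rw [← add_assoc, ← map_add, h, neg_add_cancel]
  have hfP := hfs.chord hT'.neg hx'
  rw [map_add, add_neg_cancel_right] at hfP
  obtain ⟨rfl, rfl⟩ := hP'.unique hfP
  have c : ∀ a : L, HasVal (W.pointEval hP.eq_aeval')
    (algebraMap L W.toAffine.FunctionField a) a := fun a => hasVal_algebraMap a
  have h3 := HasVal.chord (c (W.b₂ / 4)) hasVal_ofX_X hasVal_etaFun (c xT) (c ηT) hx
  have h4 := hasVal_aeval_div (r := r) h3.1 (by rwa [RatFunc.extend_self])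
  have h5 := hasVal_aeval_div (r := s) h3.1 (by rwa [RatFunc.extend_self])
  rw [RatFunc.extend_self] at h4 h5
  exact HasVal.chord (c (W'.b₂ / 4)) h4 (h3.2.mul h5) (c x₁) (c (-η₁)) hx'

/-- Homomorphisms given by rational functions are regular everywhere. -/
lemma Rep.hasVal (hf : Rep f r s) {P : W.toAffine.Point} {x η x' η' : L} (hP : IsPt P x η)
    (hP' : IsPt (f P) x' η') :
    HasVal (W.pointEval hP.eq_aeval') (W.ofX r) x' ∧
      HasVal (W.pointEval hP.eq_aeval') (W.ofX s * W.etaFun) η' := by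
  have hgood : ∀ᶠ Q in cofinite, ∀ x η, IsPt Q x η →
      RegAt x r ∧ RegAt x s ∧ IsPt (f Q) (ev x r) (η * ev x s) := by
    filter_upwards [hf, eventually_isPt (RatFunc.eventually_regAt r),
      eventually_isPt (RatFunc.eventually_regAt s)] with Q h1 h2 h3 x η hx
    exact ⟨h2 x η hx, h3 x η hx, h1 x η hx⟩
  obtain ⟨r₂, s₂, hf2⟩ := hf.add_self
  -- A generic translation `T` moves `P` to a point where `r` and `s` describe `f`, and avoids the
  -- degenerate chords.
  have hT : ∀ᶠ T in cofinite, T ≠ 0 ∧ f T ≠ 0 ∧ P ≠ T ∧ P ≠ -T ∧ f P + (f T + f T) ≠ 0 ∧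
      ∀ x η, IsPt (P + T) x η →
        RegAt x r ∧ RegAt x s ∧ IsPt (f (P + T)) (ev x r) (η * ev x s) := by
    filter_upwards [IsPt.eventually_ne_zero, hf.eventually_ne_zero,
      (Set.finite_singleton P).eventually_cofinite_notMem,
      (Set.finite_singleton (-P)).eventually_cofinite_notMem,
      hf2.tendsto.eventually ((Set.finite_singleton (-f P)).eventually_cofinite_notMem),
      (add_right_injective P).tendsto_cofinite.eventually hgood] with T h1 h2 h3 h4 h5 h6
    refine ⟨h1, h2, fun h => h3 h.symm, fun h => h4 (by simp [h]), fun h => h5 ?_, h6⟩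
    exact (neg_eq_of_add_eq_zero_right h).symm
  obtain ⟨T, hT0, hfT0, hPT, hPT', h2, hg⟩ := hT.exists
  obtain ⟨xT, ηT, hT⟩ := exists_isPt hT0
  obtain ⟨x₁, η₁, hT'⟩ := exists_isPt hfT0
  have key := hasVal_translated hT hT' hPT hPT' hg hP'.ne_zero h2 hP hP'
  have hev : ∀ᶠ Q in cofinite, ∀ x η, ∀ h : IsPt Q x η,
      ∃ u v, (HasVal (W.pointEval h.eq_aeval') (translated r s xT ηT x₁ η₁ W W').1 u ∧
          HasVal (W.pointEval h.eq_aeval') (translated r s xT ηT x₁ η₁ W W').2 v) ∧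
        HasVal (W.pointEval h.eq_aeval') (W.ofX r) u ∧
          HasVal (W.pointEval h.eq_aeval') (W.ofX s * W.etaFun) v := by
    filter_upwards [hgood, hf.eventually_ne_zero,
      (Set.finite_singleton T).eventually_cofinite_notMem,
      (Set.finite_singleton (-T)).eventually_cofinite_notMem,
      hf.tendsto.eventually ((Set.finite_singleton (-(f T + f T))).eventually_cofinite_notMem),
      (add_left_injective T).tendsto_cofinite.eventually hgood]
      with Q h1 h3 h4 h5 h6 h7 x η hQ
    obtain ⟨hr, hs, hQ'⟩ := h1 x η hQ
    refine ⟨_, _, hasVal_translated hT hT' h4 h5 h7 h3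
      (fun h => h6 (eq_neg_of_add_eq_zero_left h)) hQ hQ', ?_, ?_⟩
    · have := hasVal_ofX (h := hQ.eq_aeval') (r := r) (by rwa [RatFunc.extend_self])
      rwa [RatFunc.extend_self] at this
    · have := (hasVal_ofX (h := hQ.eq_aeval') (r := s) (by rwa [RatFunc.extend_self])).mul
        hasVal_etaFun
      rwa [RatFunc.extend_self, mul_comm _ η] at this
  -- The translated functions and the original ones agree at almost all points, hence are the same
  -- elements of the function field. The value found at `P` through translation therefore belongs to
  -- the original functions.
  have e1 : (translated r s xT ηT x₁ η₁ W W').1 = W.ofX r := eq_of_eventually_hasVal <| by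
    filter_upwards [hev] with Q hQ x η h
    obtain ⟨u, v, h1, h2⟩ := hQ x η h
    exact ⟨u, h1.1, h2.1⟩
  have e2 : (translated r s xT ηT x₁ η₁ W W').2 = W.ofX s * W.etaFun :=
    eq_of_eventually_hasVal <| by
      filter_upwards [hev] with Q hQ x η h
      obtain ⟨u, v, h1, h2⟩ := hQ x η h
      exact ⟨v, h1.2, h2.2⟩
  rwa [e1, e2] at key

end Translation

/-- Homomorphisms given by rational functions `r`, `s` are given by these functions at every point
that is not in the kernel. -/
theorem Rep.regAt {f : W.toAffine.Point →+ W'.toAffine.Point} {r s : RatFunc L} (hf : Rep f r s)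
    {P : W.toAffine.Point} {x η x' η' : L} (hP : IsPt P x η) (hP' : IsPt (f P) x' η') :
    RegAt x r ∧ RegAt x s ∧ x' = ev x r ∧ η' = η * ev x s := by
  obtain ⟨h1, h2⟩ := hf.hasVal hP hP'
  have h3 := regAt_of_hasVal h1
  rw [RatFunc.extend_self] at h3
  -- The product `cubic · s²` equals `W'.cubic(r)` and has no pole at `x`. A pole of `s` would make
  -- `s²` have a pole of order at least two, which a simple root of the cubic cannot cancel; the
  -- derivative at `x` detects this.
  have h4 : RegAt x s := by
    obtain ⟨p, q, hq, e⟩ := RatFunc.exists_div _ (h3.1.aeval W'.cubic).1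
    have hd := RatFunc.algebraMap_ne_zero s.denom_ne_zero
    rw [← hf.cubic_eq, eq_div_iff (RatFunc.algebraMap_ne_zero_of_eval hq)] at e
    have hs : s * algebraMap L[X] (RatFunc L) s.denom = algebraMap L[X] (RatFunc L) s.num :=
      ((div_eq_iff hd).mp s.num_div_denom).symm
    have e2 : W.cubic * s.num ^ 2 * q = p * s.denom ^ 2 := by
      apply RatFunc.algebraMap_injective L
      simp only [map_mul, map_pow, ← hs, ← e]
      ring
    intro h0
    have hn : s.num.eval x ≠ 0 := by
      intro h
      obtain ⟨u, v, huv⟩ := s.isCoprime_num_denom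
      have := congr(Polynomial.eval x $huv)
      simp [h, h0] at this
    have e3 := congr(Polynomial.eval x $e2)
    have e4 := congr(Polynomial.eval x (derivative $e2))
    simp only [Polynomial.eval_mul, Polynomial.eval_pow, derivative_mul, derivative_pow,
      Polynomial.eval_add, h0] at e3 e4
    simp only [ne_eq, OfNat.ofNat_ne_zero, not_false_eq_true, zero_pow, mul_zero, mul_eq_zero,
      hq, or_false, pow_eq_zero_iff, hn] at e3
    rw [e3] at e4
    obtain ⟨u, v, huv⟩ := cubic_isCoprime_derivative (W := W)
    have h5 := congr(Polynomial.eval x $huv)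
    simp [hn, hq] at e4
    simp [e3, e4] at h5
  refine ⟨h3.1, h4, h3.2, ?_⟩
  have h5 := (hasVal_ofX (h := hP.eq_aeval') (r := s) (by rwa [RatFunc.extend_self])).mul
    hasVal_etaFun
  rw [RatFunc.extend_self] at h5
  rw [h2.unique h5, mul_comm]

end WeierstrassCurve

/-! ### The isogeny defined by a pair of rational functions, and its degree -/

namespace WeierstrassCurve

open RatFunc (ev RegAt extend)

section Pullback

variable {k : Type*} [Field k] [CharZero k] {V V' : WeierstrassCurve k} {r s : RatFunc k}

lemma sq_ofX_mul_etaFun (hc : algebraMap k[X] (RatFunc k) V.cubic * s ^ 2 = aeval r V'.cubic) :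
    (V.ofX s * V.etaFun) ^ 2 = aeval (V.ofX r) V'.cubic := by
  rw [mul_pow, etaFun_sq, ← map_pow, ← map_mul, aeval_algHom_apply, ← hc, mul_comm]

/-- Polynomial functions composed with `(x, η) ↦ (r(x), η s(x))`. -/
def polyPullback (hc : algebraMap k[X] (RatFunc k) V.cubic * s ^ 2 = aeval r V'.cubic) :
    V'.toAffine.CoordinateRing →ₐ[k] V.toAffine.FunctionField where
  __ := V'.pointEval (sq_ofX_mul_etaFun hc)
  commutes' a := by
    change V'.pointEval _ (Affine.CoordinateRing.mk V'.toAffine (C (C a))) = _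
    rw [pointEval_mk, aevalAeval_C, aeval_C]

lemma polyPullback_apply (hc : algebraMap k[X] (RatFunc k) V.cubic * s ^ 2 = aeval r V'.cubic)
    (c : V'.toAffine.CoordinateRing) :
    polyPullback hc c = V'.pointEval (sq_ofX_mul_etaFun hc) c := rfl

/-- The images of `p + q y` are compared in the basis `1, η`: `s ≠ 0` and the transcendence of `r`
force `q = 0`, then `p = 0`. -/
lemma polyPullback_injective
    (hc : algebraMap k[X] (RatFunc k) V.cubic * s ^ 2 = aeval r V'.cubic)
    (hr : ¬∃ c, r = RatFunc.C c) : Function.Injective (polyPullback hc) := by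
  have ht := transcendental_iff_injective.mp (r.transcendental_of_ne_C hr)
  have hs : s ≠ 0 := by
    rintro rfl
    rw [zero_pow two_ne_zero, mul_zero, eq_comm, map_eq_zero_iff _ ht] at hc
    exact V'.cubic_monic.ne_zero hc
  rw [injective_iff_map_eq_zero]
  intro c h
  obtain ⟨p, q, rfl⟩ := Affine.CoordinateRing.exists_smul_basis_eq c
  rw [polyPullback_apply, Affine.CoordinateRing.smul, Affine.CoordinateRing.smul, mul_one, map_add,
    map_mul, pointEval_mk, pointEval_mk, pointEval_mk, aevalAeval_C, aevalAeval_C, aevalAeval_Y,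
    aeval_algHom_apply, aeval_algHom_apply] at h
  have h1 : V.ofX (aeval r p - aeval r q * (RatFunc.C V'.a₁ * r + RatFunc.C V'.a₃) / 2) +
      V.ofX (aeval r q * s) * V.etaFun = 0 := by
    rw [← h, ← V.ofX.commutes, ← V.ofX.commutes, RatFunc.algebraMap_eq_C]
    simp only [map_sub, map_mul, map_add, map_div₀, map_ofNat]
    ring
  obtain ⟨h2, h3⟩ := ofX_add_ofX_mul_etaFun_eq_zero h1
  have hq := (map_eq_zero_iff _ ht).mp ((mul_eq_zero.mp h3).resolve_right hs)
  subst hq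
  have hp : p = 0 := (map_eq_zero_iff _ ht).mp (by simpa using h2)
  rw [hp, zero_smul, zero_smul, add_zero]

/-- Rational functions composed with `(x, η) ↦ (r(x), η s(x))`. -/
def ratPullback (hc : algebraMap k[X] (RatFunc k) V.cubic * s ^ 2 = aeval r V'.cubic)
    (hr : ¬∃ c, r = RatFunc.C c) :
    V'.toAffine.FunctionField →ₐ[k] V.toAffine.FunctionField :=
  IsFractionRing.liftAlgHom (polyPullback_injective hc hr)

lemma ratPullback_algebraMap
    (hc : algebraMap k[X] (RatFunc k) V.cubic * s ^ 2 = aeval r V'.cubic)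
    (hr : ¬∃ c, r = RatFunc.C c) (c : V'.toAffine.CoordinateRing) :
    ratPullback hc hr (algebraMap _ _ c) = V'.pointEval (sq_ofX_mul_etaFun hc) c := by
  rw [ratPullback, IsFractionRing.liftAlgHom_apply, IsFractionRing.lift_algebraMap]
  rfl

lemma ratPullback_ofX
    (hc : algebraMap k[X] (RatFunc k) V.cubic * s ^ 2 = aeval r V'.cubic)
    (hr : ¬∃ c, r = RatFunc.C c) (q : RatFunc k) :
    ratPullback hc hr (V'.ofX q) = V.ofX (RatFunc.compHom r hr q) := by
  have key : ∀ p : k[X], ratPullback hc hr (V'.ofX (algebraMap k[X] (RatFunc k) p)) =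
      V.ofX (RatFunc.compHom r hr (algebraMap k[X] (RatFunc k) p)) := fun p => by
    rw [ofX_algebraMap, ratPullback_algebraMap, pointEval_mk, aevalAeval_C,
      RatFunc.compHom_algebraMap, aeval_algHom_apply]
  rw [← q.num_div_denom, map_div₀, map_div₀, map_div₀, map_div₀, key, key]

lemma finrank_ofX : Module.finrank V.ofX.fieldRange V.toAffine.FunctionField = 2 := by
  have hli : LinearIndependent V.ofX.fieldRange ![1, V.etaFun] := by
    rw [LinearIndependent.pair_iff]
    rintro ⟨_, A, rfl⟩ ⟨_, B, rfl⟩ h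
    have h' : V.ofX A + V.ofX B * V.etaFun = 0 := by
      rw [← h, Algebra.smul_def, Algebra.smul_def, mul_one]
      rfl
    obtain ⟨rfl, rfl⟩ := ofX_add_ofX_mul_etaFun_eq_zero h'
    exact ⟨Subtype.ext (map_zero V.ofX), Subtype.ext (map_zero V.ofX)⟩
  have hsp : ⊤ ≤ Submodule.span V.ofX.fieldRange (Set.range ![1, V.etaFun]) := by
    rintro z -
    obtain ⟨A, B, rfl⟩ := V.exists_ofX_add_ofX_mul_etaFun z
    rw [Matrix.range_cons, Matrix.range_cons, Matrix.range_empty, Set.union_empty,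
      Set.singleton_union, Submodule.mem_span_pair]
    refine ⟨⟨_, A, rfl⟩, ⟨_, B, rfl⟩, ?_⟩
    rw [Algebra.smul_def, Algebra.smul_def, mul_one]
    rfl
  rw [Module.finrank_eq_card_basis (Module.Basis.mk hli hsp), Fintype.card_fin]

/-- The field `k(r)` lies below `k(V)` through the image of `k(V')` and also through `k(x)`. In the
two towers the steps `k(r) ⊆ φ(k(V'))` and `k(x) ⊆ k(V)` both have degree 2, so the remaining
degrees agree. -/
lemma finrank_ratPullback
    (hc : algebraMap k[X] (RatFunc k) V.cubic * s ^ 2 = aeval r V'.cubic)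
    (hr : ¬∃ c, r = RatFunc.C c) :
    Module.finrank (ratPullback hc hr).fieldRange V.toAffine.FunctionField = r.height := by
  set φ := ratPullback hc hr
  have e : V'.ofX.fieldRange.map φ = (RatFunc.compHom r hr).fieldRange.map V.ofX := by
    rw [AlgHom.fieldRange_eq_map, AlgHom.fieldRange_eq_map, IntermediateField.map_map,
      IntermediateField.map_map]
    congr 1
    exact AlgHom.ext fun q => ratPullback_ofX hc hr q
  have h1 : IntermediateField.relfinrank (V'.ofX.fieldRange.map φ) φ.fieldRange = 2 := by
    rw [AlgHom.fieldRange_eq_map φ, IntermediateField.relfinrank_map_map,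
      IntermediateField.relfinrank_top_right, finrank_ofX]
  have h2 : IntermediateField.relfinrank ((RatFunc.compHom r hr).fieldRange.map V.ofX)
      V.ofX.fieldRange = r.height := by
    rw [AlgHom.fieldRange_eq_map V.ofX, IntermediateField.relfinrank_map_map,
      IntermediateField.relfinrank_top_right, RatFunc.height_eq_finrank,
      RatFunc.adjoin_eq_fieldRange hr]
  have h3 := IntermediateField.relfinrank_mul_finrank_top
    (A := V'.ofX.fieldRange.map φ) (B := φ.fieldRange)
    (by rw [AlgHom.fieldRange_eq_map φ]; exact IntermediateField.map_mono _ le_top)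
  have h4 := IntermediateField.relfinrank_mul_finrank_top
    (A := (RatFunc.compHom r hr).fieldRange.map V.ofX) (B := V.ofX.fieldRange)
    (by rw [AlgHom.fieldRange_eq_map V.ofX]; exact IntermediateField.map_mono _ le_top)
  rw [h1, e] at h3
  rw [h2, finrank_ofX] at h4
  omega

end Pullback

variable {K : Type*} [Field K] {k L : Type*} [Field k] [CharZero k] [Field L] [CharZero L]
  [IsAlgClosed L] [DecidableEq L]
  [Algebra K k] [Algebra K L] [Algebra k L] [IsScalarTower K k L]
variable {W W' : WeierstrassCurve K} [W.IsElliptic] [W'.IsElliptic]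

/-- A homomorphism given by rational functions with coefficients in `k` is an isogeny over `k`. -/
theorem Rep.exists_isogeny {f : (W⁄L).toAffine.Point →+ (W'⁄L).toAffine.Point} {r s : RatFunc k}
    (hf : Rep (W := W⁄L) (W' := W'⁄L) f (extend k L r) (extend k L s)) :
    ∃ φ : Isogeny k L W W', φ.toHom = f ∧ φ.degree = r.height := by
  have hr : ¬∃ c, r = RatFunc.C c := by
    rw [← RatFunc.height_eq_zero, ← RatFunc.height_extend (L := L), RatFunc.height_eq_zero]
    exact hf.nonconst
  have hext : ∀ p : k[X], extend k L (aeval r p) =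
      aeval (extend k L r) (p.map (algebraMap k L)) := fun p => by
    induction p using Polynomial.induction_on' with
    | add p q hp hq => simp only [map_add, Polynomial.map_add, hp, hq]
    | monomial n a =>
      rw [aeval_monomial, Polynomial.map_monomial, aeval_monomial, map_mul, map_pow,
        RatFunc.algebraMap_eq_C, RatFunc.algebraMap_eq_C, RatFunc.extend_C]
  -- The curve identity holds over `L` and descends to `k` because extension of scalars is
  -- injective.
  have hc : algebraMap k[X] (RatFunc k) (W⁄k).cubic * s ^ 2 = aeval r (W'⁄k).cubic := by
    apply (extend k L).injective
    have := hf.cubic_eq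
    rwa [cubicFun, cubic_baseChange k L W, cubic_baseChange k L W', ← hext, ←
        RatFunc.extend_algebraMap,
      ← map_pow, ← map_mul] at this
  refine ⟨⟨f, ratPullback hc hr, hf.ne_zero, ?_⟩, rfl, finrank_ratPullback hc hr⟩
  intro x y x' y' h h' e g v hg
  rw [hasValueAt_iff h']at hg
  rw [hasValueAt_iff h]
  have hP := isPt_some h
  have hP' : IsPt (f (.some x y h)) _ _ := e ▸ isPt_some h'
  obtain ⟨h1, h2, h3, h4⟩ := hf.regAt hP hP'
  have hX : HasVal ((W⁄k).pointEval (hP.eq_aeval k)) ((W⁄k).ofX r) x' := h3 ▸ hasVal_ofX h1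
  have hY := (hasVal_ofX (V := W⁄k) (h := hP.eq_aeval k) h2).mul hasVal_etaFun
  rw [mul_comm _ (y + _), ← h4] at hY
  -- Compatibility with values need only be tested on the coordinate ring, whose elements are `p(x)
  -- + q(x) y`.
  refine HasVal.map (φ := (ratPullback hc hr).toRingHom) (fun c => ?_) hg
  change HasVal _ (ratPullback hc hr (algebraMap _ _ c)) _
  rw [ratPullback_algebraMap]
  obtain ⟨p, q, rfl⟩ := Affine.CoordinateRing.exists_smul_basis_eq c
  simp only [Affine.CoordinateRing.smul, mul_one, map_add, map_mul, pointEval_mk, aevalAeval_C,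
    aevalAeval_Y]
  have hc := fun a => hasVal_algebraMap (V := W⁄k) (h := hP.eq_aeval k) a
  have h2 : HasVal ((W⁄k).pointEval (hP.eq_aeval k)) (2 : (W⁄k).toAffine.FunctionField) 2 := by
    have := hc 2
    rwa [map_ofNat, map_ofNat] at this
  exact (hasVal_aeval hX p).add ((hasVal_aeval hX q).mul
    (hY.sub ((((hc _).mul hX).add (hc _)).div h2 two_ne_zero)))

end WeierstrassCurve

/-! ### Galois conjugation and descent -/

namespace RatFunc

variable {k L : Type*} [Field k] [Field L] [Algebra k L]

/-- The action of an automorphism of `L` on the coefficients of a rational function. -/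
def conj (σ : L ≃ₐ[k] L) : RatFunc L →+* RatFunc L :=
  mapRingHom (Polynomial.mapRingHom (σ : L →+* L)) fun p hp => by simpa using hp

variable {σ : L ≃ₐ[k] L}

lemma conj_algebraMap (p : L[X]) : conj σ (algebraMap _ _ p) =
    algebraMap _ _ (p.map (σ : L →+* L)) := by
  rw [conj, ← div_one (algebraMap L[X] (RatFunc L) p), ← map_one (algebraMap L[X] (RatFunc L)),
    coe_mapRingHom_eq_coe_map, map_apply_div]
  simp

lemma regAt_conj {x : L} {r : RatFunc L} (hr : RegAt x r) :
    RegAt (σ x) (conj σ r) ∧ ev (σ x) (conj σ r) = σ (ev x r) := by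
  obtain ⟨p, q, hq, rfl⟩ := exists_div r hr
  have key : ∀ p : L[X], (p.map (σ : L →+* L)).eval (σ x) = σ (p.eval x) := fun p =>
    eval_map_apply (σ : L →+* L) x
  have := regAt_div (x := σ x) (p := p.map (σ : L →+* L)) (q := q.map (σ : L →+* L))
    (by rwa [key, ne_eq, map_eq_zero_iff _ σ.injective])
  rw [map_div₀, conj_algebraMap, conj_algebraMap, (regAt_div hq).2, map_div₀, ← key, ← key]
  exact this

/-- Galois descent for rational functions. -/
lemma exists_extend_eq [IsGalois k L] {r : RatFunc L} (h : ∀ σ : L ≃ₐ[k] L, conj σ r = r) :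
    ∃ r₀ : RatFunc k, extend k L r₀ = r := by
  have hcop := r.isCoprime_num_denom
  have hd0 := algebraMap_ne_zero r.denom_ne_zero
  -- The denominator of a reduced fraction is normalised to be monic, so invariance of the fraction
  -- gives invariance of the denominator itself, and then of the numerator.
  have hdenom : ∀ σ : L ≃ₐ[k] L, r.denom.map (σ : L →+* L) = r.denom := fun σ => by
    have e := h σ
    have hm : (r.denom.map (σ : L →+* L)).Monic := r.monic_denom.map _
    conv_lhs at e => rw [← r.num_div_denom]
    conv_rhs at e => rw [← r.num_div_denom]
    rw [map_div₀, conj_algebraMap, conj_algebraMap,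
      div_eq_div_iff (algebraMap_ne_zero hm.ne_zero) hd0, ← map_mul, ← map_mul] at e
    have e := algebraMap_injective L e
    have hdvd : r.denom ∣ r.denom.map (σ : L →+* L) :=
      hcop.symm.dvd_of_dvd_mul_left ⟨_, by rw [← e, mul_comm]⟩
    exact (eq_of_monic_of_dvd_of_natDegree_le r.monic_denom hm hdvd
      (natDegree_map _).le)
  have hnum : ∀ σ : L ≃ₐ[k] L, r.num.map (σ : L →+* L) = r.num := fun σ => by
    have e := h σ
    conv_lhs at e => rw [← r.num_div_denom]
    conv_rhs at e => rw [← r.num_div_denom]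
    rw [map_div₀, conj_algebraMap, conj_algebraMap, hdenom, div_left_inj' hd0] at e
    exact algebraMap_injective L e
  have key : ∀ p : L[X], (∀ σ : L ≃ₐ[k] L, p.map (σ : L →+* L) = p) →
      ∃ p₀ : k[X], p₀.map (algebraMap k L) = p := fun p hp => by
    rw [← mem_lifts, lifts_iff_coeff_lifts]
    intro n
    rw [← IntermediateField.mem_bot, InfiniteGalois.mem_bot_iff_fixed]
    intro σ
    simpa using congr(Polynomial.coeff $(hp σ) n)
  obtain ⟨p, hp⟩ := key _ hnum
  obtain ⟨q, hq⟩ := key _ hdenom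
  refine ⟨algebraMap _ _ p / algebraMap _ _ q, ?_⟩
  rw [map_div₀, extend_algebraMap, extend_algebraMap, hp, hq, num_div_denom]

end RatFunc

namespace WeierstrassCurve

open RatFunc (ev RegAt extend)

section Conjugation

variable {k L : Type*} [Field k] [Field L] [Algebra k L] [CharZero L] [IsAlgClosed L]
  [DecidableEq L] {E E' : WeierstrassCurve k}

lemma IsPt.map {P : (E⁄L).toAffine.Point} {x η : L} (h : IsPt P x η) (σ : L ≃ₐ[k] L) :
    IsPt (Affine.Point.map (W' := E) (σ : L →ₐ[k] L) P) (σ x) (σ η) := by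
  obtain ⟨h, rfl⟩ := h
  have e : σ (η - ((E⁄L).a₁ * x + (E⁄L).a₃) / 2) =
      σ η - ((E⁄L).a₁ * σ x + (E⁄L).a₃) / 2 := by
    have h1 : σ (E⁄L).a₁ = (E⁄L).a₁ := σ.commutes _
    have h3 : σ (E⁄L).a₃ = (E⁄L).a₃ := σ.commutes _
    rw [map_sub, map_div₀, map_add, map_mul, h1, h3, map_ofNat]
  have h' := (Affine.baseChange_nonsingular (E : Affine k) (f := (σ : L →ₐ[k] L)) σ.injective
      ..).mpr h
  refine ⟨e ▸ h', ?_⟩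
  rw [Affine.Point.map_some, Affine.Point.some.injEq]
  exact ⟨rfl, e⟩

/-- The conjugate of a homomorphism by a Galois automorphism. -/
def conjHom (σ : L ≃ₐ[k] L) (f : (E⁄L).toAffine.Point →+ (E'⁄L).toAffine.Point) :
    (E⁄L).toAffine.Point →+ (E'⁄L).toAffine.Point :=
  (Affine.Point.map (W' := E') (σ : L →ₐ[k] L)).comp
    (f.comp (Affine.Point.map (W' := E) (σ.symm : L →ₐ[k] L)))

variable [E.IsElliptic] [E'.IsElliptic]

lemma map_map_symm (σ : L ≃ₐ[k] L) (P : (E⁄L).toAffine.Point) :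
    Affine.Point.map (W' := E) (σ : L →ₐ[k] L)
      (Affine.Point.map (W' := E) (σ.symm : L →ₐ[k] L) P) = P := by
  by_cases hP : P = 0
  · rw [hP, _root_.map_zero, _root_.map_zero]
  · obtain ⟨x, η, h⟩ := exists_isPt hP
    have := (h.map σ.symm).map σ
    rw [σ.apply_symm_apply, σ.apply_symm_apply] at this
    exact this.ext h

lemma map_symm_map (σ : L ≃ₐ[k] L) (P : (E⁄L).toAffine.Point) :
    Affine.Point.map (W' := E) (σ.symm : L →ₐ[k] L)
      (Affine.Point.map (W' := E) (σ : L →ₐ[k] L) P) = P :=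
  map_map_symm σ.symm P

lemma Rep.conj {f : (E⁄L).toAffine.Point →+ (E'⁄L).toAffine.Point} {r s : RatFunc L}
    (h : Rep (W := E⁄L) (W' := E'⁄L) f r s) (σ : L ≃ₐ[k] L) :
    Rep (W := E⁄L) (W' := E'⁄L) (conjHom σ f) (RatFunc.conj σ r) (RatFunc.conj σ s) := by
  have ht := (Affine.Point.map_injective (W' := E)
    (σ.symm : L →ₐ[k] L)).tendsto_cofinite
  filter_upwards [ht.eventually h, ht.eventually (eventually_isPt (RatFunc.eventually_regAt r)),
    ht.eventually (eventually_isPt (RatFunc.eventually_regAt s))] with P hP hr hs x η hx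
  have h1 := hx.map σ.symm
  have h2 := (hP _ _ h1).map σ
  have e1 := (RatFunc.regAt_conj (σ := σ) (hr _ _ h1)).2
  have e2 := (RatFunc.regAt_conj (σ := σ) (hs _ _ h1)).2
  rw [map_mul, ← e1, ← e2, σ.apply_symm_apply, σ.apply_symm_apply] at h2
  exact h2

end Conjugation

/-! ### The isomorphisms `(x, η) ↦ (u² x, u³ η)` -/

section Scaling

variable {L : Type*} [Field L] [CharZero L] [IsAlgClosed L] [DecidableEq L]
variable {W W' : WeierstrassCurve L} [W.IsElliptic] [W'.IsElliptic] {u : L}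

/-- `W'` is obtained from `W` by the substitution `(x, η) ↦ (u² x, u³ η)`. -/
structure IsScaling (u : L) (W W' : WeierstrassCurve L) : Prop where
  ne_zero : u ≠ 0
  b₂_eq : W'.b₂ = u ^ 2 * W.b₂
  b₄_eq : W'.b₄ = u ^ 4 * W.b₄
  b₆_eq : W'.b₆ = u ^ 6 * W.b₆

lemma IsScaling.inv (h : IsScaling u W W') : IsScaling u⁻¹ W' W := by
  have := h.ne_zero
  refine ⟨inv_ne_zero this, ?_, ?_, ?_⟩
  · rw [h.b₂_eq]; field_simp
  · rw [h.b₄_eq]; field_simp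
  · rw [h.b₆_eq]; field_simp

lemma IsScaling.eval_cubic (h : IsScaling u W W') (x : L) :
    W'.cubic.eval (u ^ 2 * x) = u ^ 6 * W.cubic.eval x := by
  rw [WeierstrassCurve.eval_cubic, WeierstrassCurve.eval_cubic, h.b₂_eq, h.b₄_eq, h.b₆_eq]
  ring

lemma IsScaling.exists_isPt (h : IsScaling u W W') (P : W.toAffine.Point) :
    ∃ Q : W'.toAffine.Point, (P = 0 → Q = 0) ∧
      ∀ x η, IsPt P x η → IsPt Q (u ^ 2 * x) (u ^ 3 * η) := by
  by_cases hP : P = 0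
  · exact ⟨0, fun _ => rfl, fun x η h => absurd hP h.ne_zero⟩
  · obtain ⟨x, η, hx⟩ := WeierstrassCurve.exists_isPt hP
    obtain ⟨Q, hQ⟩ := IsPt.of_eq (W := W') (x := u ^ 2 * x) (η := u ^ 3 * η) <| by
      rw [h.eval_cubic, ← hx.eq]
      ring
    refine ⟨Q, fun h => absurd h hP, fun x' η' hx' => ?_⟩
    obtain ⟨rfl, rfl⟩ := hx.unique hx'
    exact hQ

/-- Chord and tangent slopes are multiplied by `u`, and the addition formulas are homogeneous for
the weights 2 and 3 of `x` and `η`. -/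
lemma IsScaling.exists_hom (h : IsScaling u W W') :
    ∃ f : W.toAffine.Point →+ W'.toAffine.Point,
      ∀ P x η, IsPt P x η → IsPt (f P) (u ^ 2 * x) (u ^ 3 * η) := by
  have hu := h.ne_zero
  choose f h0 hf using h.exists_isPt
  have hneg : ∀ P, f (-P) = -f P := fun P => by
    by_cases hP : P = 0
    · rw [hP, neg_zero, h0 0 rfl, neg_zero]
    · obtain ⟨x, η, hx⟩ := WeierstrassCurve.exists_isPt hP
      have h1 := hf _ _ _ hx.neg
      rw [mul_neg] at h1
      exact h1.ext (hf _ _ _ hx).neg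
  refine ⟨AddMonoidHom.mk' f fun P Q => ?_, hf⟩
  by_cases hP : P = 0
  · rw [hP, h0 0 rfl, zero_add, zero_add]
  by_cases hQ : Q = 0
  · rw [hQ, h0 0 rfl, add_zero, add_zero]
  obtain ⟨x, η, hx⟩ := WeierstrassCurve.exists_isPt hP
  obtain ⟨x', η', hx'⟩ := WeierstrassCurve.exists_isPt hQ
  by_cases hxx : x = x'
  · subst hxx
    have hcase : P = -Q → f (P + Q) = f P + f Q := by
      rintro rfl
      rw [hneg, neg_add_cancel, neg_add_cancel, h0 0 rfl]
    rcases hx.eq_or_eq_neg hx' with rfl | h1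
    · by_cases hη : η = 0
      · apply hcase
        refine hx.ext (by simpa [hη] using hx.neg)
      · refine (hf _ _ _ (hx.double hη)).ext ?_
        have h2 := (hf _ _ _ hx).double (mul_ne_zero (pow_ne_zero 3 hu) hη)
        have e : W'.cubic.derivative.eval (u ^ 2 * x) = u ^ 4 * W.cubic.derivative.eval x := by
          simp only [cubic, h.b₂_eq, h.b₄_eq, h.b₆_eq, derivative_add, derivative_X_pow,
            derivative_mul, derivative_C, derivative_X]
          simp
          ring
        convert h2 using 1
        · rw [e, h.b₂_eq]; field_simp
        · rw [e, h.b₂_eq]; field_simp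
    · exact hcase h1
  · refine (hf _ _ _ (hx.add hx' hxx)).ext ?_
    have hd := sub_ne_zero.mpr hxx
    have h2 := (hf _ _ _ hx).add (hf _ _ _ hx')
      (fun h => hxx (mul_left_cancel₀ (pow_ne_zero 2 hu) h))
    have e : (u ^ 3 * η - u ^ 3 * η') / (u ^ 2 * x - u ^ 2 * x') =
        u * ((η - η') / (x - x')) := by
      rw [← mul_sub, ← mul_sub]
      field_simp
    convert h2 using 1
    · rw [e, h.b₂_eq]; ring
    · rw [e, h.b₂_eq]; ring

/-- The isomorphism `(x, η) ↦ (u² x, u³ η)`. -/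
def IsScaling.hom (h : IsScaling u W W') : W.toAffine.Point →+ W'.toAffine.Point :=
  h.exists_hom.choose

lemma IsScaling.rep (h : IsScaling u W W') :
    Rep h.hom (RatFunc.C (u ^ 2) * RatFunc.X) (RatFunc.C (u ^ 3)) := by
  refine .of_forall fun P x η hx => ?_
  have e := ((RatFunc.regAt_C x (u ^ 2)).mul (RatFunc.regAt_X x)).2
  rw [RatFunc.ev_C, show ev x RatFunc.X = x by simp] at e
  rw [e, RatFunc.ev_C, mul_comm η]
  exact h.exists_hom.choose_spec P x η hx

lemma IsScaling.hasTangent (h : IsScaling u W W') : HasTangent h.hom u⁻¹ := by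
  refine .inr ⟨_, _, h.rep, ?_⟩
  have := h.ne_zero
  rw [RatFunc.deriv_C_mul, RatFunc.deriv_X, mul_one, ← map_mul]
  congr 1
  field_simp

lemma IsScaling.rep_comp {W'' : WeierstrassCurve L} [W''.IsElliptic] (h : IsScaling u W' W'')
    {f : W.toAffine.Point →+ W'.toAffine.Point} {r s : RatFunc L} (hf : Rep f r s) :
    Rep (h.hom.comp f) (RatFunc.C (u ^ 2) * r) (RatFunc.C (u ^ 3) * s) := by
  have := h.rep.comp hf
  rwa [map_mul, RatFunc.compHom_X, ← RatFunc.algebraMap_eq_C, AlgHom.commutes,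
    AlgHom.commutes] at this

end Scaling

end WeierstrassCurve

/-! ### The square root of the discriminant in a quadratic ring -/

section QuadraticOrder

variable {R : Type*} [CommRing R] [IsDomain R] [CharZero R] (b : Module.Basis (Fin 2) ℤ R)

/-- A quadratic ring contains a square root of its discriminant, and half of it if the
discriminant is divisible by four. -/
lemma exists_sq_eq_discr :
    Algebra.discr ℤ b ≠ 0 ∧ ∃ δ : R, δ * δ = (Algebra.discr ℤ b : ℤ) ∧
      (4 ∣ Algebra.discr ℤ b → ∃ ε : R, 2 * ε = δ) := by
  set e := b 0
  set g := b 1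
  have hrepr : ∀ x : R, ∃ i j : ℤ, x = i * e + j * g := fun x => by
    refine ⟨b.repr x 0, b.repr x 1, ?_⟩
    conv_lhs => rw [← b.sum_repr x, Fin.sum_univ_two]
    rw [zsmul_eq_mul, zsmul_eq_mul]
  have hindep : ∀ i j i' j' : ℤ, (i * e + j * g : R) = i' * e + j' * g → i = i' ∧ j = j' := by
    intro i j i' j' h
    have h1 := congr(b.repr $h)
    simp only [← zsmul_eq_mul, map_add, map_smul, e, g, Module.Basis.repr_self] at h1
    exact ⟨by simpa using congr($h1 0), by simpa using congr($h1 1)⟩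
  have htr : ∀ (x : R) (i j i' j' : ℤ), x * e = i * e + j * g → x * g = i' * e + j' * g →
      Algebra.trace ℤ R x = i + j' := fun x i j i' j' h h' => by
    rw [Algebra.trace_eq_matrix_trace b, Matrix.trace_fin_two, Algebra.leftMulMatrix_eq_repr_mul,
      Algebra.leftMulMatrix_eq_repr_mul]
    change b.repr (x * e) 0 + b.repr (x * g) 1 = _
    rw [h, h']
    simp [← zsmul_eq_mul, e, g]
  obtain ⟨a, β, hee⟩ := hrepr (e * e)
  obtain ⟨c, d, heg⟩ := hrepr (e * g)
  obtain ⟨p, q, hgg⟩ := hrepr (g * g)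
  obtain ⟨m, n, h1⟩ := hrepr 1
  have ht0 : Algebra.trace ℤ R e = a + d := htr e _ _ _ _ hee heg
  have ht1 : Algebra.trace ℤ R g = c + q := htr g _ _ _ _ (by rw [mul_comm, heg]) hgg
  have hlin : ∀ i j : ℤ, Algebra.trace ℤ R (i * e + j * g) = i * (a + d) + j * (c + q) :=
    fun i j => by
      rw [← zsmul_eq_mul, ← zsmul_eq_mul, map_add, map_zsmul, map_zsmul, ht0, ht1, smul_eq_mul,
        smul_eq_mul]
  have hu : m * (a + d) + n * (c + q) = 2 := by
    rw [← hlin, ← h1, htr 1 1 0 0 1 (by simp) (by simp)]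
    norm_num
  have hdisc : Algebra.discr ℤ b = (a * (a + d) + β * (c + q)) * (p * (a + d) + q * (c + q)) -
      (c * (a + d) + d * (c + q)) ^ 2 := by
    rw [Algebra.discr_def, Matrix.det_fin_two]
    simp only [Algebra.traceMatrix_apply, Algebra.traceForm_apply]
    change Algebra.trace ℤ R (e * e) * Algebra.trace ℤ R (g * g) -
      Algebra.trace ℤ R (e * g) * Algebra.trace ℤ R (g * e) = _
    rw [mul_comm g e, hee, heg, hgg, hlin, hlin, hlin, sq]
  -- The basis `e, g` is arbitrary, so the relations between structure constants come from comparing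
  -- coefficients in `1 · e = e`, `1 · g = g`, `(e e) g = e (e g)` and `(e g) g = e (g g)`.
  obtain ⟨hu1, hu2⟩ := hindep (m * a + n * c) (m * β + n * d) 1 0 <| by
    push_cast
    linear_combination -e * h1 - m * hee - n * heg
  obtain ⟨hu3, hu4⟩ := hindep (m * c + n * p) (m * d + n * q) 0 1 <| by
    push_cast
    linear_combination -g * h1 - m * heg - n * hgg
  obtain ⟨-, hs2⟩ := hindep (a * c + β * p) (a * d + β * q) (c * a + d * c) (c * β + d * d) <| by
    push_cast
    linear_combination -g * hee + e * heg + c * hee + d * heg - a * heg - β * hgg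
  obtain ⟨hs3, -⟩ := hindep (c * c + d * p) (c * d + d * q) (p * a + q * c) (p * β + q * d) <| by
    push_cast
    linear_combination -g * heg + e * hgg + p * hee + q * heg - c * heg - d * hgg
  set t₀ := a + d with ht₀
  set t₁ := c + q with ht₁
  set Δ := Algebra.discr ℤ b
  have hT0 : m * (a * t₀ + β * t₁) + n * (c * t₀ + d * t₁) = t₀ := by
    linear_combination t₀ * hu1 + t₁ * hu2
  have hT1 : m * (c * t₀ + d * t₁) + n * (p * t₀ + q * t₁) = t₁ := by
    linear_combination t₀ * hu3 + t₁ * hu4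
  have hm : Δ * m = t₁ ^ 2 * a - 2 * t₀ * t₁ * c + t₀ ^ 2 * p := by
    rw [hdisc]
    linear_combination (p * t₀ + q * t₁) * hT0 - (c * t₀ + d * t₁) * hT1 +
      t₁ ^ 2 * ht₀ - t₀ * t₁ * ht₁
  have hn : Δ * n = t₁ ^ 2 * β - 2 * t₀ * t₁ * d + t₀ ^ 2 * q := by
    rw [hdisc]
    linear_combination (a * t₀ + β * t₁) * hT1 - (c * t₀ + d * t₁) * hT0 +
      t₀ ^ 2 * ht₁ - t₀ * t₁ * ht₀
  -- With `t₀ = tr e` and `t₁ = tr g`, the element `t₁ e - t₀ g` has trace zero, and its square is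
  -- the discriminant.
  have hsq : (t₁ * e - t₀ * g) * (t₁ * e - t₀ * g) = (Δ : R) := by
    have hm := congr((($hm : ℤ) : R))
    have hn := congr((($hn : ℤ) : R))
    push_cast at hm hn
    linear_combination t₁ ^ 2 * hee - 2 * t₀ * t₁ * heg + t₀ ^ 2 * hgg - Δ * h1 - e * hm - g * hn
  refine ⟨fun h0 => ?_, _, hsq, fun h4 => ?_⟩
  · rw [h0, Int.cast_zero, mul_self_eq_zero] at hsq
    obtain ⟨h2, h3⟩ := hindep t₁ (-t₀) 0 0 (by push_cast; linear_combination hsq)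
    rw [h2, neg_eq_zero.mp h3] at hu
    simp at hu
  -- Modulo 2, `tr(x²) = tr(x)²`. With the relations for the coordinates of `1` and an even
  -- discriminant, a finite check over `ZMod 2` shows that both traces are even, so the square root
  -- can be halved.
  · have hT00 : a * t₀ + β * t₁ = t₀ ^ 2 - 2 * (a * d - β * c) := by
      rw [ht₀, ht₁]
      linear_combination hs2
    have hT11 : p * t₀ + q * t₁ = t₁ ^ 2 - 2 * (c * q - d * p) := by
      rw [ht₀, ht₁]
      linear_combination -hs3
    have h20 : (2 : ZMod 2) = 0 := rfl
    have z1 := congr((($hu : ℤ) : ZMod 2))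
    have z2 := congr((($hT0 : ℤ) : ZMod 2))
    have z3 := congr((($hT1 : ℤ) : ZMod 2))
    have z4 : ((Δ : ℤ) : ZMod 2) = 0 :=
      (ZMod.intCast_zmod_eq_zero_iff_dvd _ 2).mpr ((by norm_num : (2 : ℤ) ∣ 4).trans h4)
    rw [hdisc, hT00, hT11] at z4
    rw [hT00] at z2
    rw [hT11] at z3
    push_cast at z1 z2 z3 z4
    generalize (c * t₀ + d * t₁ : ZMod 2) = w at z2 z3 z4
    rw [h20] at z1 z2 z3 z4
    simp only [zero_mul, sub_zero] at z2 z3 z4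
    have key : ∀ x y m n w : ZMod 2, m * x + n * y = 0 → m * x ^ 2 + n * w = x →
        m * w + n * y ^ 2 = y → x ^ 2 * y ^ 2 - w ^ 2 = 0 → x = 0 ∧ y = 0 := by
      decide
    obtain ⟨k0, k1⟩ := key _ _ _ _ _ z1 z2 z3 z4
    obtain ⟨s₀, h0⟩ := (ZMod.intCast_zmod_eq_zero_iff_dvd _ 2).mp k0
    obtain ⟨s₁, h1⟩ := (ZMod.intCast_zmod_eq_zero_iff_dvd _ 2).mp k1
    refine ⟨s₁ * e - s₀ * g, ?_⟩
    rw [h0, h1]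
    push_cast
    ring

end QuadraticOrder

/-! ### Complex multiplication and quadratic twists -/

namespace WeierstrassCurve

open RatFunc (ev RegAt extend)

variable [DecidableEq (AlgebraicClosure ℚ)] (E : WeierstrassCurve ℚ) [E.IsElliptic]

variable {E}

lemma isScaling_quadraticTwist {d : ℚ} {u : AlgebraicClosure ℚ} (hd : d ≠ 0) (hu : u ^ 2 =
    algebraMap ℚ (AlgebraicClosure ℚ) d) :
    IsScaling u (E⁄(AlgebraicClosure ℚ)) ((E.quadraticTwist d)⁄(AlgebraicClosure ℚ)) := by
  have h4 : u ^ 4 = algebraMap ℚ (AlgebraicClosure ℚ) (d ^ 2) := by rw [map_pow, ← hu]; ring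
  have h6 : u ^ 6 = algebraMap ℚ (AlgebraicClosure ℚ) (d ^ 3) := by rw [map_pow, ← hu]; ring
  refine ⟨?_, ?_, ?_, ?_⟩
  · rintro rfl
    rw [zero_pow two_ne_zero, eq_comm, map_eq_zero] at hu
    exact hd hu
  · rw [hu, baseChange, baseChange, map_b₂, map_b₂, ← map_mul]
    congr 1
    simp only [quadraticTwist, b₂]
    ring
  · rw [h4, baseChange, baseChange, map_b₄, map_b₄, ← map_mul]
    congr 1
    simp only [quadraticTwist, b₄]
    ring
  · rw [h6, baseChange, baseChange, map_b₆, map_b₆, ← map_mul]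
    congr 1
    simp only [quadraticTwist, b₆]
    ring

lemma mem_geometricEnd_iff {f : AddMonoid.End (E⁄(AlgebraicClosure ℚ)).toAffine.Point} :
    f ∈ E.geometricEnd ↔ f ∈ regularEnd (E⁄(AlgebraicClosure ℚ)) := by
  refine or_congr_right ⟨?_, ?_⟩
  · rintro ⟨φ, rfl⟩
    obtain ⟨r, s, h⟩ := φ.exists_rep
    exact ⟨_, _, h⟩
  · rintro ⟨r, s, h⟩
    rw [← RatFunc.extend_self r, ← RatFunc.extend_self s] at h
    obtain ⟨φ, h, -⟩ := h.exists_isogeny (W := E) (W' := E)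
    exact ⟨φ, h⟩

/-- An endomorphism with square `-M` gives rise to an isogeny to the quadratic twist by `-M`. -/
theorem exists_isogeny_quadraticTwist {f : AddMonoid.End (E⁄(AlgebraicClosure ℚ)).toAffine.Point}
    (hf : f ∈ regularEnd (E⁄(AlgebraicClosure ℚ))) {M : ℕ} (hM : 0 < M)
    (hsq : f * f = -(M : AddMonoid.End (E⁄(AlgebraicClosure ℚ)).toAffine.Point)) {d e : ℚ} (he : e ≠
        0)
    (hd : d = -(e ^ 2 * M)) :
    ∃ φ : Isogeny ℚ (AlgebraicClosure ℚ) E (E.quadraticTwist d), φ.degree = M := by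
  have hM0 : (M : ℚ) ≠ 0 := Nat.cast_ne_zero.mpr hM.ne'
  have hd0 : d ≠ 0 := by
    rw [hd]
    exact neg_ne_zero.mpr (mul_ne_zero (pow_ne_zero 2 he) hM0)
  have := E.quadraticTwist_isElliptic hd0
  -- The action on differentials is multiplicative, and the integer `-M` acts as `-M`.
  have htan : ∀ {g : AddMonoid.End (E⁄(AlgebraicClosure ℚ)).toAffine.Point} {c : AlgebraicClosure
      ℚ},
      g * g = -(M : AddMonoid.End (E⁄(AlgebraicClosure ℚ)).toAffine.Point) →
      HasTangent (W := E⁄(AlgebraicClosure ℚ)) (W' := E⁄(AlgebraicClosure ℚ)) g c → c ^ 2 = -M :=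
          fun {g c} h hc => by
    have h1 : HasTangent (W := E⁄(AlgebraicClosure ℚ)) (W' := E⁄(AlgebraicClosure ℚ)) (g * g) (c *
        c) := hc.comp hc
    have h2 := (HasTangent.id (W := E⁄(AlgebraicClosure ℚ))).zsmul (-M)
    have h3 : (-(M : ℤ)) • AddMonoidHom.id (E⁄(AlgebraicClosure ℚ)).toAffine.Point = g * g := by
      rw [h]
      ext P
      change (-(M : ℤ)) • P = -((M : AddMonoid.End (E⁄(AlgebraicClosure ℚ)).toAffine.Point) P)
      rw [AddMonoid.End.natCast_apply, neg_smul, natCast_zsmul]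
    rw [h3] at h2
    rw [sq, h1.unique h2]
    push_cast
    ring
  obtain ⟨r, s, h⟩ : ∃ r s, Rep (W := E⁄(AlgebraicClosure ℚ)) (W' := E⁄(AlgebraicClosure ℚ)) f r s
      := by
    refine hf.resolve_left ?_
    rintro rfl
    have := htan hsq .zero
    rw [zero_pow two_ne_zero, eq_comm, neg_eq_zero, Nat.cast_eq_zero] at this
    omega
  obtain ⟨c, hc0, hc⟩ := h.exists_tangent
  have hfc : HasTangent (W := E⁄(AlgebraicClosure ℚ)) (W' := E⁄(AlgebraicClosure ℚ)) f c := .inr ⟨r,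
      s, h, hc⟩
  have hc2 := htan hsq hfc
  -- A conjugate of `f` also has square `-M`, so its constant is `±c` and it equals `±f`. Both signs
  -- have the same `x`-coordinate function, which is therefore Galois invariant.
  obtain ⟨r₀, rfl⟩ : ∃ r₀ : RatFunc ℚ, extend ℚ (AlgebraicClosure ℚ) r₀ = r := by
    have : IsGalois ℚ (AlgebraicClosure ℚ) :=
      have : IsAlgClosure ℚ (AlgebraicClosure ℚ) := by
        convert AlgebraicClosure.instIsAlgClosure ℚ
        · rfl
        · exact Subsingleton.elim _ _
      have := IsAlgClosure.normal ℚ (AlgebraicClosure ℚ)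
      {}
    refine RatFunc.exists_extend_eq fun σ => ?_
    have hσ := h.conj σ
    have hσ2 : ∀ g : AddMonoid.End (E⁄(AlgebraicClosure ℚ)).toAffine.Point, g = conjHom σ f →
        g * g = -(M : AddMonoid.End (E⁄(AlgebraicClosure ℚ)).toAffine.Point) := by
      rintro _ rfl
      ext1 P
      change Affine.Point.map (W' := E) (σ : AlgebraicClosure ℚ →ₐ[ℚ] (AlgebraicClosure ℚ)) (f
        (Affine.Point.map (W' := E) (σ.symm : AlgebraicClosure ℚ →ₐ[ℚ] (AlgebraicClosure ℚ))
        (Affine.Point.map (W' := E) (σ : AlgebraicClosure ℚ →ₐ[ℚ] (AlgebraicClosure ℚ)) (f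
          (Affine.Point.map (W' := E) (σ.symm : AlgebraicClosure ℚ →ₐ[ℚ] (AlgebraicClosure ℚ))
              P))))) = _
      rw [map_symm_map]
      have := congr($hsq (Affine.Point.map (W' := E) (σ.symm : AlgebraicClosure ℚ →ₐ[ℚ]
          (AlgebraicClosure ℚ)) P))
      change f (f _) = _ at this
      rw [this]
      change Affine.Point.map (W' := E) (σ : AlgebraicClosure ℚ →ₐ[ℚ] (AlgebraicClosure ℚ))
        (-((M : AddMonoid.End (E⁄(AlgebraicClosure ℚ)).toAffine.Point) _)) =
        -((M : AddMonoid.End (E⁄(AlgebraicClosure ℚ)).toAffine.Point) P)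
      rw [AddMonoid.End.natCast_apply, AddMonoid.End.natCast_apply, _root_.map_neg, map_nsmul,
        map_map_symm]
    obtain ⟨c', -, hc'⟩ := hσ.exists_tangent
    have hfc' : HasTangent (W := E⁄(AlgebraicClosure ℚ)) (W' := E⁄(AlgebraicClosure ℚ)) (conjHom σ
        f) c' := .inr ⟨_, _, hσ, hc'⟩
    have hc2' := htan (hσ2 _ rfl) hfc'
    rw [← hc2, sq_eq_sq_iff_eq_or_eq_neg] at hc2'
    rcases hc2' with rfl | rfl
    · rw [hfc'.ext hfc] at hσ
      exact (hσ.unique h).1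
    · rw [hfc'.ext hfc.neg] at hσ
      exact (hσ.unique h.neg).1
  -- Since `c² = -M`, this is a square root of `d`, chosen so that the irrationality of the twist
  -- isomorphism cancels that of `s`.
  set u : AlgebraicClosure ℚ := algebraMap ℚ (AlgebraicClosure ℚ) e * c with hu
  have hu2 : u ^ 2 = algebraMap ℚ (AlgebraicClosure ℚ) d := by
    rw [hu, mul_pow, hc2, hd]
    simp
  have hsc := isScaling_quadraticTwist (E := E) hd0 hu2
  have hφ := hsc.rep_comp h
  -- Because `s = r'/c`, the second coordinate function `u³ s` becomes `d e r'`, which has rational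
  -- coefficients.
  have hs : s = RatFunc.C c⁻¹ * extend ℚ (AlgebraicClosure ℚ) (RatFunc.deriv r₀) := by
    rw [← RatFunc.deriv_extend, hc, ← mul_assoc, ← map_mul, inv_mul_cancel₀ hc0, map_one, one_mul]
  have e1 : RatFunc.C (u ^ 2) * extend ℚ (AlgebraicClosure ℚ) r₀ = extend ℚ (AlgebraicClosure ℚ)
      (RatFunc.C d * r₀) := by
    rw [map_mul, RatFunc.extend_C, hu2]
  have e2 : RatFunc.C (u ^ 3) * s = extend ℚ (AlgebraicClosure ℚ) (RatFunc.C (d * e) * RatFunc.deriv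
      r₀) := by
    rw [map_mul, RatFunc.extend_C, hs, ← mul_assoc, ← map_mul, map_mul (algebraMap ℚ
        (AlgebraicClosure ℚ)), ← hu2, hu]
    congr 2
    field_simp
  rw [e1, e2] at hφ
  obtain ⟨φ, -, hdeg⟩ := hφ.exists_isogeny (W := E) (W' := E.quadraticTwist d)
  refine ⟨φ, ?_⟩
  rw [hdeg, RatFunc.height_C_mul hd0, ← RatFunc.height_extend (L := AlgebraicClosure ℚ), ←
      h.homDeg_eq]
  exact homDeg_of_sq_eq_neg hf hsq

/-- An isogeny to a nontrivial quadratic twist gives rise to complex multiplication. -/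
theorem hasCM_of_isogeny {d : ℚ} (hd : ¬IsSquare d)
    (φ : Isogeny ℚ (AlgebraicClosure ℚ) E (E.quadraticTwist d)) : E.HasCM := by
  have hd0 : d ≠ 0 := by
    rintro rfl
    exact hd ⟨0, by simp⟩
  have := E.quadraticTwist_isElliptic hd0
  obtain ⟨r, s, h⟩ := φ.exists_rep
  obtain ⟨c, hc0, hc⟩ := h.exists_tangent
  -- The constant `r'/s` is a ratio of functions with rational coefficients, hence a rational
  -- number.
  obtain ⟨q, rfl⟩ : ∃ q : ℚ, c = algebraMap ℚ (AlgebraicClosure ℚ) q := by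
    have e1 : extend ℚ (AlgebraicClosure ℚ) (RatFunc.deriv r / s) = RatFunc.C c := by
      rw [map_div₀, ← RatFunc.deriv_extend, hc, mul_div_cancel_right₀ _ h.s_ne_zero]
    obtain ⟨q, hq⟩ := (RatFunc.height_eq_zero (r := RatFunc.deriv r / s)).mp <| by
      rw [← RatFunc.height_extend (L := AlgebraicClosure ℚ), e1]
      exact RatFunc.height_eq_zero.mpr ⟨c, rfl⟩
    rw [hq, RatFunc.extend_C] at e1
    exact ⟨q, (RatFunc.C_injective e1).symm⟩
  obtain ⟨u, hu⟩ := IsAlgClosed.exists_pow_nat_eq (algebraMap ℚ (AlgebraicClosure ℚ) d) two_pos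
  have hsc := (isScaling_quadraticTwist (E := E) hd0 hu).inv
  -- The geometric isomorphism from the twist back to `E` acts by `u = √d`, so the composite
  -- endomorphism acts by `u q`.
  have htan := hsc.hasTangent.comp (.inr ⟨_, _, h, hc⟩)
  refine ⟨hsc.hom.comp φ.toHom, mem_geometricEnd_iff.mpr htan.isRegularHom, fun m => ?_⟩
  by_contra! hm
  have h2 := (HasTangent.id (W := E⁄(AlgebraicClosure ℚ))).zsmul m
  have h3 : m • AddMonoidHom.id (E⁄(AlgebraicClosure ℚ)).toAffine.Point = hsc.hom.comp φ.toHom := by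
    ext P
    exact (show _ = m • P by simp).trans (hm P).symm
  rw [h3] at h2
  have h4 := htan.unique h2
  rw [inv_inv, mul_one] at h4
  -- If the endomorphism were the integer `m`, then `u q = m`, so `d = (m/q)²` would be a square.
  have h5 : algebraMap ℚ (AlgebraicClosure ℚ) (d * q ^ 2) = algebraMap ℚ (AlgebraicClosure ℚ) (m ^
      2) := by
    rw [map_mul, ← hu, map_pow, map_pow, ← mul_pow, h4]
    simp
  have h6 := (algebraMap ℚ (AlgebraicClosure ℚ)).injective h5
  have hq : q ≠ 0 := by
    rintro rfl
    simp at hc0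
  refine hd ⟨m / q, ?_⟩
  field_simp
  linear_combination h6

/-- A curve with complex multiplication has an isogeny to a nontrivial quadratic twist. -/
theorem HasCM.exists_isogeny (h : E.HasCM) :
    ∃ d : ℚ, ¬IsSquare d ∧ Nonempty (Isogeny ℚ (AlgebraicClosure ℚ) E (E.quadraticTwist d)) := by
  obtain ⟨f, hf, hne⟩ := h
  obtain ⟨g, hg, M, hM, hsq⟩ := exists_sq_eq_neg (mem_geometricEnd_iff.mp hf) fun m h => by
    obtain ⟨P, hP⟩ := hne m
    exact hP (by rw [h]; simp)
  obtain ⟨φ, -⟩ := exists_isogeny_quadraticTwist hg hM hsq one_ne_zero rfl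
  -- The twisting parameter is `-M`, negative and hence not a square.
  refine ⟨_, fun h => ?_, ⟨φ⟩⟩
  have := h.nonneg
  have hM' : (0 : ℚ) < M := by exact_mod_cast hM
  linarith

/-- The square root `δ` of `-D` in the order gives the isogeny of degree `D`. If `D = 4M`, its half
`ε` satisfies `ε² = -M`, and `-D = -(2² M)` makes the target the same twist, reached with `e = 2`.
-/
theorem HasCMBy.exists_isogeny {F : Type*} [Field F] [NumberField F] {O : Subalgebra ℤ F} {D : ℕ}
    (hO : IsImaginaryQuadraticOrder F O (-(D : ℤ))) (h : E.HasCMBy O) :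
    (∃ φ : Isogeny ℚ (AlgebraicClosure ℚ) E (E.quadraticTwist (-(D : ℚ))), φ.degree = D) ∧
      (4 ∣ D → ∃ φ : Isogeny ℚ (AlgebraicClosure ℚ) E (E.quadraticTwist (-(D : ℚ))), φ.degree = D /
          4) := by
  obtain ⟨b, hb⟩ := hO.exists_basis_discr_eq
  obtain ⟨ι, -, hι⟩ := h
  have hreg : ∀ x, ι x ∈ regularEnd (E⁄(AlgebraicClosure ℚ)) := fun x =>
    mem_geometricEnd_iff.mp (hι ▸ Set.mem_range_self x)
  obtain ⟨h0, δ, hδ, hε⟩ := exists_sq_eq_discr b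
  rw [hb] at h0 hδ hε
  have hD : 0 < D := by omega
  refine ⟨?_, fun h4 => ?_⟩
  · refine exists_isogeny_quadraticTwist (hreg δ) hD ?_ one_ne_zero (by ring)
    rw [← map_mul, hδ]
    simp
  · obtain ⟨ε, rfl⟩ := hε (by omega)
    obtain ⟨M, rfl⟩ := h4
    rw [Nat.mul_div_cancel_left _ four_pos]
    refine exists_isogeny_quadraticTwist (hreg ε) (M := M) (by omega) ?_ two_ne_zero
      (by push_cast; ring)
    have h1 : ε * ε = ((-(M : ℤ) : ℤ) : O) := by
      apply mul_left_cancel₀ (by norm_num : (4 : O) ≠ 0)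
      push_cast at hδ ⊢
      linear_combination hδ
    rw [← map_mul, h1]
    simp

end WeierstrassCurve

end

end

theorem lemma4p1 [DecidableEq (AlgebraicClosure ℚ)]
    (E : WeierstrassCurve ℚ) [E.IsElliptic] :
    -- `E` is isogenous over `ℚ` to a nontrivial quadratic twist if and only if `E` has CM
    ((∃ d : ℚ, ¬ IsSquare d ∧
        Nonempty (WeierstrassCurve.Isogeny ℚ (AlgebraicClosure ℚ) E (E.quadraticTwist d))) ↔
      E.HasCM) ∧
    -- the isogenies to the twist by the discriminant of the CM order
    (∀ (F : Type*) [Field F] [NumberField F] (O : Subalgebra ℤ F) (D : ℕ),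
      IsImaginaryQuadraticOrder F O (-(D : ℤ)) → E.HasCMBy O →
        (∃ φ : WeierstrassCurve.Isogeny ℚ (AlgebraicClosure ℚ) E (E.quadraticTwist (-(D : ℚ))),
          φ.degree = D) ∧
        (4 ∣ D →
          ∃ φ : WeierstrassCurve.Isogeny ℚ (AlgebraicClosure ℚ) E (E.quadraticTwist (-(D : ℚ))),
            φ.degree = D / 4)) := by
  refine ⟨⟨fun ⟨d, hd, ⟨φ⟩⟩ => WeierstrassCurve.hasCM_of_isogeny hd φ,
    WeierstrassCurve.HasCM.exists_isogeny⟩, fun F _ _ O D hO h =>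
      WeierstrassCurve.HasCMBy.exists_isogeny hO h⟩
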